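/- **Conventions.** A time scale is a nonempty closed set $\mathbb T\subseteq\mathbb R$, with $\sigma(t)=\inf\{s\in\mathbb T:s>t\}$ and $\rho(t)=\sup\{s\in\mathbb T:s<t\}$ ($\inf\emptyset=\sup\mathbb T$, $\sup\emptyset=\inf\mathbb T$); $\mathbb T^\kappa=\mathbb T\setminus(\rho(\sup\mathbb T),\sup\mathbb T]$ if $\sup\mathbb T<\infty$, and $\mathbb T^\kappa=\mathbb T$ otherwise. For $f:\mathbb T\to\mathbb R$ and $t\in\mathbb T^\kappa$, the delta derivative $f^\Delta(t)$ is the number (if it exists) such that for every $\varepsilon>0$ there is $\delta>0$ with $|f(\sigma(t))-f(s)-f^\Delta(t)(\sigma(t)-s)|\le\varepsilon|\sigma(t)-s|$ for all $s\in\mathbb T\cap(t-\delta,t+\delta)$; partial delta derivatives are taken in one variable with the others fixed. The delta integral is $\int_\alpha^\beta f\,\Delta t=F(\beta)-F(\alpha)$, where $F$ is continuous on $\mathbb T$ and $F^\Delta=f$ on $\mathbb T^\kappa$ except possibly at countably many points, none of them right-scattered (a point $t$ is right-scattered if $\sigma(t)>t$). The exponential $e_f(\cdot,t_0)$ is the solution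 of $x^\Delta=f\,x$ on $\mathbb T^\kappa$, $x(t_0)=1$. **Theorem (Pachpatte's inequality).** Let $\mathbb T_1,\mathbb T_2$ be time scales that contain $0$ and some positive number, and let $S_i=[0,\infty)\cap\mathbb T_i$, with forward jump operator $\sigma_i$ and delta differentiation $\Delta_i$. Let $u,p,q:S_1\times S_2\to[0,\infty)$ be continuous. Let $k:S_1\times S_2\times S_1\times S_2\to[0,\infty)$, $(t_1,t_2,s_1,s_2)\mapsto k(t_1,t_2,s_1,s_2)$, be continuous, and suppose that its partial delta derivatives $k^{\Delta_1}_{t_1}$, $k^{\Delta_2}_{t_2}$ and $k^{\Delta_1\Delta_2}_{t_1t_2}=(k^{\Delta_1}_{t_1})^{\Delta_2}_{t_2}$ exist, are nonnegative and are continuous in $(t_1,t_2,s_1,s_2)$ on $S_1^\kappa\times S_2\times S_1\times S_2$, $S_1\times S_2^\kappa\times S_1\times S_2$ and $S_1^\kappa\times S_2^\kappa\times S_1\times S_2$ respectively. If $$u(t_1,t_2)\le p(t_1,t_2)+q(t_1,t_2)\int_0^{t_1}\!\!\int_0^{t_2}k(t_1,t_2,s_1,s_2)\,u(s_1,s_2)\,\Delta_2s_2\,\Delta_1s_1\qquad\text{for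 all }(t_1,t_2)\in S_1\times S_2,$$ then $$u(t_1,t_2)\le p(t_1,t_2)+q(t_1,t_2)\,A(t_1,t_2)\,e_{c(\cdot,t_2)}(t_1,0)\qquad\text{for all }(t_1,t_2)\in S_1\times S_2,$$ where $$\begin{aligned} a(t_1,t_2)={}&k(\sigma_1(t_1),\sigma_2(t_2),t_1,t_2)\,p(t_1,t_2)+\int_0^{t_2}k^{\Delta_2}_{t_2}(\sigma_1(t_1),t_2,t_1,s_2)\,p(t_1,s_2)\,\Delta_2s_2\\ &+\int_0^{t_1}k^{\Delta_1}_{t_1}(t_1,\sigma_2(t_2),s_1,t_2)\,p(s_1,t_2)\,\Delta_1s_1+\int_0^{t_1}\!\!\int_0^{t_2}k^{\Delta_1\Delta_2}_{t_1t_2}(t_1,t_2,s_1,s_2)\,p(s_1,s_2)\,\Delta_2s_2\,\Delta_1s_1,\\ b(t_1,t_2)={}&\text{the same expression with } q \text{ in place of } p,\\ A(t_1,t_2)={}&\int_0^{t_1}\!\!\int_0^{t_2}a(s_1,s_2)\,\Delta_2s_2\,\Delta_1s_1,\qquad c(t_1,t_2)=\int_0^{t_2}b(t_1,s_2)\,\Delta_2s_2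 \end{aligned}$$ for $(t_1,t_2)\in S_1^\kappa\times S_2^\kappa$ (for $a,b$), $(t_1,t_2)\in S_1\times S_2$ (for $A$) and $(t_1,t_2)\in S_1^\kappa\times S_2$ (for $c$). Here $e_{c(\cdot,t_2)}(\cdot,0)$ is the exponential on $S_1$ of the function $s_1\mapsto c(s_1,t_2)$, with $t_2$ fixed. -/

import Mathlib

namespace TimeScale

/-- A time scale: a nonempty closed subset of the real line. -/
def IsTimeScale (T : Set ℝ) : Prop := T.Nonempty ∧ IsClosed T

/-- The part `ℝ₊ ∩ T` of a set of reals, where `ℝ₊ = [0, ∞)`. -/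
def half (T : Set ℝ) : Set ℝ := Set.Ici 0 ∩ T

open Classical in
/-- Forward jump operator `σ(t) = inf {s ∈ T : s > t}`, with the convention `inf ∅ = sup T`. -/
noncomputable def sigma (T : Set ℝ) (t : ℝ) : ℝ :=
  if {s | s ∈ T ∧ t < s}.Nonempty then sInf {s | s ∈ T ∧ t < s} else sSup T

open Classical in
/-- Backward jump operator `ρ(t) = sup {s ∈ T : s < t}`, with the convention `sup ∅ = inf T`. -/
noncomputable def rho (T : Set ℝ) (t : ℝ) : ℝ :=
  if {s | s ∈ T ∧ s < t}.Nonempty then sSup {s | s ∈ T ∧ s < t} else sInf T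

open Classical in
/-- The set `T^κ`: it is `T \ (ρ(sup T), sup T]` if `sup T < ∞`, and `T` otherwise. -/
noncomputable def kappa (T : Set ℝ) : Set ℝ :=
  if BddAbove T then T \ Set.Ioc (rho T (sSup T)) (sSup T) else T

/-- `d` is a delta (Hilger) derivative at `t` of `f : T → ℝ`. Only the values of `f` on `T`
matter. The number `d` is unique when `t ∈ T^κ`. -/
def HasDeltaDerivAt (T : Set ℝ) (f : ℝ → ℝ) (d t : ℝ) : Prop :=
  ∀ ε > 0, ∃ δ > 0, ∀ s ∈ T, |s - t| < δ →
    |f (sigma T t) - f s - d * (sigma T t - s)| ≤ ε * |sigma T t - s|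

/-- Delta differentiability at `t` (meant for `t ∈ T^κ`). -/
def DeltaDifferentiableAt (T : Set ℝ) (f : ℝ → ℝ) (t : ℝ) : Prop :=
  ∃ d, HasDeltaDerivAt T f d t

open Classical in
/-- The delta derivative `f^Δ(t)` (meant for `t ∈ T^κ`). -/
noncomputable def deltaDeriv (T : Set ℝ) (f : ℝ → ℝ) (t : ℝ) : ℝ :=
  if h : DeltaDifferentiableAt T f t then Classical.choose h else 0

/-- `F` is a pre-antiderivative of `f` on `T`: it is continuous on `T`, and `F^Δ = f` on some
`D ⊆ T^κ` such that `T^κ \ D` is countable and contains no right-scattered point. -/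
def IsPreAntiderivative (T : Set ℝ) (f F : ℝ → ℝ) : Prop :=
  ContinuousOn F T ∧ ∃ D ⊆ kappa T, (kappa T \ D).Countable ∧
    (∀ t ∈ kappa T \ D, ¬ t < sigma T t) ∧ ∀ t ∈ D, HasDeltaDerivAt T F (f t) t

open Classical in
/-- The Cauchy delta integral `∫_a^b f(t) Δt = F(b) - F(a)`, for a pre-antiderivative `F`
of `f` on `T` and `a, b ∈ T`. -/
noncomputable def deltaIntegral (T : Set ℝ) (f : ℝ → ℝ) (a b : ℝ) : ℝ :=
  if h : ∃ F, IsPreAntiderivative T f F then Classical.choose h b - Classical.choose h a else 0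

/-- `x` solves the initial value problem `x^Δ = f x` on `T^κ`, `x(t₀) = 1`. -/
def IsExponential (T : Set ℝ) (f : ℝ → ℝ) (t₀ : ℝ) (x : ℝ → ℝ) : Prop :=
  x t₀ = 1 ∧ ∀ t ∈ kappa T, HasDeltaDerivAt T x (f t * x t) t

open Classical in
/-- The time scale exponential `e_f(t, t₀)`: the solution of `x^Δ = f x`, `x(t₀) = 1`. -/
noncomputable def deltaExp (T : Set ℝ) (f : ℝ → ℝ) (t t₀ : ℝ) : ℝ :=
  if h : ∃ x, IsExponential T f t₀ x then Classical.choose h t else 0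

/-- The iterated integral `∫_0^{t₁} ∫_0^{t₂} f(s₁, s₂) Δ₂s₂ Δ₁s₁`. -/
noncomputable def deltaIntegral₂ (T₁ T₂ : Set ℝ) (f : ℝ → ℝ → ℝ) (t₁ t₂ : ℝ) : ℝ :=
  deltaIntegral T₁ (fun s₁ => deltaIntegral T₂ (fun s₂ => f s₁ s₂) 0 t₂) 0 t₁

/-- The partial delta derivative of `k(t₁, t₂, s₁, s₂)` with respect to `t₁`. -/
noncomputable def partial₁ (T₁ : Set ℝ) (k : ℝ → ℝ → ℝ → ℝ → ℝ) : ℝ → ℝ → ℝ → ℝ → ℝ :=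
  fun t₁ t₂ s₁ s₂ => deltaDeriv T₁ (fun t => k t t₂ s₁ s₂) t₁

/-- The partial delta derivative of `k(t₁, t₂, s₁, s₂)` with respect to `t₂`. -/
noncomputable def partial₂ (T₂ : Set ℝ) (k : ℝ → ℝ → ℝ → ℝ → ℝ) : ℝ → ℝ → ℝ → ℝ → ℝ :=
  fun t₁ t₂ s₁ s₂ => deltaDeriv T₂ (fun t => k t₁ t s₁ s₂) t₂

/-- The mixed second-order partial delta derivative: first in `t₁`, then in `t₂`. -/
noncomputable def partial₁₂ (T₁ T₂ : Set ℝ) (k : ℝ → ℝ → ℝ → ℝ → ℝ) :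
    ℝ → ℝ → ℝ → ℝ → ℝ :=
  partial₂ T₂ (partial₁ T₁ k)

/-- Joint continuity of a function of `(t₁, t₂, s₁, s₂)` on `A × B × C × D`. -/
def JointlyContinuousOn (k : ℝ → ℝ → ℝ → ℝ → ℝ) (A B C D : Set ℝ) : Prop :=
  ContinuousOn (fun x : ℝ × ℝ × ℝ × ℝ => k x.1 x.2.1 x.2.2.1 x.2.2.2) (A ×ˢ B ×ˢ C ×ˢ D)

/-- `k` has the partial delta derivatives in `t₁`, in `t₂` and in `t₁, t₂` wherever these are
meaningful, and `k` and these derivatives are continuous. -/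
structure IsSmoothKernel (T₁ T₂ : Set ℝ) (k : ℝ → ℝ → ℝ → ℝ → ℝ) : Prop where
  cont : JointlyContinuousOn k T₁ T₂ T₁ T₂
  diff₁ : ∀ t₁ ∈ kappa T₁, ∀ t₂ ∈ T₂, ∀ s₁ ∈ T₁, ∀ s₂ ∈ T₂,
    DeltaDifferentiableAt T₁ (fun t => k t t₂ s₁ s₂) t₁
  cont₁ : JointlyContinuousOn (partial₁ T₁ k) (kappa T₁) T₂ T₁ T₂
  diff₂ : ∀ t₁ ∈ T₁, ∀ t₂ ∈ kappa T₂, ∀ s₁ ∈ T₁, ∀ s₂ ∈ T₂,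
    DeltaDifferentiableAt T₂ (fun t => k t₁ t s₁ s₂) t₂
  cont₂ : JointlyContinuousOn (partial₂ T₂ k) T₁ (kappa T₂) T₁ T₂
  diff₁₂ : ∀ t₁ ∈ kappa T₁, ∀ t₂ ∈ kappa T₂, ∀ s₁ ∈ T₁, ∀ s₂ ∈ T₂,
    DeltaDifferentiableAt T₂ (fun t => partial₁ T₁ k t₁ t s₁ s₂) t₂
  cont₁₂ : JointlyContinuousOn (partial₁₂ T₁ T₂ k) (kappa T₁) (kappa T₂) T₁ T₂

/-- The coefficient built from the kernel `k` and a weight `f`; the function `a` of the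
inequality is the case `f = p` and the function `b` is the case `f = q`. -/
noncomputable def coeff (T₁ T₂ : Set ℝ) (k : ℝ → ℝ → ℝ → ℝ → ℝ) (f : ℝ → ℝ → ℝ)
    (t₁ t₂ : ℝ) : ℝ :=
  k (sigma T₁ t₁) (sigma T₂ t₂) t₁ t₂ * f t₁ t₂
  + deltaIntegral T₂ (fun s₂ => partial₂ T₂ k (sigma T₁ t₁) t₂ t₁ s₂ * f t₁ s₂) 0 t₂
  + deltaIntegral T₁ (fun s₁ => partial₁ T₁ k t₁ (sigma T₂ t₂) s₁ t₂ * f s₁ t₂) 0 t₁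
  + deltaIntegral₂ T₁ T₂ (fun s₁ s₂ => partial₁₂ T₁ T₂ k t₁ t₂ s₁ s₂ * f s₁ s₂) t₁ t₂

end TimeScale

/-!
On `S = [0, ∞) ∩ T` delta integration is integration against a measure: the image of Lebesgue
measure under the projection `s ↦ max {r ∈ S | r ≤ s}`, for which `[s, t)` has mass `t - s` when
`s, t ∈ S` (`deltaMeasure`). For the integrands that occur here (`IsDeltaRegular`: locally bounded,
and continuous at the points that are not right-scattered) the indefinite integral against this
measure is an antiderivative, and pre-antiderivatives are unique up to a constant
(`IsHalfScale.eq_of_hasDeltaDerivAt_zero`), so the delta integral, which is defined by an arbitrary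
pre-antiderivative, equals the integral (`IsDeltaRegular.deltaIntegral_eq`). Dominated convergence
and Fubini's theorem then become available.

Let `z(t₁, t₂)` be the double integral of `k(t₁, t₂, s₁, s₂) u(s₁, s₂)`. Expanding `k` by the
fundamental theorem of calculus in `t₁` and in `t₂`, and exchanging the order of integration, shows
that `z` is the double integral of the coefficient function of `k` with weight `u`
(`integral_integral_eq_of_expansions`, `IsKernel.integral_eq_integral_kernelCoeff`). This avoids
differentiating `z`.

Since `k` and its derivatives are nonnegative, `z` is nondecreasing in both variables and the
coefficient function is monotone in its weight. From `u ≤ p + q z` it follows that the coefficient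
function of `u` at `(s₁, s₂)` is at most `a(s₁, s₂) + b(s₁, s₂) z(s₁, t₂)` for `s₂ ≤ t₂`, hence that
`z(t₁, t₂) ≤ A(t₁, t₂) + ∫ c(s₁, t₂) z(s₁, t₂) Δs₁`, where `A` is nondecreasing in its first
variable. The Gronwall inequality (`gronwall`) yields `z ≤ A e_c`. It is proved by iteration, for an
arbitrary solution of the initial value problem, and the same iteration proves that the exponential
exists (`exists_isExponential`).
-/

namespace TimeScale

open MeasureTheory Set Filter Topology

/-! ### The half line part of a time scale: jumps and the set `S^κ` -/

/-- The properties of `S = [0, ∞) ∩ T` that matter: a closed set of nonnegative reals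
containing `0`. -/
structure IsHalfScale (S : Set ℝ) : Prop where
  closed : IsClosed S
  zero_mem : (0 : ℝ) ∈ S
  nonneg : ∀ t ∈ S, 0 ≤ t

lemma isHalfScale_half {T : Set ℝ} (hT : IsTimeScale T) (h0 : (0 : ℝ) ∈ T) :
    IsHalfScale (half T) where
  closed := isClosed_Ici.inter hT.2
  zero_mem := ⟨self_mem_Ici, h0⟩
  nonneg := fun _ ht => ht.1

lemma sigma_le {S : Set ℝ} {t b : ℝ} (hb : b ∈ S) (h : t < b) : sigma S t ≤ b := by
  have hne : {s | s ∈ S ∧ t < s}.Nonempty := ⟨b, hb, h⟩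
  rw [sigma, if_pos hne]
  exact csInf_le ⟨t, fun s hs => hs.2.le⟩ ⟨hb, h⟩

lemma sigma_eq_self_of_isMax {S : Set ℝ} {t : ℝ} (ht : t ∈ S) (h : ∀ s ∈ S, s ≤ t) :
    sigma S t = t := by
  have hne : ¬ {s | s ∈ S ∧ t < s}.Nonempty := by
    rintro ⟨s, hs, hts⟩
    exact absurd (h s hs) (not_le.2 hts)
  rw [sigma, if_neg hne]
  exact IsGreatest.csSup_eq ⟨ht, h⟩

lemma le_sigma {S : Set ℝ} {t : ℝ} (ht : t ∈ S) : t ≤ sigma S t := by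
  by_cases hne : {s | s ∈ S ∧ t < s}.Nonempty
  · rw [sigma, if_pos hne]
    exact le_csInf hne fun s hs => hs.2.le
  · refine (sigma_eq_self_of_isMax ht fun s hs => ?_).ge
    by_contra! hts
    exact hne ⟨s, hs, hts⟩

lemma sigma_mem {S : Set ℝ} (hS : IsClosed S) {t : ℝ} (ht : t ∈ S) : sigma S t ∈ S := by
  by_cases hne : {s | s ∈ S ∧ t < s}.Nonempty
  · rw [sigma, if_pos hne]
    have h := csInf_mem_closure hne ⟨t, fun s hs => hs.2.le⟩
    exact hS.closure_subset_iff.2 (fun s hs => hs.1) h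
  · rw [sigma_eq_self_of_isMax ht fun s hs => ?_]
    · exact ht
    · by_contra! hts
      exact hne ⟨s, hs, hts⟩

lemma exists_gt_of_lt_sigma {S : Set ℝ} {t : ℝ} (ht : t ∈ S) (h : t < sigma S t) :
    ∃ b ∈ S, t < b := by
  by_contra! hne
  exact absurd (sigma_eq_self_of_isMax ht hne) h.ne'

lemma sigma_monotone (S : Set ℝ) : Monotone (sigma S) := by
  intro t t' htt
  by_cases hne' : {s | s ∈ S ∧ t' < s}.Nonempty
  · have hsub : {s | s ∈ S ∧ t' < s} ⊆ {s | s ∈ S ∧ t < s} :=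
      fun s hs => ⟨hs.1, htt.trans_lt hs.2⟩
    rw [sigma, sigma, if_pos hne', if_pos (hne'.mono hsub)]
    exact csInf_le_csInf ⟨t, fun s hs => hs.2.le⟩ hne' hsub
  · have hbdd : BddAbove S := ⟨t', fun s hs => by
      by_contra! h
      exact hne' ⟨s, hs, h⟩⟩
    rw [sigma, sigma, if_neg hne']
    split_ifs with hne
    · obtain ⟨b, hb⟩ := hne
      exact (csInf_le ⟨t, fun s hs => hs.2.le⟩ hb).trans (le_csSup hbdd hb.1)
    · exact le_rfl

lemma kappa_subset (S : Set ℝ) : kappa S ⊆ S := by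
  intro t ht
  rw [kappa] at ht
  split_ifs at ht
  exacts [ht.1, ht]

lemma mem_kappa_of_lt {S : Set ℝ} {t b : ℝ} (ht : t ∈ S) (hb : b ∈ S) (h : t < b) : t ∈ kappa S := by
  rw [kappa]
  split_ifs with hbdd
  · refine ⟨ht, fun hmem => ?_⟩
    have hlt : t < sSup S := h.trans_le (le_csSup hbdd hb)
    have hne : {s | s ∈ S ∧ s < sSup S}.Nonempty := ⟨t, ht, hlt⟩
    rw [rho, if_pos hne] at hmem
    exact absurd (le_csSup ⟨sSup S, fun s hs => hs.2.le⟩ (show t ∈ {s | s ∈ S ∧ s < sSup S}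
      from ⟨ht, hlt⟩)) (not_le.2 hmem.1)
  · exact ht

/-- A point of `S` outside `S^κ` is an isolated maximum of `S`. -/
lemma eventually_eq_of_notMem_kappa {S : Set ℝ} {t : ℝ} (ht : t ∈ S) (hn : t ∉ kappa S) :
    (∀ s ∈ S, s ≤ t) ∧ ∀ᶠ s in 𝓝[S] t, s = t := by
  have hmax : ∀ s ∈ S, s ≤ t := by
    intro s hs
    by_contra! h
    exact hn (mem_kappa_of_lt ht hs h)
  refine ⟨hmax, ?_⟩
  have hbdd : BddAbove S := ⟨t, hmax⟩
  have hsup : sSup S = t := IsGreatest.csSup_eq ⟨ht, hmax⟩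
  rw [kappa, if_pos hbdd, hsup] at hn
  have hmem : t ∈ Ioc (rho S t) t := by
    by_contra h
    exact hn ⟨ht, h⟩
  filter_upwards [self_mem_nhdsWithin, mem_nhdsWithin_of_mem_nhds (Ioi_mem_nhds hmem.1)]
    with s hs hs'
  refine le_antisymm (hmax s hs) ?_
  by_contra! hlt
  have hne : {r | r ∈ S ∧ r < t}.Nonempty := ⟨s, hs, hlt⟩
  have hs'' : rho S t < s := hs'
  rw [rho, if_pos hne] at hs''
  exact absurd (le_csSup ⟨t, fun r hr => hr.2.le⟩ (show s ∈ {r | r ∈ S ∧ r < t} from ⟨hs, hlt⟩))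
    (not_le.2 hs'')

lemma countable_rightScattered (S : Set ℝ) : {t | t ∈ S ∧ t < sigma S t}.Countable := by
  refine (countable_setOfPred_isolated_right_within (s := S)).mono ?_
  rintro t ⟨ht, hσ⟩
  refine ⟨ht, ?_⟩
  rw [← notMem_closure_iff_nhdsWithin_eq_bot]
  intro hcl
  have hsub : S ∩ Ioi t ⊆ Ici (sigma S t) := fun s hs => sigma_le hs.1 hs.2
  exact absurd (isClosed_Ici.closure_subset_iff.2 hsub hcl) (not_le.2 hσ)

namespace IsHalfScale

variable {S : Set ℝ} (hS : IsHalfScale S)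
include hS

lemma isClosed_kappa : IsClosed (kappa S) := by
  by_cases hbdd : BddAbove S
  · have : kappa S = S ∩ Iic (rho S (sSup S)) := by
      ext t
      rw [kappa, if_pos hbdd]
      constructor
      · rintro ⟨ht, hn⟩
        refine ⟨ht, ?_⟩
        by_contra h
        exact hn ⟨not_le.1 h, le_csSup hbdd ht⟩
      · rintro ⟨ht, hle⟩
        exact ⟨ht, fun h => absurd h.1 (not_lt.2 hle)⟩
    rw [this]
    exact hS.closed.inter isClosed_Iic
  · rw [kappa, if_neg hbdd]
    exact hS.closed

/-- The forward jump operator is continuous at points that are not right-scattered. -/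
lemma continuousWithinAt_sigma {t : ℝ} (ht : t ∈ S) (hd : ¬ t < sigma S t) :
    ContinuousWithinAt (sigma S) S t := by
  have hσ : sigma S t = t := le_antisymm (not_lt.1 hd) (le_sigma ht)
  rw [ContinuousWithinAt, hσ]
  by_cases hmax : ∀ s ∈ S, s ≤ t
  · have h1 : Tendsto (fun s : ℝ => s) (𝓝[S] t) (𝓝 t) := nhdsWithin_le_nhds
    refine tendsto_of_tendsto_of_tendsto_of_le_of_le' h1 tendsto_const_nhds ?_ ?_
    · filter_upwards [self_mem_nhdsWithin] with s hs using le_sigma hs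
    · filter_upwards [self_mem_nhdsWithin] with s hs
      exact hmax _ (sigma_mem hS.closed hs)
  · push Not at hmax
    obtain ⟨b, hb, htb⟩ := hmax
    refine tendsto_order.2 ⟨fun c hc => ?_, fun c hc => ?_⟩
    · filter_upwards [self_mem_nhdsWithin, mem_nhdsWithin_of_mem_nhds (Ioi_mem_nhds hc)]
        with s hs hs'
      exact lt_of_lt_of_le hs' (le_sigma hs)
    · -- a point of `S` in `(t, c)` bounds `σ` near `t`
      have hne : {s | s ∈ S ∧ t < s}.Nonempty := ⟨b, hb, htb⟩
      have hinf : sInf {s | s ∈ S ∧ t < s} < c := by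
        have : sigma S t = sInf {s | s ∈ S ∧ t < s} := by rw [sigma, if_pos hne]
        rw [← this, hσ]
        exact hc
      obtain ⟨r, hr, hrc⟩ := exists_lt_of_csInf_lt hne hinf
      filter_upwards [mem_nhdsWithin_of_mem_nhds (Iio_mem_nhds hr.2)] with s hs
      exact (sigma_le hr.1 hs).trans_lt hrc

lemma exists_sigma_le (M : ℝ) : ∃ M', ∀ t ∈ S, t ≤ M → sigma S t ≤ M' := by
  by_cases h : ∃ b ∈ S, M < b
  · obtain ⟨b, hb, hMb⟩ := h
    exact ⟨b, fun t _ htM => sigma_le hb (htM.trans_lt hMb)⟩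
  · push Not at h
    exact ⟨M, fun t ht _ => h _ (sigma_mem hS.closed ht)⟩

end IsHalfScale

/-! ### The delta measure -/

/-- The projection of the half line onto `S`: the largest point of `S` that is
at most `s`, for `s ≥ 0`. -/
noncomputable def proj (S : Set ℝ) (s : ℝ) : ℝ := sSup (S ∩ Iic s)

/-- The delta measure of `S`, the image of Lebesgue measure under the projection onto `S`:
integration over `[s, t)` against it is the delta integral from `s` to `t`. If `S` has a maximum,
this point gets infinite mass; only sets `Iio t` with `t ∈ S` are integrated over. -/
noncomputable def deltaMeasure (S : Set ℝ) : Measure ℝ :=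
  (volume.restrict (Ici 0)).map (proj S)

namespace IsHalfScale

variable {S : Set ℝ} (hS : IsHalfScale S)
include hS

lemma isGreatest_proj {s : ℝ} (hs : 0 ≤ s) : IsGreatest (S ∩ Iic s) (proj S s) :=
  ⟨(hS.closed.inter isClosed_Iic).csSup_mem ⟨0, hS.zero_mem, hs⟩ ⟨s, fun _ h => h.2⟩,
    fun _ hr => le_csSup ⟨s, fun _ h => h.2⟩ hr⟩

lemma proj_of_neg {s : ℝ} (hs : s < 0) : proj S s = 0 := by
  have : S ∩ Iic s = ∅ := by
    ext r
    simp only [mem_inter_iff, mem_Iic, mem_empty_iff_false, iff_false, not_and, not_le]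
    exact fun hr => hs.trans_le (hS.nonneg r hr)
  rw [proj, this, Real.sSup_empty]

lemma proj_mem (s : ℝ) : proj S s ∈ S := by
  rcases lt_or_ge s 0 with h | h
  · rw [hS.proj_of_neg h]
    exact hS.zero_mem
  · exact (hS.isGreatest_proj h).1.1

lemma proj_le {s : ℝ} (hs : 0 ≤ s) : proj S s ≤ s := (hS.isGreatest_proj hs).1.2

lemma le_proj_iff {s t : ℝ} (ht : t ∈ S) (hs : 0 ≤ s) : t ≤ proj S s ↔ t ≤ s :=
  ⟨fun h => h.trans (hS.proj_le hs), fun h => (hS.isGreatest_proj hs).2 ⟨ht, h⟩⟩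

lemma proj_eq_self {t : ℝ} (ht : t ∈ S) : proj S t = t :=
  le_antisymm (hS.proj_le (hS.nonneg t ht)) ((hS.le_proj_iff ht (hS.nonneg t ht)).2 le_rfl)

lemma proj_monotone : Monotone (proj S) := by
  intro s s' h
  rcases lt_or_ge s 0 with h0 | h0
  · rw [hS.proj_of_neg h0]
    exact hS.nonneg _ (hS.proj_mem s')
  · exact (hS.isGreatest_proj (h0.trans h)).2
      ⟨(hS.isGreatest_proj h0).1.1, (hS.proj_le h0).trans h⟩

lemma measurable_proj : Measurable (proj S) := hS.proj_monotone.measurable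

lemma ae_mem : ∀ᵐ s ∂(deltaMeasure S), s ∈ S := by
  exact (ae_map_iff hS.measurable_proj.aemeasurable hS.closed.measurableSet).2
    (ae_of_all _ hS.proj_mem)

lemma deltaMeasure_Ico {s t : ℝ} (hs : s ∈ S) (ht : t ∈ S) :
    deltaMeasure S (Ico s t) = ENNReal.ofReal (t - s) := by
  have : proj S ⁻¹' Ico s t ∩ Ici 0 = Ico s t := by
    ext r
    constructor
    · rintro ⟨⟨h1, h2⟩, h0⟩
      rw [hS.le_proj_iff hs h0] at h1
      rw [← not_le, hS.le_proj_iff ht h0, not_le] at h2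
      exact ⟨h1, h2⟩
    · rintro ⟨h1, h2⟩
      have h0 : 0 ≤ r := (hS.nonneg s hs).trans h1
      refine ⟨⟨(hS.le_proj_iff hs h0).2 h1, ?_⟩, h0⟩
      rw [← not_le, hS.le_proj_iff ht h0, not_le]
      exact h2
  rw [deltaMeasure, Measure.map_apply hS.measurable_proj measurableSet_Ico,
    Measure.restrict_apply (hS.measurable_proj measurableSet_Ico), this, Real.volume_Ico]

lemma ae_nonneg : ∀ᵐ s ∂(deltaMeasure S), 0 ≤ s := hS.ae_mem.mono hS.nonneg

lemma deltaMeasure_Iio {t : ℝ} (ht : t ∈ S) : deltaMeasure S (Iio t) = ENNReal.ofReal t := by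
  have h := hS.deltaMeasure_Ico hS.zero_mem ht
  rw [sub_zero] at h
  rw [← h]
  refine measure_congr ?_
  filter_upwards [hS.ae_nonneg] with s hs
  exact propext ⟨fun h => ⟨hs, h⟩, fun h => h.2⟩

lemma isFiniteMeasure_Iio {t : ℝ} (ht : t ∈ S) :
    IsFiniteMeasure ((deltaMeasure S).restrict (Iio t)) := by
  refine ⟨?_⟩
  rw [Measure.restrict_apply_univ, hS.deltaMeasure_Iio ht]
  exact ENNReal.ofReal_lt_top

lemma ae_mem_kappa {t : ℝ} (ht : t ∈ S) :
    ∀ᵐ s ∂(deltaMeasure S).restrict (Iio t), s ∈ kappa S := by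
  filter_upwards [ae_restrict_of_ae hS.ae_mem, ae_restrict_mem measurableSet_Iio] with s hs hst
  exact mem_kappa_of_lt hs ht hst

/-- A point of `S` that is not right-scattered and not the maximum has delta measure zero. -/
lemma deltaMeasure_singleton {t b : ℝ} (ht : t ∈ S) (hb : b ∈ S) (htb : t < b)
    (hd : ¬ t < sigma S t) : deltaMeasure S {t} = 0 := by
  have hσ : sigma S t = t := le_antisymm (not_lt.1 hd) (le_sigma ht)
  have hne : {s | s ∈ S ∧ t < s}.Nonempty := ⟨b, hb, htb⟩
  refine le_antisymm (ENNReal.le_of_forall_pos_le_add fun ε hε _ => ?_) (zero_le)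
  have hinf : sInf {s | s ∈ S ∧ t < s} < t + ε := by
    have : sigma S t = sInf {s | s ∈ S ∧ t < s} := by rw [sigma, if_pos hne]
    rw [← this, hσ]
    simpa using hε
  obtain ⟨r, hr, hrc⟩ := exists_lt_of_csInf_lt hne hinf
  calc deltaMeasure S {t} ≤ deltaMeasure S (Ico t r) :=
        measure_mono (singleton_subset_iff.2 ⟨le_rfl, hr.2⟩)
    _ = ENNReal.ofReal (r - t) := hS.deltaMeasure_Ico ht hr.1
    _ ≤ ENNReal.ofReal ε := ENNReal.ofReal_le_ofReal (by linarith)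
    _ = 0 + ε := by simp

end IsHalfScale

/-! ### Delta derivatives -/

lemma HasDeltaDerivAt.sub {S : Set ℝ} {f g : ℝ → ℝ} {d e t : ℝ} (hf : HasDeltaDerivAt S f d t)
    (hg : HasDeltaDerivAt S g e t) : HasDeltaDerivAt S (fun s => f s - g s) (d - e) t := by
  intro ε hε
  obtain ⟨δ, hδ, h⟩ := hf (ε / 2) (half_pos hε)
  obtain ⟨δ', hδ', h'⟩ := hg (ε / 2) (half_pos hε)
  refine ⟨min δ δ', lt_min hδ hδ', fun s hs hst => ?_⟩
  have h1 := h s hs (hst.trans_le (min_le_left _ _))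
  have h2 := h' s hs (hst.trans_le (min_le_right _ _))
  calc _ = |(f (sigma S t) - f s - d * (sigma S t - s))
          - (g (sigma S t) - g s - e * (sigma S t - s))| := by ring_nf
    _ ≤ _ := abs_sub _ _
    _ ≤ ε * |sigma S t - s| := by linarith

/-- Testing the delta derivative at `s = t`. -/
lemma HasDeltaDerivAt.apply_sigma {S : Set ℝ} {f : ℝ → ℝ} {d t : ℝ} (ht : t ∈ S)
    (hf : HasDeltaDerivAt S f d t) : f (sigma S t) - f t = d * (sigma S t - t) := by
  rcases (le_sigma ht).eq_or_lt with h | h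
  · rw [← h]
    ring
  refine sub_eq_zero.1 (abs_nonpos_iff.1 (le_of_forall_pos_le_add fun ε hε => ?_))
  have hpos : 0 < sigma S t - t := sub_pos.2 h
  obtain ⟨δ, hδ, hb⟩ := hf (ε / (sigma S t - t)) (div_pos hε hpos)
  have := hb t ht (by simpa using hδ)
  rw [abs_of_pos hpos, div_mul_cancel₀ _ hpos.ne'] at this
  linarith

lemma HasDeltaDerivAt.continuousWithinAt {S : Set ℝ} {f : ℝ → ℝ} {d t : ℝ} (ht : t ∈ S)
    (hf : HasDeltaDerivAt S f d t) : ContinuousWithinAt f S t := by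
  rw [Metric.continuousWithinAt_iff]
  intro ε hε
  set μ := sigma S t - t with hμ
  have hμ0 : 0 ≤ μ := sub_nonneg.2 (le_sigma ht)
  obtain ⟨η, hη, hηε⟩ : ∃ η > 0, η * (μ + 1 + |d| + 1) < ε := by
    refine ⟨ε / (2 * (μ + 1 + |d| + 1)), by positivity, ?_⟩
    rw [div_mul_eq_mul_div, div_lt_iff₀ (by positivity)]
    nlinarith [abs_nonneg d, mul_pos hε (show 0 < μ + 1 + |d| + 1 by positivity)]
  obtain ⟨δ, hδ, hb⟩ := hf η hη
  refine ⟨min δ (min 1 η), by positivity, fun s hs hst => ?_⟩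
  rw [Real.dist_eq] at hst ⊢
  have h1 := hb s hs (hst.trans_le (min_le_left _ _))
  have h2 : |s - t| < 1 := hst.trans_le ((min_le_right _ _).trans (min_le_left _ _))
  have h3 : |s - t| < η := hst.trans_le ((min_le_right _ _).trans (min_le_right _ _))
  have h4 := hf.apply_sigma ht
  have h5 : |sigma S t - s| ≤ μ + 1 := by
    calc |sigma S t - s| = |μ - (s - t)| := by rw [hμ]; ring_nf
      _ ≤ |μ| + |s - t| := abs_sub _ _
      _ ≤ μ + 1 := by rw [abs_of_nonneg hμ0]; linarith
  have h6 : f s - f t = -(f (sigma S t) - f s - d * (sigma S t - s)) + d * (s - t) := by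
    linear_combination h4
  calc |f s - f t| ≤ |f (sigma S t) - f s - d * (sigma S t - s)| + |d * (s - t)| := by
        rw [h6]
        refine (abs_add_le _ _).trans ?_
        rw [abs_neg]
    _ ≤ η * (μ + 1) + |d| * η := by
        rw [abs_mul]
        gcongr
        exact h1.trans (by gcongr)
    _ ≤ η * (μ + 1 + |d| + 1) := by nlinarith
    _ < ε := hηε

lemma DeltaDifferentiableAt.hasDeltaDerivAt {S : Set ℝ} {f : ℝ → ℝ} {t : ℝ}
    (h : DeltaDifferentiableAt S f t) : HasDeltaDerivAt S f (deltaDeriv S f t) t := by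
  rw [deltaDeriv, dif_pos h]
  exact Classical.choose_spec h

/-! ### Functions with a delta integral -/

/-- A class of integrands that is stable under composition with the forward jump operator: the
functions that are continuous at every point of `S^κ` that is not right-scattered and are bounded
on bounded parts of `S^κ`. It contains the rd-continuous functions. -/
structure IsDeltaRegular (S : Set ℝ) (f : ℝ → ℝ) : Prop where
  cont : ∀ t ∈ kappa S, ¬ t < sigma S t → ContinuousWithinAt f (kappa S) t
  bdd : ∀ M, ∃ C, ∀ t ∈ kappa S, t ≤ M → |f t| ≤ C

namespace IsDeltaRegular

variable {S : Set ℝ} {f g : ℝ → ℝ}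

lemma congr (hf : IsDeltaRegular S f) (h : ∀ t ∈ kappa S, g t = f t) : IsDeltaRegular S g where
  cont := fun t ht hd => (hf.cont t ht hd).congr h (h t ht)
  bdd := fun M => by
    obtain ⟨C, hC⟩ := hf.bdd M
    exact ⟨C, fun t ht htM => (h t ht).symm ▸ hC t ht htM⟩

lemma mul (hf : IsDeltaRegular S f) (hg : IsDeltaRegular S g) :
    IsDeltaRegular S (fun t => f t * g t) where
  cont := fun t ht hd => (hf.cont t ht hd).mul (hg.cont t ht hd)
  bdd := fun M => by
    obtain ⟨C, hC⟩ := hf.bdd M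
    obtain ⟨C', hC'⟩ := hg.bdd M
    refine ⟨C * C', fun t ht htM => ?_⟩
    rw [abs_mul]
    exact mul_le_mul (hC t ht htM) (hC' t ht htM) (abs_nonneg _)
      ((abs_nonneg _).trans (hC t ht htM))

lemma of_continuousOn (hS : IsHalfScale S) (hf : ContinuousOn f (kappa S)) :
    IsDeltaRegular S f where
  cont := fun t ht _ => hf t ht
  bdd := fun M => by
    have hc : IsCompact (kappa S ∩ Icc 0 M) := isCompact_Icc.inter_left hS.isClosed_kappa
    obtain ⟨C, hC⟩ := hc.exists_bound_of_continuousOn (hf.mono inter_subset_left)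
    exact ⟨C, fun t ht htM => hC t ⟨ht, hS.nonneg t (kappa_subset S ht), htM⟩⟩

lemma aestronglyMeasurable (hS : IsHalfScale S) (hf : IsDeltaRegular S f) {t : ℝ} (ht : t ∈ S) :
    AEStronglyMeasurable f ((deltaMeasure S).restrict (Iio t)) := by
  set μ := (deltaMeasure S).restrict (Iio t)
  set Q := {t | t ∈ S ∧ t < sigma S t}
  have hQ : Q.Countable := countable_rightScattered S
  have hae : ∀ᵐ s ∂μ, s ∈ (kappa S \ Q) ∪ Q := by
    filter_upwards [hS.ae_mem_kappa ht] with s hs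
    by_cases h : s ∈ Q
    exacts [Or.inr h, Or.inl ⟨hs, h⟩]
  rw [← Measure.restrict_eq_self_of_ae_mem hae]
  refine aestronglyMeasurable_union_iff.2 ⟨?_, ?_⟩
  · refine ContinuousOn.aestronglyMeasurable (fun s hs => ?_)
      (hS.isClosed_kappa.measurableSet.diff hQ.measurableSet)
    exact (hf.cont s hs.1 fun h => hs.2 ⟨kappa_subset S hs.1, h⟩).mono sdiff_subset
  · rw [← biUnion_of_singleton Q, biUnion_eq_iUnion]
    have := hQ.to_subtype
    refine aestronglyMeasurable_iUnion_iff.2 fun x => ?_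
    rw [Measure.restrict_singleton]
    exact aestronglyMeasurable_dirac.smul_measure _

lemma exists_ae_bound (hS : IsHalfScale S) (hf : IsDeltaRegular S f) {t : ℝ} (ht : t ∈ S) :
    ∃ C, ∀ᵐ s ∂(deltaMeasure S).restrict (Iio t), ‖f s‖ ≤ C := by
  obtain ⟨C, hC⟩ := hf.bdd t
  refine ⟨C, ?_⟩
  filter_upwards [hS.ae_mem_kappa ht, ae_restrict_mem measurableSet_Iio] with s hs hst
  exact hC s hs (le_of_lt hst)

lemma integrableOn (hS : IsHalfScale S) (hf : IsDeltaRegular S f) {t : ℝ} (ht : t ∈ S) :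
    IntegrableOn f (Iio t) (deltaMeasure S) := by
  have := hS.isFiniteMeasure_Iio ht
  obtain ⟨C, hC⟩ := hf.exists_ae_bound hS ht
  exact Integrable.of_bound (hf.aestronglyMeasurable hS ht) C hC

lemma integral_Iio_sub (hS : IsHalfScale S) (hf : IsDeltaRegular S f) {s t : ℝ} (ht : t ∈ S)
    (hst : s ≤ t) :
    (∫ r in Iio t, f r ∂deltaMeasure S) - ∫ r in Iio s, f r ∂deltaMeasure S
      = ∫ r in Ico s t, f r ∂deltaMeasure S := by
  have hi := hf.integrableOn hS ht
  rw [← Iio_union_Ico_eq_Iio hst, setIntegral_union ?_ measurableSet_Ico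
    (hi.mono_set (Iio_subset_Iio hst)) (hi.mono_set Ico_subset_Iio_self)]
  · ring
  · exact Set.disjoint_left.2 fun x hx hx' => absurd hx'.1 (not_le.2 hx)

/-- If an integrand is within `ε` of `d` between `s` and `t`, the slope of its integral is within
`ε` of `d`. -/
lemma abs_integral_sub_le (hS : IsHalfScale S) (hf : IsDeltaRegular S f) {s t d ε : ℝ}
    (hs : s ∈ S) (ht : t ∈ S) (hst : s ≤ t)
    (h : ∀ r ∈ kappa S, s ≤ r → r < t → |f r - d| ≤ ε) :
    |(∫ r in Iio t, f r ∂deltaMeasure S) - (∫ r in Iio s, f r ∂deltaMeasure S) - d * (t - s)|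
      ≤ ε * (t - s) := by
  have hm := hS.deltaMeasure_Ico hs ht
  have hreal : (deltaMeasure S).real (Ico s t) = t - s := by
    rw [Measure.real, hm, ENNReal.toReal_ofReal (sub_nonneg.2 hst)]
  have hfin : deltaMeasure S (Ico s t) < ⊤ := by
    rw [hm]
    exact ENNReal.ofReal_lt_top
  have hi : IntegrableOn f (Ico s t) (deltaMeasure S) :=
    (hf.integrableOn hS ht).mono_set Ico_subset_Iio_self
  have heq : (∫ r in Iio t, f r ∂deltaMeasure S) - (∫ r in Iio s, f r ∂deltaMeasure S)
      - d * (t - s) = ∫ r in Ico s t, (f r - d) ∂deltaMeasure S := by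
    rw [hf.integral_Iio_sub hS ht hst, integral_sub hi (integrableOn_const hfin.ne),
      setIntegral_const, hreal, smul_eq_mul, mul_comm]
  rw [heq, ← hreal]
  refine norm_setIntegral_le_of_norm_le_const_ae (f := fun r => f r - d) hfin ?_
  filter_upwards [ae_restrict_of_ae hS.ae_mem, ae_restrict_mem measurableSet_Ico] with r hr hr'
  exact h r (mem_kappa_of_lt hr ht hr'.2) hr'.1 hr'.2

lemma continuousOn_integral (hS : IsHalfScale S) (hf : IsDeltaRegular S f) :
    ContinuousOn (fun t => ∫ r in Iio t, f r ∂deltaMeasure S) S := by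
  intro t ht
  rw [Metric.continuousWithinAt_iff]
  intro ε hε
  obtain ⟨C, hC⟩ := hf.bdd (t + 1)
  have key : ∀ a ∈ S, ∀ b ∈ S, a ≤ b → b ≤ t + 1 →
      |(∫ r in Iio b, f r ∂deltaMeasure S) - ∫ r in Iio a, f r ∂deltaMeasure S|
        ≤ |C| * (b - a) := by
    intro a ha b hb hab hbt
    have := hf.abs_integral_sub_le hS (d := 0) (ε := |C|) ha hb hab fun r hr _ hrb => by
      rw [sub_zero]
      exact (hC r hr (hrb.le.trans hbt)).trans (le_abs_self C)
    simpa using this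
  refine ⟨min 1 (ε / (|C| + 1)), by positivity, fun s hs hst => ?_⟩
  rw [Real.dist_eq] at hst ⊢
  have h1 : |s - t| < 1 := hst.trans_le (min_le_left _ _)
  have h2 : |s - t| < ε / (|C| + 1) := hst.trans_le (min_le_right _ _)
  rw [lt_div_iff₀ (by positivity)] at h2
  have h3 : |(∫ r in Iio s, f r ∂deltaMeasure S) - ∫ r in Iio t, f r ∂deltaMeasure S|
      ≤ |C| * |s - t| := by
    rcases le_total s t with h | h
    · rw [abs_sub_comm, abs_sub_comm s, abs_of_nonneg (sub_nonneg.2 h)]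
      exact key s hs t ht h (by linarith)
    · rw [abs_of_nonneg (sub_nonneg.2 h)]
      exact key t ht s hs h (by linarith [(abs_lt.1 h1).2])
  nlinarith [abs_nonneg (s - t)]

/-- The fundamental theorem of calculus: the indefinite integral has the integrand as its delta
derivative, at every point of `S^κ`. -/
lemma hasDeltaDerivAt_integral (hS : IsHalfScale S) (hf : IsDeltaRegular S f) {t : ℝ}
    (ht : t ∈ kappa S) :
    HasDeltaDerivAt S (fun t => ∫ r in Iio t, f r ∂deltaMeasure S) (f t) t := by
  have htS := kappa_subset S ht
  intro ε hε
  by_cases hd : t < sigma S t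
  · have hσS := sigma_mem hS.closed htS
    have hσ := hf.abs_integral_sub_le hS (d := f t) (ε := 0) htS hσS hd.le fun r hr h1 h2 => by
      have : r = t := by
        refine le_antisymm ?_ h1
        by_contra! h
        exact absurd (sigma_le (kappa_subset S hr) h) (not_le.2 h2)
      simp [this]
    rw [zero_mul] at hσ
    have hσ' := abs_nonpos_iff.1 hσ
    have hμ : 0 < sigma S t - t := sub_pos.2 hd
    -- continuity at `t` controls the remaining difference
    have hcont := hf.continuousOn_integral hS t htS
    rw [Metric.continuousWithinAt_iff] at hcont
    obtain ⟨δ, hδ, hδ'⟩ := hcont (ε * (sigma S t - t) / 2) (by positivity)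
    refine ⟨min (min δ (sigma S t - t)) (ε * (sigma S t - t) / (2 * (|f t| + 1))),
      by positivity, fun s hs hst => ?_⟩
    have h1 : |s - t| < δ := hst.trans_le ((min_le_left _ _).trans (min_le_left _ _))
    have h2 : |s - t| < sigma S t - t :=
      hst.trans_le ((min_le_left _ _).trans (min_le_right _ _))
    have h3 := hst.trans_le (min_le_right _ _)
    have hle : s ≤ t := by
      by_contra! h
      have := sigma_le hs h
      rw [abs_of_pos (sub_pos.2 h)] at h2
      linarith
    have h4 := hδ' hs h1
    rw [Real.dist_eq] at h4
    rw [lt_div_iff₀ (by positivity)] at h3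
    have h5 : |f t * (s - t)| ≤ ε * (sigma S t - t) / 2 := by
      rw [abs_mul]
      nlinarith [abs_nonneg (f t), abs_nonneg (s - t)]
    have h6 : ε * (sigma S t - t) ≤ ε * |sigma S t - s| := by
      gcongr
      exact le_trans (by linarith) (le_abs_self _)
    refine le_trans ?_ h6
    dsimp only
    have h7 : (∫ r in Iio (sigma S t), f r ∂deltaMeasure S)
          - (∫ r in Iio s, f r ∂deltaMeasure S) - f t * (sigma S t - s)
        = f t * (s - t) - ((∫ r in Iio s, f r ∂deltaMeasure S)
          - ∫ r in Iio t, f r ∂deltaMeasure S) := by linear_combination hσ'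
    rw [h7]
    exact (abs_sub _ _).trans (by linarith)
  · have hσ : sigma S t = t := le_antisymm (not_lt.1 hd) (le_sigma htS)
    have hc := hf.cont t ht hd
    rw [Metric.continuousWithinAt_iff] at hc
    obtain ⟨δ, hδ, hδ'⟩ := hc ε hε
    refine ⟨δ, hδ, fun s hs hst => ?_⟩
    rw [hσ]
    dsimp only
    rw [abs_lt] at hst
    rcases le_total s t with h | h
    · rw [abs_of_nonneg (sub_nonneg.2 h)]
      refine hf.abs_integral_sub_le hS hs htS h fun r hr h1 h2 => ?_
      exact (hδ' hr (by rw [Real.dist_eq, abs_lt]; constructor <;> linarith)).le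
    · rw [abs_sub_comm t s, abs_of_nonneg (sub_nonneg.2 h)]
      have := hf.abs_integral_sub_le hS (d := f t) (ε := ε) htS hs h fun r hr h1 h2 =>
        (hδ' hr (by rw [Real.dist_eq, abs_lt]; constructor <;> linarith)).le
      rw [← abs_neg]
      convert this using 2
      ring

end IsDeltaRegular

/-! ### Uniqueness of pre-antiderivatives -/

/-- A continuous function on `S` with delta derivative `0` off a countable set without
right-scattered points is constant. Its composition with the projection onto `S` is continuous and
has derivative `0` off a countable set of reals, so that the fundamental theorem of calculus on the
line applies. -/
lemma IsHalfScale.eq_of_hasDeltaDerivAt_zero {S : Set ℝ} (hS : IsHalfScale S) {H : ℝ → ℝ}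
    (hc : ContinuousOn H S) {D : Set ℝ} (hcount : (kappa S \ D).Countable)
    (hrs : ∀ t ∈ kappa S \ D, ¬ t < sigma S t) (hder : ∀ t ∈ D, HasDeltaDerivAt S H 0 t)
    {b : ℝ} (hb : b ∈ S) : H b = H 0 := by
  have hσ : ∀ p ∈ S, p < sigma S p → H (sigma S p) = H p := by
    intro p hp hlt
    obtain ⟨c, hcS, hpc⟩ := exists_gt_of_lt_sigma hp hlt
    have hpD : p ∈ D := by
      by_contra h
      exact hrs p ⟨mem_kappa_of_lt hp hcS hpc, h⟩ hlt
    have := (hder p hpD).apply_sigma hp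
    linarith
  -- on either side of `t`, the value at `s` is a value of `H` at a point of `S` no farther from `t`
  have hclose : ∀ t ∈ S, ∀ s, 0 ≤ s → ∃ r ∈ S, |r - t| ≤ |s - t| ∧ H (proj S s) = H r := by
    intro t ht s hs
    rcases le_or_gt t s with h | h
    · refine ⟨proj S s, hS.proj_mem s, ?_, rfl⟩
      have h1 := (hS.le_proj_iff ht hs).2 h
      have h2 := hS.proj_le hs
      rw [abs_of_nonneg (sub_nonneg.2 h1), abs_of_nonneg (sub_nonneg.2 h)]
      linarith
    · rcases (hS.proj_le hs).eq_or_lt with he | hlt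
      · exact ⟨s, he ▸ hS.proj_mem s, le_rfl, by rw [he]⟩
      · have hp := hS.proj_mem s
        have h1 : s ≤ sigma S (proj S s) := by
          have hne : {r | r ∈ S ∧ proj S s < r}.Nonempty := ⟨t, ht, hlt.trans h⟩
          rw [sigma, if_pos hne]
          refine le_csInf hne fun r hr => ?_
          by_contra! hrs'
          exact absurd ((hS.le_proj_iff hr.1 hs).2 hrs'.le) (not_le.2 hr.2)
        refine ⟨sigma S (proj S s), sigma_mem hS.closed hp, ?_, (hσ _ hp (hlt.trans_le h1)).symm⟩
        have h2 : sigma S (proj S s) ≤ t := sigma_le ht (hlt.trans h)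
        rw [abs_sub_comm, abs_of_nonneg (sub_nonneg.2 h2), abs_sub_comm,
          abs_of_nonneg (sub_nonneg.2 h.le)]
        linarith
  have hconst : ∀ t, 0 ≤ t → t ∉ S → ∀ᶠ s in 𝓝 t, proj S s = proj S t := by
    intro t h0 ht
    have hnear : ∀ᶠ s in 𝓝 t, s ∉ S := hS.closed.isOpen_compl.mem_nhds ht
    obtain ⟨a, c, ⟨hat, htc⟩, hsub⟩ := mem_nhds_iff_exists_Ioo_subset.1 hnear
    have hpos : 0 < t := lt_of_le_of_ne h0 fun h => ht (h ▸ hS.zero_mem)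
    filter_upwards [Ioo_mem_nhds hat htc, Ioi_mem_nhds hpos] with s hs hs0
    have hs0' : 0 ≤ s := le_of_lt hs0
    have hout : ∀ r, r ∈ S → r < c → r ≤ a := fun r hr hrc => by
      by_contra! h
      exact hsub ⟨h, hrc⟩ hr
    refine le_antisymm ?_ ?_
    · rw [hS.le_proj_iff (hS.proj_mem s) h0]
      exact (hout _ (hS.proj_mem s) ((hS.proj_le hs0').trans_lt hs.2)).trans hat.le
    · rw [hS.le_proj_iff (hS.proj_mem t) hs0']
      exact (hout _ (hS.proj_mem t) ((hS.proj_le h0).trans_lt htc)).trans hs.1.le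
  have hb0 := hS.nonneg b hb
  have hcont : ContinuousOn (fun s => H (proj S s)) (Icc 0 b) := by
    intro t ht
    by_cases htS : t ∈ S
    · rw [Metric.continuousWithinAt_iff]
      intro ε hε
      obtain ⟨δ, hδ, h⟩ := Metric.continuousWithinAt_iff.1 (hc t htS) ε hε
      refine ⟨δ, hδ, fun s hs hst => ?_⟩
      obtain ⟨r, hr, hrt, he⟩ := hclose t htS s hs.1
      rw [he, hS.proj_eq_self htS]
      exact h hr (hrt.trans_lt hst)
    · refine ContinuousAt.continuousWithinAt ?_
      refine (continuousAt_const (y := H (proj S t))).congr ?_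
      filter_upwards [hconst t ht.1 htS] with s hs
      rw [hs]
  have hderiv : ∀ t ∈ Ioo 0 b \ ({t | t ∈ S ∧ t < sigma S t} ∪ (kappa S \ D)),
      HasDerivAt (fun s => H (proj S s)) ((fun _ => (0 : ℝ)) t) t := by
    rintro t ⟨ht, hn⟩
    by_cases htS : t ∈ S
    · have hd : ¬ t < sigma S t := fun h => hn (Or.inl ⟨htS, h⟩)
      have htD : t ∈ D := by
        by_contra h
        exact hn (Or.inr ⟨mem_kappa_of_lt htS hb ht.2, h⟩)
      have hσt : sigma S t = t := le_antisymm (not_lt.1 hd) (le_sigma htS)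
      rw [hasDerivAt_iff_isLittleO, Asymptotics.isLittleO_iff]
      intro ε hε
      obtain ⟨δ, hδ, h⟩ := hder t htD ε hε
      filter_upwards [Metric.ball_mem_nhds t hδ, Ioi_mem_nhds ht.1] with s hs hs0
      obtain ⟨r, hr, hrt, he⟩ := hclose t htS s (le_of_lt hs0)
      have := h r hr (hrt.trans_lt hs)
      rw [hσt, zero_mul, sub_zero] at this
      rw [he, hS.proj_eq_self htS, smul_zero, sub_zero, Real.norm_eq_abs, Real.norm_eq_abs,
        abs_sub_comm]
      refine this.trans ?_
      rw [abs_sub_comm]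
      gcongr
    · refine (hasDerivAt_const t (H (proj S t))).congr_of_eventuallyEq ?_
      filter_upwards [hconst t ht.1.le htS] with s hs
      rw [hs]
  have := integral_eq_of_hasDerivAt_off_countable_of_le (fun s => H (proj S s)) (fun _ => 0) hb0
    ((countable_rightScattered S).union hcount) hcont hderiv (by simp)
  rw [intervalIntegral.integral_zero, hS.proj_eq_self hb, hS.proj_eq_self hS.zero_mem] at this
  linarith

lemma IsHalfScale.integral_Iio_zero {S : Set ℝ} (hS : IsHalfScale S) (f : ℝ → ℝ) :
    ∫ r in Iio 0, f r ∂deltaMeasure S = 0 := by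
  rw [Measure.restrict_eq_zero.2, integral_zero_measure]
  rw [hS.deltaMeasure_Iio hS.zero_mem, ENNReal.ofReal_zero]

lemma IsPreAntiderivative.sub_eq_integral {S : Set ℝ} (hS : IsHalfScale S) {f F : ℝ → ℝ}
    (hf : IsDeltaRegular S f) (hF : IsPreAntiderivative S f F) {t : ℝ} (ht : t ∈ S) :
    F t - F 0 = ∫ r in Iio t, f r ∂deltaMeasure S := by
  obtain ⟨hFc, D, hD, hcount, hrs, hder⟩ := hF
  have := hS.eq_of_hasDeltaDerivAt_zero (hFc.sub (hf.continuousOn_integral hS)) hcount hrs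
    (fun s hs => by
      have := (hder s hs).sub (hf.hasDeltaDerivAt_integral hS (hD hs))
      rwa [sub_self] at this) ht
  simp only [Pi.sub_apply, hS.integral_Iio_zero, sub_zero] at this
  linarith

/-- The delta integral of a regular function is its integral against the delta measure. -/
lemma IsDeltaRegular.deltaIntegral_eq {S : Set ℝ} (hS : IsHalfScale S) {f : ℝ → ℝ}
    (hf : IsDeltaRegular S f) {t : ℝ} (ht : t ∈ S) :
    deltaIntegral S f 0 t = ∫ r in Iio t, f r ∂deltaMeasure S := by
  have h : ∃ F, IsPreAntiderivative S f F :=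
    ⟨fun t => ∫ r in Iio t, f r ∂deltaMeasure S, hf.continuousOn_integral hS, kappa S,
      Subset.rfl, by simp, by simp, fun t ht => hf.hasDeltaDerivAt_integral hS ht⟩
  rw [deltaIntegral, dif_pos h]
  exact (Classical.choose_spec h).sub_eq_integral hS hf ht

lemma isPreAntiderivative_of_hasDeltaDerivAt {S : Set ℝ} {f F : ℝ → ℝ}
    (h : ∀ t ∈ kappa S, HasDeltaDerivAt S F (f t) t) : IsPreAntiderivative S f F := by
  refine ⟨fun t ht => ?_, kappa S, Subset.rfl, by simp, by simp, h⟩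
  by_cases hk : t ∈ kappa S
  · exact (h t hk).continuousWithinAt ht
  · refine ContinuousWithinAt.congr_of_eventuallyEq (f := fun _ => F t)
      continuousWithinAt_const ?_ rfl
    filter_upwards [(eventually_eq_of_notMem_kappa ht hk).2] with s hs
    rw [hs]

/-- The second fundamental theorem of calculus for delta integrals. -/
lemma IsDeltaRegular.integral_eq_sub {S : Set ℝ} (hS : IsHalfScale S) {f F : ℝ → ℝ}
    (hf : IsDeltaRegular S f) (h : ∀ t ∈ kappa S, HasDeltaDerivAt S F (f t) t) {s t : ℝ}
    (hs : s ∈ S) (ht : t ∈ S) (hst : s ≤ t) :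
    ∫ r in Ico s t, f r ∂deltaMeasure S = F t - F s := by
  have hF := isPreAntiderivative_of_hasDeltaDerivAt h
  rw [← hf.integral_Iio_sub hS ht hst, ← hF.sub_eq_integral hS hf hs,
    ← hF.sub_eq_integral hS hf ht]
  ring

/-! ### Picard iteration and the Gronwall inequality -/

namespace IsHalfScale

variable {S : Set ℝ} (hS : IsHalfScale S)
include hS

lemma integrableOn_pow {t : ℝ} (ht : t ∈ S) (n : ℕ) :
    IntegrableOn (fun r => r ^ n) (Iio t) (deltaMeasure S) :=
  (IsDeltaRegular.of_continuousOn hS (continuous_pow n).continuousOn).integrableOn hS ht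

/-- The projection onto `S` lies below the identity, so delta integrals of powers are at most the
integrals of powers on the line. -/
lemma integral_pow_le {t : ℝ} (ht : t ∈ S) (n : ℕ) :
    ∫ r in Iio t, r ^ n ∂deltaMeasure S ≤ t ^ (n + 1) / (n + 1) := by
  have ht0 := hS.nonneg t ht
  have hset : proj S ⁻¹' Iio t ∩ Ici 0 = Ico 0 t := by
    ext r
    constructor
    · rintro ⟨h2, h0⟩
      rw [mem_preimage, mem_Iio, ← not_le, hS.le_proj_iff ht h0, not_le] at h2
      exact ⟨h0, h2⟩
    · rintro ⟨h0, h2⟩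
      refine ⟨?_, h0⟩
      rw [mem_preimage, mem_Iio, ← not_le, hS.le_proj_iff ht h0, not_le]
      exact h2
  have h1 : ∫ r in Iio t, r ^ n ∂deltaMeasure S = ∫ r in Ico 0 t, proj S r ^ n := by
    rw [deltaMeasure, setIntegral_map measurableSet_Iio
      (continuous_pow n).aestronglyMeasurable hS.measurable_proj.aemeasurable,
      Measure.restrict_restrict (hS.measurable_proj measurableSet_Iio), hset]
  have h2 : ∫ r in Ico 0 t, r ^ n = t ^ (n + 1) / (n + 1) := by
    rw [integral_Ico_eq_integral_Ioc, ← intervalIntegral.integral_of_le ht0, integral_pow]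
    simp
  rw [h1, ← h2]
  have hint : IntegrableOn (fun r : ℝ => r ^ n) (Ico 0 t) :=
    ((continuous_pow n).continuousOn.integrableOn_compact isCompact_Icc).mono_set
      Ico_subset_Icc_self
  have hle : ∀ r ∈ Ico 0 t, proj S r ^ n ≤ r ^ n := fun r hr =>
    pow_le_pow_left₀ (hS.nonneg _ (hS.proj_mem r)) (hS.proj_le hr.1) n
  refine setIntegral_mono_on ?_ hint measurableSet_Ico hle
  refine Integrable.mono' hint (hS.measurable_proj.pow_const n).aestronglyMeasurable ?_
  filter_upwards [ae_restrict_mem measurableSet_Ico] with r hr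
  rw [Real.norm_eq_abs, abs_of_nonneg (pow_nonneg (hS.nonneg _ (hS.proj_mem r)) n)]
  exact hle r hr

lemma integral_le_of_le_pow {f : ℝ → ℝ} {t B : ℝ} {n : ℕ} (ht : t ∈ S) (hB : 0 ≤ B)
    (hf : IntegrableOn f (Iio t) (deltaMeasure S)) (h : ∀ r ∈ kappa S, r < t → f r ≤ B * r ^ n) :
    ∫ r in Iio t, f r ∂deltaMeasure S ≤ B * (t ^ (n + 1) / (n + 1)) := by
  calc ∫ r in Iio t, f r ∂deltaMeasure S ≤ ∫ r in Iio t, B * r ^ n ∂deltaMeasure S := by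
        refine integral_mono_ae hf ((hS.integrableOn_pow ht n).const_mul B) ?_
        filter_upwards [hS.ae_mem_kappa ht, ae_restrict_mem measurableSet_Iio] with r hr hrt
        exact h r hr hrt
    _ ≤ B * (t ^ (n + 1) / (n + 1)) := by
        rw [integral_const_mul]
        exact mul_le_mul_of_nonneg_left (hS.integral_pow_le ht n) hB

end IsHalfScale

lemma factorial_step (C t : ℝ) (n : ℕ) :
    C * (C ^ n / n.factorial) * (t ^ (n + 1) / (n + 1))
      = (C * t) ^ (n + 1) / (n + 1).factorial := by
  have h1 : (n.factorial : ℝ) ≠ 0 := by positivity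
  have h2 : (n : ℝ) + 1 ≠ 0 := by positivity
  rw [Nat.factorial_succ, mul_pow, Nat.cast_mul, Nat.cast_succ]
  field_simp
  ring

/-- The Picard iterates of `x = 1 + ∫ c x`, as the terms of a series. -/
noncomputable def picardTerm (S : Set ℝ) (c : ℝ → ℝ) : ℕ → ℝ → ℝ
  | 0 => fun _ => 1
  | n + 1 => fun t => ∫ r in Iio t, c r * picardTerm S c n r ∂deltaMeasure S

section Exponential

variable {S : Set ℝ} {c : ℝ → ℝ}

lemma isDeltaRegular_of_continuousOn (hS : IsHalfScale S) {f : ℝ → ℝ} (hf : ContinuousOn f S) :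
    IsDeltaRegular S f :=
  .of_continuousOn hS (hf.mono (kappa_subset S))

lemma continuousOn_picardTerm (hS : IsHalfScale S) (hc : IsDeltaRegular S c) (n : ℕ) :
    ContinuousOn (picardTerm S c n) S := by
  induction n with
  | zero => exact continuousOn_const
  | succ n ih => exact (hc.mul (isDeltaRegular_of_continuousOn hS ih)).continuousOn_integral hS

lemma isDeltaRegular_picard_integrand (hS : IsHalfScale S) (hc : IsDeltaRegular S c) (n : ℕ) :
    IsDeltaRegular S (fun r => c r * picardTerm S c n r) :=
  hc.mul (isDeltaRegular_of_continuousOn hS (continuousOn_picardTerm hS hc n))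

lemma abs_picardTerm_le (hS : IsHalfScale S) (hc : IsDeltaRegular S c) {M C : ℝ} (hC0 : 0 ≤ C)
    (hC : ∀ t ∈ kappa S, t ≤ M → |c t| ≤ C) (n : ℕ) :
    ∀ t ∈ S, t ≤ M → |picardTerm S c n t| ≤ (C * t) ^ n / n.factorial := by
  induction n with
  | zero => simp [picardTerm]
  | succ n ih =>
    intro t ht htM
    have hint := (isDeltaRegular_picard_integrand hS hc n).integrableOn hS ht
    rw [← factorial_step]
    refine (norm_integral_le_integral_norm _).trans
      (hS.integral_le_of_le_pow ht (by positivity) hint.norm fun r hr hrt => ?_)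
    rw [norm_mul, mul_assoc, div_mul_eq_mul_div, ← mul_pow]
    exact mul_le_mul (hC r hr (hrt.le.trans htM)) (ih r (kappa_subset S hr) (hrt.le.trans htM))
      (abs_nonneg _) hC0

lemma exists_abs_le_on_kappa (hc : IsDeltaRegular S c) (M : ℝ) :
    ∃ C, 0 ≤ C ∧ ∀ t ∈ kappa S, t ≤ M → |c t| ≤ C := by
  obtain ⟨C, hC⟩ := hc.bdd M
  exact ⟨|C|, abs_nonneg C, fun t ht htM => (hC t ht htM).trans (le_abs_self C)⟩

lemma continuousOn_picardSeries (hS : IsHalfScale S) (hc : IsDeltaRegular S c) :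
    ContinuousOn (fun t => ∑' n, picardTerm S c n t) S := by
  intro t ht
  obtain ⟨C, hC0, hC⟩ := exists_abs_le_on_kappa hc (t + 1)
  have h : ContinuousOn (fun t => ∑' n, picardTerm S c n t) (S ∩ Iic (t + 1)) := by
    refine continuousOn_tsum
      (fun n => (continuousOn_picardTerm hS hc n).mono inter_subset_left)
      (Real.summable_pow_div_factorial (C * (t + 1))) fun n s hs => ?_
    have h0 := hS.nonneg s hs.1
    exact (abs_picardTerm_le hS hc hC0 hC n s hs.1 hs.2).trans (div_le_div_of_nonneg_right
      (pow_le_pow_left₀ (mul_nonneg hC0 h0) (mul_le_mul_of_nonneg_left hs.2 hC0) n)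
      (Nat.cast_nonneg _))
  refine (h t ⟨ht, by simp⟩).mono_of_mem_nhdsWithin ?_
  exact inter_mem self_mem_nhdsWithin (mem_nhdsWithin_of_mem_nhds (Iic_mem_nhds (by simp)))

lemma picardSeries_eq (hS : IsHalfScale S) (hc : IsDeltaRegular S c) {t : ℝ} (ht : t ∈ S) :
    ∑' n, picardTerm S c n t
      = 1 + ∫ r in Iio t, c r * ∑' n, picardTerm S c n r ∂deltaMeasure S := by
  obtain ⟨C, hC0, hC⟩ := exists_abs_le_on_kappa hc t
  have hsum : ∀ s ∈ S, s ≤ t → Summable fun n => picardTerm S c n s := fun s hs hst =>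
    Summable.of_norm_bounded (Real.summable_pow_div_factorial (C * s))
      fun n => abs_picardTerm_le hS hc hC0 hC n s hs hst
  have hint := fun n => (isDeltaRegular_picard_integrand hS hc n).integrableOn hS ht
  have hnorm : Summable fun n => ∫ r in Iio t, ‖c r * picardTerm S c n r‖ ∂deltaMeasure S := by
    refine Summable.of_nonneg_of_le (fun n => integral_nonneg fun r => norm_nonneg _) (fun n => ?_)
      ((summable_nat_add_iff 1).2 (Real.summable_pow_div_factorial (C * t)))
    rw [← factorial_step]
    refine hS.integral_le_of_le_pow ht (by positivity) (hint n).norm fun r hr hrt => ?_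
    rw [norm_mul, mul_assoc, div_mul_eq_mul_div, ← mul_pow]
    exact mul_le_mul (hC r hr hrt.le)
      (abs_picardTerm_le hS hc hC0 hC n r (kappa_subset S hr) hrt.le) (abs_nonneg _) hC0
  have h := (hasSum_integral_of_summable_integral_norm hint hnorm).tsum_eq
  rw [(hsum t ht le_rfl).tsum_eq_zero_add]
  simp only [picardTerm]
  rw [h]
  simp only [tsum_mul_left]

/-- A regular coefficient has an exponential: the sum of the Picard series. -/
lemma exists_isExponential (hS : IsHalfScale S) (hc : IsDeltaRegular S c) :
    ∃ x, IsExponential S c 0 x := by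
  have hreg := hc.mul (isDeltaRegular_of_continuousOn hS (continuousOn_picardSeries hS hc))
  refine ⟨fun t => ∑' n, picardTerm S c n t, ?_, fun t ht => ?_⟩
  · dsimp only
    rw [picardSeries_eq hS hc hS.zero_mem, hS.integral_Iio_zero, add_zero]
  · have hd := hreg.hasDeltaDerivAt_integral hS ht
    intro ε hε
    obtain ⟨δ, hδ, h⟩ := hd ε hε
    refine ⟨δ, hδ, fun s hs hst => ?_⟩
    dsimp only
    rw [picardSeries_eq hS hc hs,
      picardSeries_eq hS hc (sigma_mem hS.closed (kappa_subset S ht)), add_sub_add_left_eq_sub]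
    exact h s hs hst

lemma isExponential_deltaExp (hS : IsHalfScale S) (hc : IsDeltaRegular S c) :
    IsExponential S c 0 (fun t => deltaExp S c t 0) := by
  have h := exists_isExponential hS hc
  simp only [deltaExp, dif_pos h]
  exact Classical.choose_spec h

lemma IsExponential.continuousOn {x : ℝ → ℝ} (hx : IsExponential S c 0 x) : ContinuousOn x S :=
  (isPreAntiderivative_of_hasDeltaDerivAt (f := fun t => c t * x t) hx.2).1

lemma IsExponential.eq_integral (hS : IsHalfScale S) (hc : IsDeltaRegular S c) {x : ℝ → ℝ}
    (hx : IsExponential S c 0 x) {t : ℝ} (ht : t ∈ S) :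
    x t = 1 + ∫ r in Iio t, c r * x r ∂deltaMeasure S := by
  have h := (isPreAntiderivative_of_hasDeltaDerivAt (f := fun t => c t * x t) hx.2).sub_eq_integral
    hS (hc.mul (isDeltaRegular_of_continuousOn hS hx.continuousOn)) ht
  rw [hx.1] at h
  linarith

/-- The Gronwall inequality in integral form. The difference `w = y - A x` satisfies
`w ≤ ∫ c w`, and iterating this estimate bounds `w` by `B (C t) ^ n / n!` for every `n`. -/
lemma gronwall (hS : IsHalfScale S) (hc : IsDeltaRegular S c) (hc0 : ∀ t ∈ kappa S, 0 ≤ c t)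
    {x : ℝ → ℝ} (hx : IsExponential S c 0 x) {y : ℝ → ℝ} {A T M : ℝ} (hT : T ∈ S)
    (hym : AEStronglyMeasurable y ((deltaMeasure S).restrict (Iio T)))
    (hyM : ∀ t ∈ S, t ≤ T → |y t| ≤ M)
    (hy : ∀ t ∈ S, t ≤ T → y t ≤ A + ∫ r in Iio t, c r * y r ∂deltaMeasure S) :
    y T ≤ A * x T := by
  obtain ⟨C, hC0, hC⟩ := exists_abs_le_on_kappa hc T
  have hxreg := isDeltaRegular_of_continuousOn hS hx.continuousOn
  have hfin := hS.isFiniteMeasure_Iio hT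
  have hyi : IntegrableOn (fun r => c r * y r) (Iio T) (deltaMeasure S) := by
    refine Integrable.of_bound ((hc.aestronglyMeasurable hS hT).mul hym) (C * M) ?_
    filter_upwards [hS.ae_mem_kappa hT, ae_restrict_mem measurableSet_Iio] with r hr hrt
    rw [norm_mul]
    exact mul_le_mul (hC r hr (le_of_lt hrt)) (hyM r (kappa_subset S hr) (le_of_lt hrt))
      (abs_nonneg _) hC0
  have hxi := (hc.mul hxreg).integrableOn hS hT
  have hwi : IntegrableOn (fun r => c r * (y r - A * x r)) (Iio T) (deltaMeasure S) := by
    refine (hyi.sub (hxi.const_mul A)).congr (ae_of_all _ fun r => ?_)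
    simp only [Pi.sub_apply]
    ring
  have hw : ∀ t ∈ S, t ≤ T →
      y t - A * x t ≤ ∫ r in Iio t, c r * (y r - A * x r) ∂deltaMeasure S := by
    intro t ht htT
    have h1 : ∫ r in Iio t, c r * (y r - A * x r) ∂deltaMeasure S
        = (∫ r in Iio t, c r * y r ∂deltaMeasure S)
          - A * ∫ r in Iio t, c r * x r ∂deltaMeasure S := by
      rw [← integral_const_mul, ← integral_sub (hyi.mono_set (Iio_subset_Iio htT))
        ((hxi.mono_set (Iio_subset_Iio htT)).const_mul A)]
      congr 1
      ext r
      ring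
    have h2 := hx.eq_integral hS hc ht
    rw [h1, h2]
    linarith [hy t ht htT]
  obtain ⟨B, hB⟩ : ∃ B, ∀ t ∈ S, t ≤ T → y t - A * x t ≤ B := by
    have hcomp : IsCompact (S ∩ Icc 0 T) := isCompact_Icc.inter_left hS.closed
    obtain ⟨X, hX⟩ := hcomp.exists_bound_of_continuousOn
      (hx.continuousOn.mono inter_subset_left)
    refine ⟨M + |A| * X, fun t ht htT => ?_⟩
    have h1 := (le_abs_self _).trans (hyM t ht htT)
    have h2 : |A * x t| ≤ |A| * X := by
      rw [abs_mul]
      exact mul_le_mul_of_nonneg_left (hX t ⟨ht, hS.nonneg t ht, htT⟩) (abs_nonneg A)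
    linarith [neg_abs_le (A * x t)]
  have hiter : ∀ n : ℕ, ∀ t ∈ S, t ≤ T →
      y t - A * x t ≤ |B| * ((C * t) ^ n / n.factorial) := by
    intro n
    induction n with
    | zero =>
      intro t ht htT
      simpa using (hB t ht htT).trans (le_abs_self B)
    | succ n ih =>
      intro t ht htT
      rw [← factorial_step, ← mul_assoc]
      refine (hw t ht htT).trans (hS.integral_le_of_le_pow ht (by positivity)
        (hwi.mono_set (Iio_subset_Iio htT)) fun r hr hrt => ?_)
      have hrT := hrt.le.trans htT
      have hr0 := hS.nonneg r (kappa_subset S hr)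
      calc c r * (y r - A * x r) ≤ c r * (|B| * ((C * r) ^ n / n.factorial)) :=
            mul_le_mul_of_nonneg_left (ih r (kappa_subset S hr) hrT) (hc0 r hr)
        _ ≤ C * (|B| * ((C * r) ^ n / n.factorial)) :=
            mul_le_mul_of_nonneg_right ((le_abs_self _).trans (hC r hr hrT)) (by positivity)
        _ = |B| * (C * (C ^ n / n.factorial)) * r ^ n := by
            rw [mul_pow]
            ring
  have hlim : Tendsto (fun n : ℕ => |B| * ((C * T) ^ n / n.factorial)) atTop (𝓝 (|B| * 0)) :=
    (FloorSemiring.tendsto_pow_div_factorial_atTop (C * T)).const_mul _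
  rw [mul_zero] at hlim
  have := ge_of_tendsto' hlim fun n => hiter n T hT le_rfl
  linarith

end Exponential

/-! ### Expansion of a double integral by Fubini's theorem -/

/-- Bounded measurable functions, which are integrable for every finite measure. -/
def IsBddMeas {α : Type*} [MeasurableSpace α] (f : α → ℝ) : Prop :=
  Measurable f ∧ ∃ C, ∀ x, |f x| ≤ C

namespace IsBddMeas

variable {α β : Type*} [MeasurableSpace α] [MeasurableSpace β]

lemma comp {f : α → ℝ} (hf : IsBddMeas f) {g : β → α} (hg : Measurable g) :
    IsBddMeas fun x => f (g x) :=
  ⟨hf.1.comp hg, hf.2.imp fun _ h x => h (g x)⟩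

lemma add {f g : α → ℝ} (hf : IsBddMeas f) (hg : IsBddMeas g) : IsBddMeas fun x => f x + g x := by
  obtain ⟨C, hC⟩ := hf.2
  obtain ⟨C', hC'⟩ := hg.2
  exact ⟨hf.1.add hg.1, C + C', fun x => (abs_add_le _ _).trans (add_le_add (hC x) (hC' x))⟩

lemma indicator {f : α → ℝ} (hf : IsBddMeas f) {s : Set α} (hs : MeasurableSet s) :
    IsBddMeas (s.indicator f) := by
  obtain ⟨C, hC⟩ := hf.2
  exact ⟨hf.1.indicator hs, C, fun x => (norm_indicator_le_norm_self f x).trans (hC x)⟩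

lemma integrable {f : α → ℝ} (hf : IsBddMeas f) (μ : Measure α) [IsFiniteMeasure μ] :
    Integrable f μ := by
  obtain ⟨C, hC⟩ := hf.2
  exact Integrable.of_bound hf.1.aestronglyMeasurable C (ae_of_all _ hC)

lemma integral {f : α → β → ℝ} (hf : IsBddMeas fun p : α × β => f p.1 p.2) (μ : Measure β)
    [IsFiniteMeasure μ] : IsBddMeas fun x => ∫ y, f x y ∂μ := by
  obtain ⟨C, hC⟩ := hf.2
  refine ⟨(StronglyMeasurable.integral_prod_right (f := f) hf.1.stronglyMeasurable).measurable,
    C * μ.real univ, fun x => ?_⟩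
  exact norm_integral_le_of_norm_le_const (f := f x) (ae_of_all _ fun y => hC (x, y))

lemma integral_Iio {f : α → ℝ → ℝ} (hf : IsBddMeas fun p : α × ℝ => f p.1 p.2) (μ : Measure ℝ)
    [IsFiniteMeasure μ] {φ : α → ℝ} (hφ : Measurable φ) :
    IsBddMeas fun x => ∫ y in Iio (φ x), f x y ∂μ := by
  have hs : MeasurableSet {p : α × ℝ | p.2 < φ p.1} :=
    measurableSet_lt measurable_snd (hφ.comp measurable_fst)
  have h := IsBddMeas.integral (f := fun x y => {p : α × ℝ | p.2 < φ p.1}.indicator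
    (fun p => f p.1 p.2) (x, y)) (hf.indicator hs) μ
  convert h using 2 with x
  rw [← integral_indicator measurableSet_Iio]
  rfl

lemma integral_Ioi {f : α → ℝ → ℝ} (hf : IsBddMeas fun p : α × ℝ => f p.1 p.2) (μ : Measure ℝ)
    [IsFiniteMeasure μ] {φ : α → ℝ} (hφ : Measurable φ) :
    IsBddMeas fun x => ∫ y in Ioi (φ x), f x y ∂μ := by
  have hs : MeasurableSet {p : α × ℝ | φ p.1 < p.2} :=
    measurableSet_lt (hφ.comp measurable_fst) measurable_snd
  have h := IsBddMeas.integral (f := fun x y => {p : α × ℝ | φ p.1 < p.2}.indicator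
    (fun p => f p.1 p.2) (x, y)) (hf.indicator hs) μ
  convert h using 2 with x
  rw [← integral_indicator measurableSet_Ioi]
  rfl

lemma integral_swap {f : α → β → ℝ} (hf : IsBddMeas fun p : α × β => f p.1 p.2) (μ : Measure α)
    (ν : Measure β) [IsFiniteMeasure μ] [IsFiniteMeasure ν] :
    ∫ x, ∫ y, f x y ∂ν ∂μ = ∫ y, ∫ x, f x y ∂μ ∂ν :=
  integral_integral_swap (hf.integrable _)

/-- Fubini's theorem on the triangle `s < r`. -/
lemma integral_triangle {f : ℝ → ℝ → ℝ} (hf : IsBddMeas fun p : ℝ × ℝ => f p.1 p.2)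
    (μ : Measure ℝ) [IsFiniteMeasure μ] :
    ∫ s, ∫ r in Ioi s, f r s ∂μ ∂μ = ∫ r, ∫ s in Iio r, f r s ∂μ ∂μ := by
  have hs : MeasurableSet {p : ℝ × ℝ | p.2 < p.1} := measurableSet_lt measurable_snd measurable_fst
  have h := IsBddMeas.integral_swap (f := fun r s => {p : ℝ × ℝ | p.2 < p.1}.indicator
    (fun p => f p.1 p.2) (r, s)) (hf.indicator hs) μ μ
  convert h.symm using 3 with s r
  · rw [← integral_indicator measurableSet_Ioi]
    rfl
  · rw [← integral_indicator measurableSet_Iio]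
    rfl

end IsBddMeas

/-- The double integral of a kernel is the double integral of its coefficient function, in the
abstract: `K` is expanded in the first variable into `K1` and the integral of `K11`, then these two
are expanded in the second variable, and the orders of integration are exchanged. -/
lemma integral_integral_eq_of_expansions (μ₁ μ₂ : Measure ℝ) [IsFiniteMeasure μ₁]
    [IsFiniteMeasure μ₂] {K K1 K2 : ℝ → ℝ → ℝ} {K11 K22 K3 : ℝ → ℝ → ℝ → ℝ}
    {K12 : ℝ → ℝ → ℝ → ℝ → ℝ}
    (hK1 : IsBddMeas fun p : ℝ × ℝ => K1 p.1 p.2)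
    (hK2 : IsBddMeas fun p : ℝ × ℝ => K2 p.1 p.2)
    (hK11 : IsBddMeas fun p : ℝ × ℝ × ℝ => K11 p.1 p.2.1 p.2.2)
    (hK22 : IsBddMeas fun p : ℝ × ℝ × ℝ => K22 p.1 p.2.1 p.2.2)
    (hK3 : IsBddMeas fun p : ℝ × ℝ × ℝ => K3 p.1 p.2.1 p.2.2)
    (hK12 : IsBddMeas fun p : ℝ × ℝ × ℝ × ℝ => K12 p.1 p.2.1 p.2.2.1 p.2.2.2)
    (h : ∀ s₁ s₂, K s₁ s₂ = K1 s₁ s₂ + ∫ r₁ in Ioi s₁, K11 r₁ s₁ s₂ ∂μ₁)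
    (h1 : ∀ r₁ s₂, K1 r₁ s₂ = K2 r₁ s₂ + ∫ r₂ in Ioi s₂, K22 r₁ r₂ s₂ ∂μ₂)
    (h11 : ∀ r₁ s₁ s₂, K11 r₁ s₁ s₂ = K3 r₁ s₁ s₂ + ∫ r₂ in Ioi s₂, K12 r₁ r₂ s₁ s₂ ∂μ₂) :
    ∫ s₁, ∫ s₂, K s₁ s₂ ∂μ₂ ∂μ₁ = ∫ r₁, ∫ r₂, (K2 r₁ r₂ + ∫ s₂ in Iio r₂, K22 r₁ r₂ s₂ ∂μ₂
      + ∫ s₁ in Iio r₁, K3 r₁ s₁ r₂ ∂μ₁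
      + ∫ s₁ in Iio r₁, ∫ s₂ in Iio r₂, K12 r₁ r₂ s₁ s₂ ∂μ₂ ∂μ₁) ∂μ₂ ∂μ₁ := by
  have m11 : IsBddMeas fun p : ℝ × ℝ => ∫ r₁ in Ioi p.1, K11 r₁ p.1 p.2 ∂μ₁ :=
    IsBddMeas.integral_Ioi (f := fun (p : ℝ × ℝ) r₁ => K11 r₁ p.1 p.2)
      (hK11.comp (g := fun p : (ℝ × ℝ) × ℝ => (p.2, p.1.1, p.1.2)) (by fun_prop)) μ₁ (by fun_prop)
  have i11 : IsBddMeas fun p : ℝ × ℝ => ∫ s₂, K11 p.1 p.2 s₂ ∂μ₂ :=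
    IsBddMeas.integral (f := fun (p : ℝ × ℝ) s₂ => K11 p.1 p.2 s₂)
      (hK11.comp (g := fun p : (ℝ × ℝ) × ℝ => (p.1.1, p.1.2, p.2)) (by fun_prop)) μ₂
  have m22 : IsBddMeas fun p : ℝ × ℝ => ∫ s₂ in Iio p.2, K22 p.1 p.2 s₂ ∂μ₂ :=
    IsBddMeas.integral_Iio (f := fun (p : ℝ × ℝ) s₂ => K22 p.1 p.2 s₂)
      (hK22.comp (g := fun p : (ℝ × ℝ) × ℝ => (p.1.1, p.1.2, p.2)) (by fun_prop)) μ₂ (by fun_prop)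
  have m12 : IsBddMeas fun p : ℝ × ℝ × ℝ => ∫ s₂ in Iio p.2.1, K12 p.1 p.2.1 p.2.2 s₂ ∂μ₂ :=
    IsBddMeas.integral_Iio (f := fun (p : ℝ × ℝ × ℝ) s₂ => K12 p.1 p.2.1 p.2.2 s₂)
      (hK12.comp (g := fun p : (ℝ × ℝ × ℝ) × ℝ => (p.1.1, p.1.2.1, p.1.2.2, p.2)) (by fun_prop))
      μ₂ (by fun_prop)
  have m3 : IsBddMeas fun p : ℝ × ℝ => ∫ s₁ in Iio p.1, K3 p.1 s₁ p.2 ∂μ₁ :=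
    IsBddMeas.integral_Iio (f := fun (p : ℝ × ℝ) s₁ => K3 p.1 s₁ p.2)
      (hK3.comp (g := fun p : (ℝ × ℝ) × ℝ => (p.1.1, p.2, p.1.2)) (by fun_prop)) μ₁ (by fun_prop)
  have m4 : IsBddMeas fun p : ℝ × ℝ =>
      ∫ s₁ in Iio p.1, ∫ s₂ in Iio p.2, K12 p.1 p.2 s₁ s₂ ∂μ₂ ∂μ₁ :=
    IsBddMeas.integral_Iio (f := fun (p : ℝ × ℝ) s₁ => ∫ s₂ in Iio p.2, K12 p.1 p.2 s₁ s₂ ∂μ₂)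
      (m12.comp (g := fun p : (ℝ × ℝ) × ℝ => (p.1.1, p.1.2, p.2)) (by fun_prop)) μ₁ (by fun_prop)
  -- expansion in the first variable
  have e1 : ∫ s₁, ∫ s₂, K s₁ s₂ ∂μ₂ ∂μ₁ = (∫ r₁, ∫ s₂, K1 r₁ s₂ ∂μ₂ ∂μ₁)
      + ∫ r₁, ∫ s₁ in Iio r₁, ∫ s₂, K11 r₁ s₁ s₂ ∂μ₂ ∂μ₁ ∂μ₁ := by
    have a1 : ∀ s₁, ∫ s₂, K s₁ s₂ ∂μ₂ = (∫ s₂, K1 s₁ s₂ ∂μ₂)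
        + ∫ r₁ in Ioi s₁, ∫ s₂, K11 r₁ s₁ s₂ ∂μ₂ ∂μ₁ := by
      intro s₁
      simp only [h]
      rw [integral_add
        ((hK1.comp (g := fun s₂ : ℝ => (s₁, s₂)) (by fun_prop)).integrable μ₂)
        ((m11.comp (g := fun s₂ : ℝ => (s₁, s₂)) (by fun_prop)).integrable μ₂)]
      congr 1
      exact IsBddMeas.integral_swap (f := fun s₂ r₁ => K11 r₁ s₁ s₂)
        (hK11.comp (g := fun p : ℝ × ℝ => (p.2, s₁, p.1)) (by fun_prop)) μ₂
        (μ₁.restrict (Ioi s₁))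
    have a2 : IsBddMeas fun s₁ => ∫ r₁ in Ioi s₁, ∫ s₂, K11 r₁ s₁ s₂ ∂μ₂ ∂μ₁ :=
      IsBddMeas.integral_Ioi (f := fun s₁ r₁ => ∫ s₂, K11 r₁ s₁ s₂ ∂μ₂)
        (i11.comp (g := fun p : ℝ × ℝ => (p.2, p.1)) (by fun_prop)) μ₁ measurable_id
    simp only [a1]
    rw [integral_add ((hK1.integral μ₂).integrable μ₁) (a2.integrable μ₁)]
    congr 1
    exact IsBddMeas.integral_triangle (f := fun r₁ s₁ => ∫ s₂, K11 r₁ s₁ s₂ ∂μ₂) i11 μ₁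
  -- expansions in the second variable
  have e2 : ∀ r₁, ∫ s₂, K1 r₁ s₂ ∂μ₂
      = ∫ r₂, (K2 r₁ r₂ + ∫ s₂ in Iio r₂, K22 r₁ r₂ s₂ ∂μ₂) ∂μ₂ := by
    intro r₁
    have b : IsBddMeas fun p : ℝ × ℝ => K22 r₁ p.1 p.2 :=
      hK22.comp (g := fun p : ℝ × ℝ => (r₁, p.1, p.2)) (by fun_prop)
    have b2 : IsBddMeas fun s₂ => K2 r₁ s₂ :=
      hK2.comp (g := fun s₂ : ℝ => (r₁, s₂)) (by fun_prop)
    have b22 : IsBddMeas fun s₂ => ∫ r₂ in Ioi s₂, K22 r₁ r₂ s₂ ∂μ₂ :=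
      IsBddMeas.integral_Ioi (f := fun s₂ r₂ => K22 r₁ r₂ s₂)
        (b.comp (g := fun p : ℝ × ℝ => (p.2, p.1)) (by fun_prop)) μ₂ measurable_id
    have b22' : IsBddMeas fun r₂ => ∫ s₂ in Iio r₂, K22 r₁ r₂ s₂ ∂μ₂ :=
      m22.comp (g := fun r₂ : ℝ => (r₁, r₂)) (by fun_prop)
    simp only [h1]
    rw [integral_add (b2.integrable μ₂) (b22.integrable μ₂),
      integral_add (b2.integrable μ₂) (b22'.integrable μ₂)]
    congr 1
    exact IsBddMeas.integral_triangle (f := fun r₂ s₂ => K22 r₁ r₂ s₂) b μ₂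
  have e3 : ∀ r₁ s₁, ∫ s₂, K11 r₁ s₁ s₂ ∂μ₂
      = ∫ r₂, (K3 r₁ s₁ r₂ + ∫ s₂ in Iio r₂, K12 r₁ r₂ s₁ s₂ ∂μ₂) ∂μ₂ := by
    intro r₁ s₁
    have b : IsBddMeas fun p : ℝ × ℝ => K12 r₁ p.1 s₁ p.2 :=
      hK12.comp (g := fun p : ℝ × ℝ => (r₁, p.1, s₁, p.2)) (by fun_prop)
    have b3 : IsBddMeas fun s₂ => K3 r₁ s₁ s₂ :=
      hK3.comp (g := fun s₂ : ℝ => (r₁, s₁, s₂)) (by fun_prop)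
    have b12 : IsBddMeas fun s₂ => ∫ r₂ in Ioi s₂, K12 r₁ r₂ s₁ s₂ ∂μ₂ :=
      IsBddMeas.integral_Ioi (f := fun s₂ r₂ => K12 r₁ r₂ s₁ s₂)
        (b.comp (g := fun p : ℝ × ℝ => (p.2, p.1)) (by fun_prop)) μ₂ measurable_id
    have b12' : IsBddMeas fun r₂ => ∫ s₂ in Iio r₂, K12 r₁ r₂ s₁ s₂ ∂μ₂ :=
      m12.comp (g := fun r₂ : ℝ => (r₁, r₂, s₁)) (by fun_prop)
    simp only [h11]
    rw [integral_add (b3.integrable μ₂) (b12.integrable μ₂),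
      integral_add (b3.integrable μ₂) (b12'.integrable μ₂)]
    congr 1
    exact IsBddMeas.integral_triangle (f := fun r₂ s₂ => K12 r₁ r₂ s₁ s₂) b μ₂
  have e4 : ∀ r₁, ∫ s₁ in Iio r₁, ∫ s₂, K11 r₁ s₁ s₂ ∂μ₂ ∂μ₁
      = ∫ r₂, ((∫ s₁ in Iio r₁, K3 r₁ s₁ r₂ ∂μ₁)
        + ∫ s₁ in Iio r₁, ∫ s₂ in Iio r₂, K12 r₁ r₂ s₁ s₂ ∂μ₂ ∂μ₁) ∂μ₂ := by
    intro r₁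
    have c3 : IsBddMeas fun p : ℝ × ℝ => K3 r₁ p.1 p.2 :=
      hK3.comp (g := fun p : ℝ × ℝ => (r₁, p.1, p.2)) (by fun_prop)
    have c12 : IsBddMeas fun p : ℝ × ℝ => ∫ s₂ in Iio p.2, K12 r₁ p.2 p.1 s₂ ∂μ₂ :=
      m12.comp (g := fun p : ℝ × ℝ => (r₁, p.2, p.1)) (by fun_prop)
    simp only [e3]
    rw [IsBddMeas.integral_swap
      (f := fun s₁ r₂ => K3 r₁ s₁ r₂ + ∫ s₂ in Iio r₂, K12 r₁ r₂ s₁ s₂ ∂μ₂) (c3.add c12) _ μ₂]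
    refine integral_congr_ae (ae_of_all _ fun r₂ => ?_)
    exact integral_add ((c3.comp (g := fun s₁ : ℝ => (s₁, r₂)) (by fun_prop)).integrable _)
      ((c12.comp (g := fun s₁ : ℝ => (s₁, r₂)) (by fun_prop)).integrable _)
  have m34 := m3.add m4
  have mK := hK2.add m22
  simp only [e1, e2, e4]
  rw [← integral_add ((IsBddMeas.integral
      (f := fun r₁ r₂ => K2 r₁ r₂ + ∫ s₂ in Iio r₂, K22 r₁ r₂ s₂ ∂μ₂) mK μ₂).integrable μ₁)
    ((IsBddMeas.integral (f := fun r₁ r₂ => (∫ s₁ in Iio r₁, K3 r₁ s₁ r₂ ∂μ₁)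
        + ∫ s₁ in Iio r₁, ∫ s₂ in Iio r₂, K12 r₁ r₂ s₁ s₂ ∂μ₂ ∂μ₁) m34 μ₂).integrable μ₁)]
  refine integral_congr_ae (ae_of_all _ fun r₁ => ?_)
  dsimp only
  rw [← integral_add ((mK.comp (g := fun s₂ : ℝ => (r₁, s₂)) (by fun_prop)).integrable μ₂)
    ((m34.comp (g := fun s₂ : ℝ => (r₁, s₂)) (by fun_prop)).integrable μ₂)]
  refine integral_congr_ae (ae_of_all _ fun r₂ => ?_)
  dsimp only
  ring

/-! ### Integrals that depend on parameters -/

/-- Continuity in a parameter of a delta integral with fixed limits. -/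
lemma continuousWithinAt_integral {S P : Set ℝ} (hS : IsHalfScale S) {G : ℝ → ℝ → ℝ}
    {x b C : ℝ} (hb : b ∈ S)
    (hm : ∀ y ∈ P, AEStronglyMeasurable (G y) ((deltaMeasure S).restrict (Iio b)))
    (hC : ∀ y ∈ P, y ≤ x + 1 → ∀ s ∈ kappa S, s < b → |G y s| ≤ C)
    (hc : ∀ s ∈ kappa S, s < b → ContinuousWithinAt (fun y => G y s) P x) :
    ContinuousWithinAt (fun y => ∫ s in Iio b, G y s ∂deltaMeasure S) P x := by
  have := hS.isFiniteMeasure_Iio hb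
  refine tendsto_integral_filter_of_dominated_convergence (fun _ => C) ?_ ?_
    (integrable_const C) ?_
  · filter_upwards [self_mem_nhdsWithin] with y hy using hm y hy
  · filter_upwards [self_mem_nhdsWithin, mem_nhdsWithin_of_mem_nhds (Iic_mem_nhds (lt_add_one x))]
      with y hy hyx
    filter_upwards [hS.ae_mem_kappa hb, ae_restrict_mem measurableSet_Iio] with s hs hsb
    exact hC y hy hyx s hs hsb
  · filter_upwards [hS.ae_mem_kappa hb, ae_restrict_mem measurableSet_Iio] with s hs hsb
    exact hc s hs hsb

/-- Continuity in a parameter of a delta integral whose upper limit is the parameter, at a point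
that is not right-scattered. -/
lemma continuousWithinAt_integral_self {S : Set ℝ} (hS : IsHalfScale S) {G : ℝ → ℝ → ℝ}
    {t C : ℝ} (ht : t ∈ kappa S) (hd : ¬ t < sigma S t)
    (hm : ∀ y ∈ kappa S, ∀ b ∈ S,
      AEStronglyMeasurable (G y) ((deltaMeasure S).restrict (Iio b)))
    (hC : ∀ y ∈ kappa S, y ≤ t + 1 → ∀ s ∈ kappa S, s < y → |G y s| ≤ C)
    (hc : ∀ s ∈ kappa S, ContinuousWithinAt (fun y => G y s) (kappa S) t) :
    ContinuousWithinAt (fun y => ∫ s in Iio y, G y s ∂deltaMeasure S) (kappa S) t := by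
  have htS := kappa_subset S ht
  obtain ⟨b, hb, htb, hev, hnull⟩ : ∃ b ∈ S, t ≤ b ∧ (∀ᶠ y in 𝓝[kappa S] t, y ≤ b) ∧
      ∀ᵐ s ∂(deltaMeasure S).restrict (Iio b), s ≠ t := by
    by_cases hmax : ∃ b ∈ S, t < b
    · obtain ⟨b, hb, htb⟩ := hmax
      refine ⟨b, hb, htb.le, mem_nhdsWithin_of_mem_nhds (Iic_mem_nhds htb), ?_⟩
      refine ae_restrict_of_ae ?_
      rw [ae_iff]
      simpa using hS.deltaMeasure_singleton htS hb htb hd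
    · push Not at hmax
      refine ⟨t, htS, le_rfl, ?_, ?_⟩
      · filter_upwards [self_mem_nhdsWithin] with y hy using hmax y (kappa_subset S hy)
      · filter_upwards [ae_restrict_mem measurableSet_Iio] with s hs using ne_of_lt hs
  have heq : ∀ y, y ≤ b → ∫ s in Iio y, G y s ∂deltaMeasure S
      = ∫ s in Iio b, (Iio y).indicator (G y) s ∂deltaMeasure S := by
    intro y hy
    rw [integral_indicator measurableSet_Iio, Measure.restrict_restrict measurableSet_Iio,
      Iio_inter_Iio, min_eq_left hy]
  have := hS.isFiniteMeasure_Iio hb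
  have hlim : Tendsto (fun y => ∫ s in Iio b, (Iio y).indicator (G y) s ∂deltaMeasure S)
      (𝓝[kappa S] t) (𝓝 (∫ s in Iio b, (Iio t).indicator (G t) s ∂deltaMeasure S)) := by
    refine tendsto_integral_filter_of_dominated_convergence (fun _ => |C|) ?_ ?_
      (integrable_const _) ?_
    · filter_upwards [self_mem_nhdsWithin] with y hy
      exact (hm y hy b hb).indicator measurableSet_Iio
    · filter_upwards [self_mem_nhdsWithin,
        mem_nhdsWithin_of_mem_nhds (Iic_mem_nhds (lt_add_one t))] with y hy hyt
      filter_upwards [hS.ae_mem_kappa hb] with s hs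
      by_cases hsy : s ∈ Iio y
      · rw [indicator_of_mem hsy]
        exact (hC y hy hyt s hs hsy).trans (le_abs_self C)
      · rw [indicator_of_notMem hsy, norm_zero]
        exact abs_nonneg C
    · filter_upwards [hS.ae_mem_kappa hb, hnull] with s hs hst
      rcases lt_or_gt_of_ne hst with h | h
      · rw [indicator_of_mem (mem_Iio.2 h)]
        refine (hc s hs).congr' ?_
        filter_upwards [mem_nhdsWithin_of_mem_nhds (Ioi_mem_nhds h)] with y hy
        rw [indicator_of_mem (mem_Iio.2 hy)]
      · rw [indicator_of_notMem (by simpa using h.le)]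
        refine tendsto_const_nhds.congr' ?_
        filter_upwards [mem_nhdsWithin_of_mem_nhds (Iio_mem_nhds h)] with y hy
        rw [indicator_of_notMem (by simpa using le_of_lt hy)]
  rw [ContinuousWithinAt, heq t htb]
  refine hlim.congr' ?_
  filter_upwards [hev] with y hy
  rw [heq y hy]

lemma IsHalfScale.abs_integral_le {S : Set ℝ} (hS : IsHalfScale S) {f : ℝ → ℝ} {t C M : ℝ}
    (ht : t ∈ S) (htM : t ≤ M) (hC : ∀ s ∈ kappa S, s < t → |f s| ≤ C) :
    |∫ s in Iio t, f s ∂deltaMeasure S| ≤ |C| * M := by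
  have hm := hS.deltaMeasure_Iio ht
  have h : ‖∫ s in Iio t, f s ∂deltaMeasure S‖ ≤ |C| * (deltaMeasure S).real (Iio t) := by
    refine norm_setIntegral_le_of_norm_le_const_ae (by rw [hm]; exact ENNReal.ofReal_lt_top) ?_
    filter_upwards [hS.ae_mem_kappa ht, ae_restrict_mem measurableSet_Iio] with s hs hst
    exact (hC s hs hst).trans (le_abs_self C)
  rw [Measure.real, hm, ENNReal.toReal_ofReal (hS.nonneg t ht)] at h
  exact h.trans (mul_le_mul_of_nonneg_left htM (abs_nonneg C))

/-- The analogue of `IsDeltaRegular` for functions of two variables: separate continuity at the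
points that are not right-scattered, and joint boundedness on bounded sets. -/
structure IsDeltaRegular₂ (S₁ S₂ : Set ℝ) (F : ℝ → ℝ → ℝ) : Prop where
  left : ∀ t₁ ∈ kappa S₁, ¬ t₁ < sigma S₁ t₁ → ∀ t₂ ∈ kappa S₂,
    ContinuousWithinAt (fun t => F t t₂) (kappa S₁) t₁
  right : ∀ t₁ ∈ kappa S₁, ∀ t₂ ∈ kappa S₂, ¬ t₂ < sigma S₂ t₂ →
    ContinuousWithinAt (fun t => F t₁ t) (kappa S₂) t₂
  bdd : ∀ M, ∃ C, ∀ t₁ ∈ kappa S₁, ∀ t₂ ∈ kappa S₂, t₁ ≤ M → t₂ ≤ M → |F t₁ t₂| ≤ C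

namespace IsDeltaRegular₂

variable {S₁ S₂ : Set ℝ} {F F' : ℝ → ℝ → ℝ}

lemma swap (hF : IsDeltaRegular₂ S₁ S₂ F) : IsDeltaRegular₂ S₂ S₁ (fun t₂ t₁ => F t₁ t₂) where
  left := fun t₂ h₂ hd t₁ h₁ => hF.right t₁ h₁ t₂ h₂ hd
  right := fun t₂ h₂ t₁ h₁ hd => hF.left t₁ h₁ hd t₂ h₂
  bdd := fun M => (hF.bdd M).imp fun _ hC t₂ h₂ t₁ h₁ hM₂ hM₁ => hC t₁ h₁ t₂ h₂ hM₁ hM₂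

lemma add (hF : IsDeltaRegular₂ S₁ S₂ F) (hF' : IsDeltaRegular₂ S₁ S₂ F') :
    IsDeltaRegular₂ S₁ S₂ (fun t₁ t₂ => F t₁ t₂ + F' t₁ t₂) where
  left := fun t₁ h₁ hd t₂ h₂ => (hF.left t₁ h₁ hd t₂ h₂).add (hF'.left t₁ h₁ hd t₂ h₂)
  right := fun t₁ h₁ t₂ h₂ hd => (hF.right t₁ h₁ t₂ h₂ hd).add (hF'.right t₁ h₁ t₂ h₂ hd)
  bdd := fun M => by
    obtain ⟨C, hC⟩ := hF.bdd M
    obtain ⟨C', hC'⟩ := hF'.bdd M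
    exact ⟨C + C', fun t₁ h₁ t₂ h₂ hM₁ hM₂ => (abs_add_le _ _).trans
      (add_le_add (hC t₁ h₁ t₂ h₂ hM₁ hM₂) (hC' t₁ h₁ t₂ h₂ hM₁ hM₂))⟩

lemma congr (hF : IsDeltaRegular₂ S₁ S₂ F)
    (h : ∀ t₁ ∈ kappa S₁, ∀ t₂ ∈ kappa S₂, F' t₁ t₂ = F t₁ t₂) : IsDeltaRegular₂ S₁ S₂ F' where
  left := fun t₁ h₁ hd t₂ h₂ =>
    (hF.left t₁ h₁ hd t₂ h₂).congr (fun t ht => h t ht t₂ h₂) (h t₁ h₁ t₂ h₂)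
  right := fun t₁ h₁ t₂ h₂ hd =>
    (hF.right t₁ h₁ t₂ h₂ hd).congr (fun t ht => h t₁ h₁ t ht) (h t₁ h₁ t₂ h₂)
  bdd := fun M => by
    obtain ⟨C, hC⟩ := hF.bdd M
    exact ⟨C, fun t₁ h₁ t₂ h₂ => (h t₁ h₁ t₂ h₂).symm ▸ hC t₁ h₁ t₂ h₂⟩

lemma isDeltaRegular_left (hF : IsDeltaRegular₂ S₁ S₂ F) {t₂ : ℝ} (h₂ : t₂ ∈ kappa S₂) :
    IsDeltaRegular S₁ (fun t₁ => F t₁ t₂) where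
  cont := fun t₁ h₁ hd => hF.left t₁ h₁ hd t₂ h₂
  bdd := fun M => by
    obtain ⟨C, hC⟩ := hF.bdd (max M t₂)
    exact ⟨C, fun t₁ h₁ hM => hC t₁ h₁ t₂ h₂ (hM.trans (le_max_left _ _)) (le_max_right _ _)⟩

lemma isDeltaRegular_right (hF : IsDeltaRegular₂ S₁ S₂ F) {t₁ : ℝ} (h₁ : t₁ ∈ kappa S₁) :
    IsDeltaRegular S₂ (F t₁) :=
  hF.swap.isDeltaRegular_left h₁

/-- Integration in the second variable up to a fixed limit. -/
lemma isDeltaRegular_integral (hS₂ : IsHalfScale S₂) (hF : IsDeltaRegular₂ S₁ S₂ F) {t₂ : ℝ}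
    (h₂ : t₂ ∈ S₂) :
    IsDeltaRegular S₁ (fun t₁ => ∫ s₂ in Iio t₂, F t₁ s₂ ∂deltaMeasure S₂) where
  cont := fun t₁ h₁ hd => by
    obtain ⟨C, hC⟩ := hF.bdd (max (t₁ + 1) t₂)
    exact continuousWithinAt_integral hS₂ h₂
      (fun y hy => (hF.isDeltaRegular_right hy).aestronglyMeasurable hS₂ h₂)
      (fun y hy hyt s hs hst => hC y hy s hs (hyt.trans (le_max_left _ _))
        (hst.le.trans (le_max_right _ _)))
      (fun s hs _ => hF.left t₁ h₁ hd s hs)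
  bdd := fun M => by
    obtain ⟨C, hC⟩ := hF.bdd (max M t₂)
    exact ⟨|C| * t₂, fun t₁ h₁ hM => hS₂.abs_integral_le h₂ le_rfl fun s hs hst =>
      hC t₁ h₁ s hs (hM.trans (le_max_left _ _)) (hst.le.trans (le_max_right _ _))⟩

/-- Integration of a function with a parameter `s`, up to the second variable. -/
lemma integral_right (hS₂ : IsHalfScale S₂) {G : ℝ → ℝ → ℝ → ℝ}
    (hm : ∀ t₁ ∈ kappa S₁, ∀ t₂ ∈ kappa S₂, ∀ b ∈ S₂,
      AEStronglyMeasurable (G t₁ t₂) ((deltaMeasure S₂).restrict (Iio b)))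
    (hG : ∀ s ∈ kappa S₂, IsDeltaRegular₂ S₁ S₂ (fun t₁ t₂ => G t₁ t₂ s))
    (hb : ∀ M, ∃ C, ∀ t₁ ∈ kappa S₁, ∀ t₂ ∈ kappa S₂, ∀ s ∈ kappa S₂,
      t₁ ≤ M → t₂ ≤ M → s ≤ M → |G t₁ t₂ s| ≤ C) :
    IsDeltaRegular₂ S₁ S₂ (fun t₁ t₂ => ∫ s in Iio t₂, G t₁ t₂ s ∂deltaMeasure S₂) where
  left := fun t₁ h₁ hd t₂ h₂ => by
    obtain ⟨C, hC⟩ := hb (max (t₁ + 1) t₂)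
    exact continuousWithinAt_integral hS₂ (kappa_subset _ h₂)
      (fun y hy => hm y hy t₂ h₂ t₂ (kappa_subset _ h₂))
      (fun y hy hyt s hs hst => hC y hy t₂ h₂ s hs (hyt.trans (le_max_left _ _))
        (le_max_right _ _) (hst.le.trans (le_max_right _ _)))
      (fun s hs _ => (hG s hs).left t₁ h₁ hd t₂ h₂)
  right := fun t₁ h₁ t₂ h₂ hd => by
    obtain ⟨C, hC⟩ := hb (max t₁ (t₂ + 1))
    exact continuousWithinAt_integral_self hS₂ h₂ hd (fun y hy => hm t₁ h₁ y hy)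
      (fun y hy hyt s hs hsy => hC t₁ h₁ y hy s hs (le_max_left _ _)
        (hyt.trans (le_max_right _ _)) ((hsy.le.trans hyt).trans (le_max_right _ _)))
      (fun s hs => (hG s hs).right t₁ h₁ t₂ h₂ hd)
  bdd := fun M => by
    obtain ⟨C, hC⟩ := hb M
    exact ⟨|C| * M, fun t₁ h₁ t₂ h₂ hM₁ hM₂ => hS₂.abs_integral_le (kappa_subset _ h₂) hM₂
      fun s hs hst => hC t₁ h₁ t₂ h₂ s hs hM₁ hM₂ (hst.le.trans hM₂)⟩

/-- Integration of a function with a parameter `s`, up to the first variable. -/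
lemma integral_left (hS₁ : IsHalfScale S₁) {G : ℝ → ℝ → ℝ → ℝ}
    (hm : ∀ t₁ ∈ kappa S₁, ∀ t₂ ∈ kappa S₂, ∀ b ∈ S₁,
      AEStronglyMeasurable (G t₁ t₂) ((deltaMeasure S₁).restrict (Iio b)))
    (hG : ∀ s ∈ kappa S₁, IsDeltaRegular₂ S₁ S₂ (fun t₁ t₂ => G t₁ t₂ s))
    (hb : ∀ M, ∃ C, ∀ t₁ ∈ kappa S₁, ∀ t₂ ∈ kappa S₂, ∀ s ∈ kappa S₁,
      t₁ ≤ M → t₂ ≤ M → s ≤ M → |G t₁ t₂ s| ≤ C) :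
    IsDeltaRegular₂ S₁ S₂ (fun t₁ t₂ => ∫ s in Iio t₁, G t₁ t₂ s ∂deltaMeasure S₁) :=
  (integral_right (S₁ := S₂) hS₁ (G := fun t₂ t₁ s => G t₁ t₂ s)
    (fun t₂ h₂ t₁ h₁ => hm t₁ h₁ t₂ h₂) (fun s hs => (hG s hs).swap)
    (fun M => (hb M).imp fun _ hC t₂ h₂ t₁ h₁ s hs hM₂ hM₁ => hC t₁ h₁ t₂ h₂ s hs hM₁ hM₂)).swap

end IsDeltaRegular₂

/-! ### Kernels and their coefficient functions -/

namespace JointlyContinuousOn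

variable {A B C D : Set ℝ} {h : ℝ → ℝ → ℝ → ℝ → ℝ}

lemma comp_continuousWithinAt (hh : JointlyContinuousOn h A B C D) {P : Set ℝ} {x : ℝ}
    {a b c d : ℝ → ℝ} (hx : x ∈ P)
    (ha : ContinuousWithinAt a P x) (hb : ContinuousWithinAt b P x)
    (hc : ContinuousWithinAt c P x) (hd : ContinuousWithinAt d P x)
    (hA : ∀ y ∈ P, a y ∈ A) (hB : ∀ y ∈ P, b y ∈ B) (hC : ∀ y ∈ P, c y ∈ C)
    (hD : ∀ y ∈ P, d y ∈ D) :
    ContinuousWithinAt (fun y => h (a y) (b y) (c y) (d y)) P x :=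
  ContinuousWithinAt.comp (f := fun y => (a y, b y, c y, d y))
    (hh _ ⟨hA x hx, hB x hx, hC x hx, hD x hx⟩)
    (ha.prodMk (hb.prodMk (hc.prodMk hd))) fun y hy => ⟨hA y hy, hB y hy, hC y hy, hD y hy⟩

lemma continuousOn_third (hg : JointlyContinuousOn h A B C D) {t₁ t₂ s₂ : ℝ} (ht₁ : t₁ ∈ A)
    (ht₂ : t₂ ∈ B) (hs₂ : s₂ ∈ D) : ContinuousOn (fun s₁ => h t₁ t₂ s₁ s₂) C := fun _ hs =>
  hg.comp_continuousWithinAt (a := fun _ => t₁) (b := fun _ => t₂) (c := id) (d := fun _ => s₂) hs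
    continuousWithinAt_const continuousWithinAt_const continuousWithinAt_id
    continuousWithinAt_const (fun _ _ => ht₁) (fun _ _ => ht₂) (fun _ hz => hz) (fun _ _ => hs₂)

lemma continuousOn_fourth (hg : JointlyContinuousOn h A B C D) {t₁ t₂ s₁ : ℝ} (ht₁ : t₁ ∈ A)
    (ht₂ : t₂ ∈ B) (hs₁ : s₁ ∈ C) : ContinuousOn (fun s₂ => h t₁ t₂ s₁ s₂) D := fun _ hs =>
  hg.comp_continuousWithinAt (a := fun _ => t₁) (b := fun _ => t₂) (c := fun _ => s₁) (d := id) hs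
    continuousWithinAt_const continuousWithinAt_const continuousWithinAt_const
    continuousWithinAt_id (fun _ _ => ht₁) (fun _ _ => ht₂) (fun _ _ => hs₁) (fun _ hz => hz)

lemma exists_bound (hh : JointlyContinuousOn h A B C D) (hA : IsClosed A) (hB : IsClosed B)
    (hC : IsClosed C) (hD : IsClosed D) (M : ℝ) :
    ∃ K, ∀ x ∈ A, ∀ y ∈ B, ∀ z ∈ C, ∀ w ∈ D, x ∈ Icc 0 M → y ∈ Icc 0 M → z ∈ Icc 0 M →
      w ∈ Icc 0 M → |h x y z w| ≤ K := by
  have hcomp : IsCompact ((A ∩ Icc 0 M) ×ˢ (B ∩ Icc 0 M) ×ˢ (C ∩ Icc 0 M) ×ˢ (D ∩ Icc 0 M)) :=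
    (isCompact_Icc.inter_left hA).prod ((isCompact_Icc.inter_left hB).prod
      ((isCompact_Icc.inter_left hC).prod (isCompact_Icc.inter_left hD)))
  obtain ⟨K, hK⟩ := hcomp.exists_bound_of_continuousOn (ContinuousOn.mono hh
    fun x hx => ⟨hx.1.1, hx.2.1.1, hx.2.2.1.1, hx.2.2.2.1⟩)
  exact ⟨K, fun x hx y hy z hz w hw hx' hy' hz' hw' =>
    hK (x, y, z, w) ⟨⟨hx, hx'⟩, ⟨hy, hy'⟩, ⟨hz, hz'⟩, ⟨hw, hw'⟩⟩⟩

/-- The restriction of `h` to a bounded part of its domain, composed with measurable functions, is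
bounded and measurable. -/
lemma isBddMeas (hh : JointlyContinuousOn h A B C D) (hA : IsClosed A) (hB : IsClosed B)
    (hC : IsClosed C) (hD : IsClosed D) {Y : Type*} [MeasurableSpace Y] {E : Set Y}
    (hE : MeasurableSet E) {a b c d : Y → ℝ} (ha : Measurable a) (hb : Measurable b)
    (hc : Measurable c) (hd : Measurable d) {M : ℝ}
    (hEA : ∀ y ∈ E, a y ∈ A ∩ Icc 0 M) (hEB : ∀ y ∈ E, b y ∈ B ∩ Icc 0 M)
    (hEC : ∀ y ∈ E, c y ∈ C ∩ Icc 0 M) (hED : ∀ y ∈ E, d y ∈ D ∩ Icc 0 M) :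
    IsBddMeas (E.indicator fun y => h (a y) (b y) (c y) (d y)) := by
  classical
  refine ⟨?_, ?_⟩
  · have hX : MeasurableSet (A ×ˢ B ×ˢ C ×ˢ D) := hA.measurableSet.prod
      (hB.measurableSet.prod (hC.measurableSet.prod hD.measurableSet))
    have h1 := ContinuousOn.measurable_piecewise hh
      (continuousOn_const (c := (0 : ℝ))) hX
    have h2 := (h1.comp (ha.prodMk (hb.prodMk (hc.prodMk hd)))).indicator hE
    convert h2 using 1
    ext y
    by_cases hy : y ∈ E
    · rw [indicator_of_mem hy, indicator_of_mem hy, Function.comp_apply, piecewise_eq_of_mem]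
      exact ⟨(hEA y hy).1, (hEB y hy).1, (hEC y hy).1, (hED y hy).1⟩
    · rw [indicator_of_notMem hy, indicator_of_notMem hy]
  · obtain ⟨K, hK⟩ := hh.exists_bound hA hB hC hD M
    refine ⟨|K|, fun y => ?_⟩
    by_cases hy : y ∈ E
    · rw [indicator_of_mem hy]
      exact (hK _ (hEA y hy).1 _ (hEB y hy).1 _ (hEC y hy).1 _ (hED y hy).1 (hEA y hy).2
        (hEB y hy).2 (hEC y hy).2 (hED y hy).2).trans (le_abs_self K)
    · rw [indicator_of_notMem hy, abs_zero]
      exact abs_nonneg K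

lemma continuousOn_integral {S₁ S₂ : Set ℝ} (hg : JointlyContinuousOn h A B S₁ S₂)
    (hS₁ : IsHalfScale S₁) (hS₂ : IsHalfScale S₂) {t₁ t₂ b : ℝ} (ht₁ : t₁ ∈ A)
    (ht₂ : t₂ ∈ B) (hb : b ∈ S₂) :
    ContinuousOn (fun s₁ => ∫ s₂ in Iio b, h t₁ t₂ s₁ s₂ ∂deltaMeasure S₂) S₁ := by
  intro x hx
  have hcomp : IsCompact (({t₁} : Set ℝ) ×ˢ ({t₂} : Set ℝ) ×ˢ (S₁ ∩ Icc 0 (x + 1)) ×ˢ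
      (S₂ ∩ Icc 0 b)) :=
    isCompact_singleton.prod (isCompact_singleton.prod
      ((isCompact_Icc.inter_left hS₁.closed).prod (isCompact_Icc.inter_left hS₂.closed)))
  obtain ⟨C, hC⟩ := hcomp.exists_bound_of_continuousOn (ContinuousOn.mono hg
    fun y hy => ⟨mem_singleton_iff.1 hy.1 ▸ ht₁, mem_singleton_iff.1 hy.2.1 ▸ ht₂,
      hy.2.2.1.1, hy.2.2.2.1⟩)
  refine continuousWithinAt_integral hS₂ (C := C) hb (fun y hy => ?_)
    (fun y hy hyx s hs hsb => hC (t₁, t₂, y, s) ⟨rfl, rfl, ⟨hy, hS₁.nonneg y hy, hyx⟩,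
      kappa_subset _ hs, hS₂.nonneg s (kappa_subset _ hs), hsb.le⟩) (fun s hs _ => ?_)
  · exact (isDeltaRegular_of_continuousOn hS₂
      (hg.continuousOn_fourth ht₁ ht₂ hy)).aestronglyMeasurable hS₂ hb
  · exact hg.continuousOn_third ht₁ ht₂ (kappa_subset _ hs) x hx

end JointlyContinuousOn

/-- A kernel `h`, which absorbs a weight in the last two variables, together with its delta
derivatives `h₁`, `h₂` and `h₁₂` in the first two variables. -/
structure IsKernel (S₁ S₂ : Set ℝ) (h h₁ h₂ h₁₂ : ℝ → ℝ → ℝ → ℝ → ℝ) : Prop where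
  cont : JointlyContinuousOn h S₁ S₂ S₁ S₂
  cont₁ : JointlyContinuousOn h₁ (kappa S₁) S₂ S₁ S₂
  cont₂ : JointlyContinuousOn h₂ S₁ (kappa S₂) S₁ S₂
  cont₁₂ : JointlyContinuousOn h₁₂ (kappa S₁) (kappa S₂) S₁ S₂
  deriv₁ : ∀ t₁ ∈ kappa S₁, ∀ t₂ ∈ S₂, ∀ s₁ ∈ S₁, ∀ s₂ ∈ S₂,
    HasDeltaDerivAt S₁ (fun t => h t t₂ s₁ s₂) (h₁ t₁ t₂ s₁ s₂) t₁
  deriv₂ : ∀ t₁ ∈ S₁, ∀ t₂ ∈ kappa S₂, ∀ s₁ ∈ S₁, ∀ s₂ ∈ S₂,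
    HasDeltaDerivAt S₂ (fun t => h t₁ t s₁ s₂) (h₂ t₁ t₂ s₁ s₂) t₂
  deriv₁₂ : ∀ t₁ ∈ kappa S₁, ∀ t₂ ∈ kappa S₂, ∀ s₁ ∈ S₁, ∀ s₂ ∈ S₂,
    HasDeltaDerivAt S₂ (fun t => h₁ t₁ t s₁ s₂) (h₁₂ t₁ t₂ s₁ s₂) t₂

/-- The coefficient function of a weighted kernel, in terms of the delta measures. -/
noncomputable def kernelCoeff (S₁ S₂ : Set ℝ) (h h₁ h₂ h₁₂ : ℝ → ℝ → ℝ → ℝ → ℝ)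
    (t₁ t₂ : ℝ) : ℝ :=
  h (sigma S₁ t₁) (sigma S₂ t₂) t₁ t₂
  + ∫ s₂ in Iio t₂, h₂ (sigma S₁ t₁) t₂ t₁ s₂ ∂deltaMeasure S₂
  + ∫ s₁ in Iio t₁, h₁ t₁ (sigma S₂ t₂) s₁ t₂ ∂deltaMeasure S₁
  + ∫ s₁ in Iio t₁, ∫ s₂ in Iio t₂, h₁₂ t₁ t₂ s₁ s₂ ∂deltaMeasure S₂ ∂deltaMeasure S₁

namespace IsKernel

variable {S₁ S₂ : Set ℝ} {h h₁ h₂ h₁₂ : ℝ → ℝ → ℝ → ℝ → ℝ}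

lemma isDeltaRegular₂_diag (hS₁ : IsHalfScale S₁) (hS₂ : IsHalfScale S₂)
    (hk : JointlyContinuousOn h S₁ S₂ S₁ S₂) :
    IsDeltaRegular₂ S₁ S₂ (fun t₁ t₂ => h (sigma S₁ t₁) (sigma S₂ t₂) t₁ t₂) where
  left := fun t₁ ht₁ hd t₂ ht₂ =>
    hk.comp_continuousWithinAt (b := fun _ => sigma S₂ t₂) (c := id) (d := fun _ => t₂) ht₁
      ((hS₁.continuousWithinAt_sigma (kappa_subset _ ht₁) hd).mono (kappa_subset _))
      continuousWithinAt_const continuousWithinAt_id continuousWithinAt_const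
      (fun y hy => sigma_mem hS₁.closed (kappa_subset _ hy))
      (fun _ _ => sigma_mem hS₂.closed (kappa_subset _ ht₂)) (fun y hy => kappa_subset _ hy)
      (fun _ _ => kappa_subset _ ht₂)
  right := fun t₁ ht₁ t₂ ht₂ hd =>
    hk.comp_continuousWithinAt (a := fun _ => sigma S₁ t₁) (c := fun _ => t₁) (d := id) ht₂
      continuousWithinAt_const
      ((hS₂.continuousWithinAt_sigma (kappa_subset _ ht₂) hd).mono (kappa_subset _))
      continuousWithinAt_const continuousWithinAt_id
      (fun _ _ => sigma_mem hS₁.closed (kappa_subset _ ht₁))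
      (fun y hy => sigma_mem hS₂.closed (kappa_subset _ hy)) (fun _ _ => kappa_subset _ ht₁)
      (fun y hy => kappa_subset _ hy)
  bdd := fun M => by
    obtain ⟨M₁, hM₁⟩ := hS₁.exists_sigma_le M
    obtain ⟨M₂, hM₂⟩ := hS₂.exists_sigma_le M
    obtain ⟨C, hC⟩ := hk.exists_bound hS₁.closed hS₂.closed hS₁.closed hS₂.closed
      (max M (max M₁ M₂))
    refine ⟨C, fun t₁ ht₁ t₂ ht₂ h1 h2 => ?_⟩
    have k₁ := kappa_subset _ ht₁
    have k₂ := kappa_subset _ ht₂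
    have m₁ := sigma_mem hS₁.closed k₁
    have m₂ := sigma_mem hS₂.closed k₂
    exact hC _ m₁ _ m₂ _ k₁ _ k₂
      ⟨hS₁.nonneg _ m₁, (hM₁ _ k₁ h1).trans ((le_max_left _ _).trans (le_max_right _ _))⟩
      ⟨hS₂.nonneg _ m₂, (hM₂ _ k₂ h2).trans ((le_max_right _ _).trans (le_max_right _ _))⟩
      ⟨hS₁.nonneg _ k₁, h1.trans (le_max_left _ _)⟩ ⟨hS₂.nonneg _ k₂, h2.trans (le_max_left _ _)⟩

lemma isDeltaRegular₂_integral_right (hS₁ : IsHalfScale S₁) (hS₂ : IsHalfScale S₂)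
    (hk : JointlyContinuousOn h₂ S₁ (kappa S₂) S₁ S₂) :
    IsDeltaRegular₂ S₁ S₂
      (fun t₁ t₂ => ∫ s₂ in Iio t₂, h₂ (sigma S₁ t₁) t₂ t₁ s₂ ∂deltaMeasure S₂) := by
  have hbd : ∀ M : ℝ, ∃ C, ∀ t₁ ∈ kappa S₁, ∀ t₂ ∈ kappa S₂, ∀ s ∈ S₂,
      t₁ ≤ M → t₂ ≤ M → s ≤ M → |h₂ (sigma S₁ t₁) t₂ t₁ s| ≤ C := by
    intro M
    obtain ⟨M₁, hM₁⟩ := hS₁.exists_sigma_le M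
    obtain ⟨C, hC⟩ := hk.exists_bound hS₁.closed hS₂.isClosed_kappa hS₁.closed hS₂.closed
      (max M M₁)
    refine ⟨C, fun t₁ ht₁ t₂ ht₂ s hs h1 h2 h3 => ?_⟩
    have k₁ := kappa_subset _ ht₁
    have m₁ := sigma_mem hS₁.closed k₁
    exact hC _ m₁ _ ht₂ _ k₁ _ hs ⟨hS₁.nonneg _ m₁, (hM₁ _ k₁ h1).trans (le_max_right _ _)⟩
      ⟨hS₂.nonneg _ (kappa_subset _ ht₂), h2.trans (le_max_left _ _)⟩
      ⟨hS₁.nonneg _ k₁, h1.trans (le_max_left _ _)⟩ ⟨hS₂.nonneg _ hs, h3.trans (le_max_left _ _)⟩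
  refine IsDeltaRegular₂.integral_right (G := fun t₁ t₂ s₂ => h₂ (sigma S₁ t₁) t₂ t₁ s₂) hS₂
    (fun t₁ ht₁ t₂ ht₂ b hb => ?_) (fun s hs => ⟨fun t₁ ht₁ hd t₂ ht₂ => ?_,
      fun t₁ ht₁ t₂ ht₂ _ => ?_, fun M => ?_⟩) (fun M => ?_)
  · exact (isDeltaRegular_of_continuousOn hS₂ (hk.continuousOn_fourth
      (sigma_mem hS₁.closed (kappa_subset _ ht₁)) ht₂
      (kappa_subset _ ht₁))).aestronglyMeasurable hS₂ hb
  · exact hk.comp_continuousWithinAt (b := fun _ => t₂) (c := id) (d := fun _ => s) ht₁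
      ((hS₁.continuousWithinAt_sigma (kappa_subset _ ht₁) hd).mono (kappa_subset _))
      continuousWithinAt_const continuousWithinAt_id continuousWithinAt_const
      (fun y hy => sigma_mem hS₁.closed (kappa_subset _ hy)) (fun _ _ => ht₂)
      (fun y hy => kappa_subset _ hy) (fun _ _ => kappa_subset _ hs)
  · exact hk.comp_continuousWithinAt (a := fun _ => sigma S₁ t₁) (b := id) (c := fun _ => t₁)
      (d := fun _ => s) ht₂ continuousWithinAt_const continuousWithinAt_id
      continuousWithinAt_const continuousWithinAt_const
      (fun _ _ => sigma_mem hS₁.closed (kappa_subset _ ht₁)) (fun _ hy => hy)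
      (fun _ _ => kappa_subset _ ht₁) (fun _ _ => kappa_subset _ hs)
  · obtain ⟨C, hC⟩ := hbd (max M s)
    exact ⟨C, fun t₁ ht₁ t₂ ht₂ h1 h2 => hC t₁ ht₁ t₂ ht₂ s (kappa_subset _ hs)
      (h1.trans (le_max_left _ _)) (h2.trans (le_max_left _ _)) (le_max_right _ _)⟩
  · obtain ⟨C, hC⟩ := hbd M
    exact ⟨C, fun t₁ ht₁ t₂ ht₂ s hs => hC t₁ ht₁ t₂ ht₂ s (kappa_subset _ hs)⟩

/-- The term with the derivative in the first variable, by exchanging the roles of the two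
scales. -/
lemma isDeltaRegular₂_integral_left (hS₁ : IsHalfScale S₁) (hS₂ : IsHalfScale S₂)
    (hk : JointlyContinuousOn h₁ (kappa S₁) S₂ S₁ S₂) :
    IsDeltaRegular₂ S₁ S₂
      (fun t₁ t₂ => ∫ s₁ in Iio t₁, h₁ t₁ (sigma S₂ t₂) s₁ t₂ ∂deltaMeasure S₁) := by
  refine (isDeltaRegular₂_integral_right (S₁ := S₂) (h₂ := fun t₂ t₁ s₂ s₁ => h₁ t₁ t₂ s₁ s₂)
    hS₂ hS₁ ?_).swap
  refine ContinuousOn.comp (g := fun x : ℝ × ℝ × ℝ × ℝ => h₁ x.1 x.2.1 x.2.2.1 x.2.2.2)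
    (f := fun x : ℝ × ℝ × ℝ × ℝ => (x.2.1, x.1, x.2.2.2, x.2.2.1)) hk
    (Continuous.continuousOn (by fun_prop)) fun x hx => ?_
  exact ⟨hx.2.1, hx.1, hx.2.2.2, hx.2.2.1⟩

lemma isDeltaRegular₂_integral_integral (hS₁ : IsHalfScale S₁) (hS₂ : IsHalfScale S₂)
    (hk : JointlyContinuousOn h₁₂ (kappa S₁) (kappa S₂) S₁ S₂) :
    IsDeltaRegular₂ S₁ S₂ (fun t₁ t₂ => ∫ s₁ in Iio t₁, ∫ s₂ in Iio t₂,
      h₁₂ t₁ t₂ s₁ s₂ ∂deltaMeasure S₂ ∂deltaMeasure S₁) := by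
  have hbd : ∀ M : ℝ, ∃ C, ∀ t₁ ∈ kappa S₁, ∀ t₂ ∈ kappa S₂, ∀ s₁ ∈ S₁, ∀ s₂ ∈ S₂,
      t₁ ≤ M → t₂ ≤ M → s₁ ≤ M → s₂ ≤ M → |h₁₂ t₁ t₂ s₁ s₂| ≤ C := by
    intro M
    obtain ⟨C, hC⟩ := hk.exists_bound hS₁.isClosed_kappa hS₂.isClosed_kappa hS₁.closed
      hS₂.closed M
    exact ⟨C, fun t₁ ht₁ t₂ ht₂ s₁ hs₁ s₂ hs₂ h1 h2 h3 h4 => hC _ ht₁ _ ht₂ _ hs₁ _ hs₂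
      ⟨hS₁.nonneg _ (kappa_subset _ ht₁), h1⟩ ⟨hS₂.nonneg _ (kappa_subset _ ht₂), h2⟩
      ⟨hS₁.nonneg _ hs₁, h3⟩ ⟨hS₂.nonneg _ hs₂, h4⟩⟩
  refine IsDeltaRegular₂.integral_left
    (G := fun t₁ t₂ s₁ => ∫ s₂ in Iio t₂, h₁₂ t₁ t₂ s₁ s₂ ∂deltaMeasure S₂) hS₁
    (fun t₁ ht₁ t₂ ht₂ b hb => ?_) (fun s₁ hs₁ => ?_) (fun M => ?_)
  · exact (isDeltaRegular_of_continuousOn hS₁ (hk.continuousOn_integral hS₁ hS₂ ht₁ ht₂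
      (kappa_subset _ ht₂))).aestronglyMeasurable hS₁ hb
  · have ks₁ := kappa_subset _ hs₁
    refine IsDeltaRegular₂.integral_right (G := fun t₁ t₂ s₂ => h₁₂ t₁ t₂ s₁ s₂) hS₂
      (fun t₁ ht₁ t₂ ht₂ b hb => ?_) (fun s hs => ⟨fun t₁ ht₁ _ t₂ ht₂ => ?_,
        fun t₁ ht₁ t₂ ht₂ _ => ?_, fun M => ?_⟩) (fun M => ?_)
    · exact (isDeltaRegular_of_continuousOn hS₂
        (hk.continuousOn_fourth ht₁ ht₂ ks₁)).aestronglyMeasurable hS₂ hb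
    · exact hk.comp_continuousWithinAt (a := id) (b := fun _ => t₂) (c := fun _ => s₁)
        (d := fun _ => s) ht₁ continuousWithinAt_id continuousWithinAt_const
        continuousWithinAt_const continuousWithinAt_const (fun _ hy => hy) (fun _ _ => ht₂)
        (fun _ _ => ks₁) (fun _ _ => kappa_subset _ hs)
    · exact hk.comp_continuousWithinAt (a := fun _ => t₁) (b := id) (c := fun _ => s₁)
        (d := fun _ => s) ht₂ continuousWithinAt_const continuousWithinAt_id
        continuousWithinAt_const continuousWithinAt_const (fun _ _ => ht₁) (fun _ hy => hy)
        (fun _ _ => ks₁) (fun _ _ => kappa_subset _ hs)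
    · obtain ⟨C, hC⟩ := hbd (max M (max s₁ s))
      exact ⟨C, fun t₁ ht₁ t₂ ht₂ h1 h2 => hC t₁ ht₁ t₂ ht₂ s₁ ks₁ s (kappa_subset _ hs)
        (h1.trans (le_max_left _ _)) (h2.trans (le_max_left _ _))
        ((le_max_left _ _).trans (le_max_right _ _))
        ((le_max_right _ _).trans (le_max_right _ _))⟩
    · obtain ⟨C, hC⟩ := hbd (max M s₁)
      exact ⟨C, fun t₁ ht₁ t₂ ht₂ s hs h1 h2 h3 => hC t₁ ht₁ t₂ ht₂ s₁ ks₁ s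
        (kappa_subset _ hs) (h1.trans (le_max_left _ _)) (h2.trans (le_max_left _ _))
        (le_max_right _ _) (h3.trans (le_max_left _ _))⟩
  · obtain ⟨C, hC⟩ := hbd M
    exact ⟨|C| * M, fun t₁ ht₁ t₂ ht₂ s₁ hs₁ h1 h2 h3 =>
      hS₂.abs_integral_le (kappa_subset _ ht₂) h2 fun s₂ hs₂ h4 =>
        hC t₁ ht₁ t₂ ht₂ s₁ (kappa_subset _ hs₁) s₂ (kappa_subset _ hs₂) h1 h2 h3 (h4.le.trans h2)⟩

lemma isDeltaRegular₂_kernelCoeff (hS₁ : IsHalfScale S₁) (hS₂ : IsHalfScale S₂)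
    (hk : IsKernel S₁ S₂ h h₁ h₂ h₁₂) :
    IsDeltaRegular₂ S₁ S₂ (kernelCoeff S₁ S₂ h h₁ h₂ h₁₂) :=
  (((isDeltaRegular₂_diag hS₁ hS₂ hk.cont).add
    (isDeltaRegular₂_integral_right hS₁ hS₂ hk.cont₂)).add
    (isDeltaRegular₂_integral_left hS₁ hS₂ hk.cont₁)).add
    (isDeltaRegular₂_integral_integral hS₁ hS₂ hk.cont₁₂)

end IsKernel

/-- The fundamental theorem of calculus from `σ(s)` to `t`, for a point `s < t`. -/
lemma IsHalfScale.eq_add_integral_Ioi {S : Set ℝ} (hS : IsHalfScale S) {f F : ℝ → ℝ}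
    (hf : ContinuousOn f (kappa S)) (hd : ∀ r ∈ kappa S, HasDeltaDerivAt S F (f r) r) {s t : ℝ}
    (hs : s ∈ S) (ht : t ∈ S) (hst : s < t) :
    F t = F (sigma S s)
      + ∫ r in Ioi s, f r ∂(deltaMeasure S).restrict (Iio t) := by
  have hσ := sigma_mem hS.closed hs
  have h1 := (IsDeltaRegular.of_continuousOn hS hf).integral_eq_sub hS hd hσ ht (sigma_le ht hst)
  rw [Measure.restrict_restrict measurableSet_Ioi]
  -- the two domains differ at most by the point `s`, when `σ(s) = s`, and then it is a null set
  have h2 : (Ico (sigma S s) t : Set ℝ) =ᵐ[deltaMeasure S] (Ioi s ∩ Iio t : Set ℝ) := by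
    by_cases hlt : s < sigma S s
    · filter_upwards [hS.ae_mem] with r hr
      exact propext ⟨fun h => ⟨hlt.trans_le h.1, h.2⟩, fun h => ⟨sigma_le hr h.1, h.2⟩⟩
    · have hss : sigma S s = s := le_antisymm (not_lt.1 hlt) (le_sigma hs)
      have hnull : ∀ᵐ r ∂deltaMeasure S, r ≠ s := by
        rw [ae_iff]
        simpa using hS.deltaMeasure_singleton hs ht hst hlt
      rw [hss]
      filter_upwards [hnull] with r hr
      exact propext ⟨fun h => ⟨lt_of_le_of_ne h.1 hr.symm, h.2⟩, fun h => ⟨le_of_lt h.1, h.2⟩⟩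
  rw [← setIntegral_congr_set h2, h1]
  ring

lemma setIntegral_restrict_Iio_congr {S : Set ℝ} (hS : IsHalfScale S) {f g : ℝ → ℝ} {r t : ℝ}
    (hrt : r ≤ t) (h : ∀ s ∈ S, s < r → f s = g s) :
    ∫ s in Iio r, f s ∂(deltaMeasure S).restrict (Iio t)
      = ∫ s in Iio r, g s ∂deltaMeasure S := by
  rw [Measure.restrict_restrict measurableSet_Iio, Iio_inter_Iio, min_eq_left hrt]
  refine integral_congr_ae ?_
  filter_upwards [ae_restrict_of_ae hS.ae_mem, ae_restrict_mem measurableSet_Iio] with s hs hsr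
  exact h s hs hsr

lemma integral_Iio_congr {S : Set ℝ} (hS : IsHalfScale S) {f g : ℝ → ℝ} {t : ℝ}
    (h : ∀ s ∈ S, s < t → f s = g s) :
    ∫ s in Iio t, f s ∂deltaMeasure S = ∫ s in Iio t, g s ∂deltaMeasure S := by
  refine integral_congr_ae ?_
  filter_upwards [ae_restrict_of_ae hS.ae_mem, ae_restrict_mem measurableSet_Iio] with s hs hst
  exact h s hs hst

namespace IsKernel

variable {S₁ S₂ : Set ℝ} {h h₁ h₂ h₁₂ : ℝ → ℝ → ℝ → ℝ → ℝ}

/-- The double integral of a kernel, as a function of its upper limits, is the double integral of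
the coefficient function. The kernel is truncated to the rectangle of integration, which makes the
functions involved bounded and measurable. -/
theorem integral_eq_integral_kernelCoeff (hS₁ : IsHalfScale S₁) (hS₂ : IsHalfScale S₂)
    (hk : IsKernel S₁ S₂ h h₁ h₂ h₁₂) {t₁ t₂ : ℝ} (ht₁ : t₁ ∈ S₁) (ht₂ : t₂ ∈ S₂) :
    ∫ s₁ in Iio t₁, ∫ s₂ in Iio t₂, h t₁ t₂ s₁ s₂ ∂deltaMeasure S₂ ∂deltaMeasure S₁
      = ∫ s₁ in Iio t₁, ∫ s₂ in Iio t₂, kernelCoeff S₁ S₂ h h₁ h₂ h₁₂ s₁ s₂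
          ∂deltaMeasure S₂ ∂deltaMeasure S₁ := by
  have := hS₁.isFiniteMeasure_Iio ht₁
  have := hS₂.isFiniteMeasure_Iio ht₂
  set μ₁ := (deltaMeasure S₁).restrict (Iio t₁)
  set μ₂ := (deltaMeasure S₂).restrict (Iio t₂)
  set E₁ := S₁ ∩ Iio t₁ with hE₁
  set E₂ := S₂ ∩ Iio t₂ with hE₂
  set M := max t₁ t₂ with hM
  have mE₁ : MeasurableSet E₁ := hS₁.closed.measurableSet.inter measurableSet_Iio
  have mE₂ : MeasurableSet E₂ := hS₂.closed.measurableSet.inter measurableSet_Iio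
  have a₁ : ∀ s ∈ E₁, s ∈ S₁ ∩ Icc 0 M := fun s hs =>
    ⟨hs.1, hS₁.nonneg s hs.1, (le_of_lt hs.2).trans (le_max_left _ _)⟩
  have a₂ : ∀ s ∈ E₂, s ∈ S₂ ∩ Icc 0 M := fun s hs =>
    ⟨hs.1, hS₂.nonneg s hs.1, (le_of_lt hs.2).trans (le_max_right _ _)⟩
  have k₁ : ∀ s ∈ E₁, s ∈ kappa S₁ ∩ Icc 0 M := fun s hs =>
    ⟨mem_kappa_of_lt hs.1 ht₁ hs.2, (a₁ s hs).2⟩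
  have k₂ : ∀ s ∈ E₂, s ∈ kappa S₂ ∩ Icc 0 M := fun s hs =>
    ⟨mem_kappa_of_lt hs.1 ht₂ hs.2, (a₂ s hs).2⟩
  have σ₁ : ∀ s ∈ E₁, sigma S₁ s ∈ S₁ ∩ Icc 0 M := fun s hs =>
    ⟨sigma_mem hS₁.closed hs.1, hS₁.nonneg _ (sigma_mem hS₁.closed hs.1),
      (sigma_le ht₁ hs.2).trans (le_max_left _ _)⟩
  have σ₂ : ∀ s ∈ E₂, sigma S₂ s ∈ S₂ ∩ Icc 0 M := fun s hs =>
    ⟨sigma_mem hS₂.closed hs.1, hS₂.nonneg _ (sigma_mem hS₂.closed hs.1),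
      (sigma_le ht₂ hs.2).trans (le_max_right _ _)⟩
  have b₂ : t₂ ∈ S₂ ∩ Icc 0 M := ⟨ht₂, hS₂.nonneg _ ht₂, le_max_right _ _⟩
  have ms₁ : Measurable (sigma S₁) := (sigma_monotone S₁).measurable
  have ms₂ : Measurable (sigma S₂) := (sigma_monotone S₂).measurable
  have ae₁ : ∀ᵐ s ∂μ₁, s ∈ E₁ := by
    filter_upwards [ae_restrict_of_ae hS₁.ae_mem, ae_restrict_mem measurableSet_Iio]
      with s hs hst using ⟨hs, hst⟩
  have ae₂ : ∀ᵐ s ∂μ₂, s ∈ E₂ := by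
    filter_upwards [ae_restrict_of_ae hS₂.ae_mem, ae_restrict_mem measurableSet_Iio]
      with s hs hst using ⟨hs, hst⟩
  -- the truncated functions
  let K : ℝ → ℝ → ℝ := fun s₁ s₂ => (E₁ ×ˢ E₂).indicator (fun p => h t₁ t₂ p.1 p.2) (s₁, s₂)
  let K1 : ℝ → ℝ → ℝ := fun r₁ s₂ =>
    (E₁ ×ˢ E₂).indicator (fun p => h (sigma S₁ p.1) t₂ p.1 p.2) (r₁, s₂)
  let K2 : ℝ → ℝ → ℝ := fun r₁ r₂ =>
    (E₁ ×ˢ E₂).indicator (fun p => h (sigma S₁ p.1) (sigma S₂ p.2) p.1 p.2) (r₁, r₂)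
  let K11 : ℝ → ℝ → ℝ → ℝ := fun r₁ s₁ s₂ =>
    (E₁ ×ˢ E₁ ×ˢ E₂).indicator (fun p => h₁ p.1 t₂ p.2.1 p.2.2) (r₁, s₁, s₂)
  let K22 : ℝ → ℝ → ℝ → ℝ := fun r₁ r₂ s₂ =>
    (E₁ ×ˢ E₂ ×ˢ E₂).indicator (fun p => h₂ (sigma S₁ p.1) p.2.1 p.1 p.2.2) (r₁, r₂, s₂)
  let K3 : ℝ → ℝ → ℝ → ℝ := fun r₁ s₁ r₂ =>
    (E₁ ×ˢ E₁ ×ˢ E₂).indicator (fun p => h₁ p.1 (sigma S₂ p.2.2) p.2.1 p.2.2) (r₁, s₁, r₂)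
  let K12 : ℝ → ℝ → ℝ → ℝ → ℝ := fun r₁ r₂ s₁ s₂ =>
    (E₁ ×ˢ E₂ ×ˢ E₁ ×ˢ E₂).indicator (fun p => h₁₂ p.1 p.2.1 p.2.2.1 p.2.2.2) (r₁, r₂, s₁, s₂)
  have hK1 : IsBddMeas fun p : ℝ × ℝ => K1 p.1 p.2 :=
    hk.cont.isBddMeas hS₁.closed hS₂.closed hS₁.closed hS₂.closed (mE₁.prod mE₂)
      (a := fun p => sigma S₁ p.1) (b := fun _ => t₂) (c := fun p => p.1) (d := fun p => p.2)
      (by fun_prop) (by fun_prop) (by fun_prop) (by fun_prop)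
      (fun p hp => σ₁ _ hp.1) (fun p hp => b₂) (fun p hp => a₁ _ hp.1) (fun p hp => a₂ _ hp.2)
  have hK2 : IsBddMeas fun p : ℝ × ℝ => K2 p.1 p.2 :=
    hk.cont.isBddMeas hS₁.closed hS₂.closed hS₁.closed hS₂.closed (mE₁.prod mE₂)
      (a := fun p => sigma S₁ p.1) (b := fun p => sigma S₂ p.2) (c := fun p => p.1)
      (d := fun p => p.2) (by fun_prop) (by fun_prop) (by fun_prop) (by fun_prop)
      (fun p hp => σ₁ _ hp.1) (fun p hp => σ₂ _ hp.2) (fun p hp => a₁ _ hp.1)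
      (fun p hp => a₂ _ hp.2)
  have hK11 : IsBddMeas fun p : ℝ × ℝ × ℝ => K11 p.1 p.2.1 p.2.2 :=
    hk.cont₁.isBddMeas hS₁.isClosed_kappa hS₂.closed hS₁.closed hS₂.closed
      (mE₁.prod (mE₁.prod mE₂)) (a := fun p => p.1) (b := fun _ => t₂) (c := fun p => p.2.1)
      (d := fun p => p.2.2) (by fun_prop) (by fun_prop) (by fun_prop) (by fun_prop)
      (fun p hp => k₁ _ hp.1) (fun p hp => b₂) (fun p hp => a₁ _ hp.2.1)
      (fun p hp => a₂ _ hp.2.2)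
  have hK22 : IsBddMeas fun p : ℝ × ℝ × ℝ => K22 p.1 p.2.1 p.2.2 :=
    hk.cont₂.isBddMeas hS₁.closed hS₂.isClosed_kappa hS₁.closed hS₂.closed
      (mE₁.prod (mE₂.prod mE₂)) (a := fun p => sigma S₁ p.1) (b := fun p => p.2.1)
      (c := fun p => p.1) (d := fun p => p.2.2) (by fun_prop) (by fun_prop) (by fun_prop)
      (by fun_prop) (fun p hp => σ₁ _ hp.1) (fun p hp => k₂ _ hp.2.1) (fun p hp => a₁ _ hp.1)
      (fun p hp => a₂ _ hp.2.2)
  have hK3 : IsBddMeas fun p : ℝ × ℝ × ℝ => K3 p.1 p.2.1 p.2.2 :=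
    hk.cont₁.isBddMeas hS₁.isClosed_kappa hS₂.closed hS₁.closed hS₂.closed
      (mE₁.prod (mE₁.prod mE₂)) (a := fun p => p.1) (b := fun p => sigma S₂ p.2.2)
      (c := fun p => p.2.1) (d := fun p => p.2.2) (by fun_prop) (by fun_prop) (by fun_prop)
      (by fun_prop) (fun p hp => k₁ _ hp.1) (fun p hp => σ₂ _ hp.2.2) (fun p hp => a₁ _ hp.2.1)
      (fun p hp => a₂ _ hp.2.2)
  have hK12 : IsBddMeas fun p : ℝ × ℝ × ℝ × ℝ => K12 p.1 p.2.1 p.2.2.1 p.2.2.2 :=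
    hk.cont₁₂.isBddMeas hS₁.isClosed_kappa hS₂.isClosed_kappa hS₁.closed hS₂.closed
      (mE₁.prod (mE₂.prod (mE₁.prod mE₂))) (a := fun p => p.1) (b := fun p => p.2.1)
      (c := fun p => p.2.2.1) (d := fun p => p.2.2.2) (by fun_prop) (by fun_prop) (by fun_prop)
      (by fun_prop) (fun p hp => k₁ _ hp.1) (fun p hp => k₂ _ hp.2.1)
      (fun p hp => a₁ _ hp.2.2.1) (fun p hp => a₂ _ hp.2.2.2)
  have e : ∀ s₁ s₂, K s₁ s₂ = K1 s₁ s₂ + ∫ r₁ in Ioi s₁, K11 r₁ s₁ s₂ ∂μ₁ := by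
    intro s₁ s₂
    by_cases hs : s₁ ∈ E₁ ∧ s₂ ∈ E₂
    · have hint : ∫ r₁ in Ioi s₁, K11 r₁ s₁ s₂ ∂μ₁ = ∫ r₁ in Ioi s₁, h₁ r₁ t₂ s₁ s₂ ∂μ₁ := by
        refine integral_congr_ae ?_
        filter_upwards [ae_restrict_of_ae ae₁] with r hr
        exact indicator_of_mem (show (r, s₁, s₂) ∈ E₁ ×ˢ E₁ ×ˢ E₂ from ⟨hr, hs⟩) _
      rw [hint]
      have hKv : K s₁ s₂ = h t₁ t₂ s₁ s₂ := indicator_of_mem (show (s₁, s₂) ∈ E₁ ×ˢ E₂ from hs) _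
      have hK1v : K1 s₁ s₂ = h (sigma S₁ s₁) t₂ s₁ s₂ :=
        indicator_of_mem (show (s₁, s₂) ∈ E₁ ×ˢ E₂ from hs) _
      rw [hKv, hK1v]
      refine hS₁.eq_add_integral_Ioi (F := fun t => h t t₂ s₁ s₂) (f := fun r => h₁ r t₂ s₁ s₂)
        (fun r hr => ?_) (fun r hr => hk.deriv₁ r hr t₂ ht₂ s₁ hs.1.1 s₂ hs.2.1) hs.1.1 ht₁ hs.1.2
      exact hk.cont₁.comp_continuousWithinAt (a := id) (b := fun _ => t₂) (c := fun _ => s₁)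
        (d := fun _ => s₂) hr continuousWithinAt_id continuousWithinAt_const
        continuousWithinAt_const continuousWithinAt_const (fun _ hy => hy) (fun _ _ => ht₂)
        (fun _ _ => hs.1.1) (fun _ _ => hs.2.1)
    · have hz : ∀ r₁, K11 r₁ s₁ s₂ = 0 := fun r₁ => indicator_of_notMem (fun hm => hs hm.2) _
      have hKv : K s₁ s₂ = 0 :=
        indicator_of_notMem (fun hm : (s₁, s₂) ∈ E₁ ×ˢ E₂ => hs hm) _
      have hK1v : K1 s₁ s₂ = 0 :=
        indicator_of_notMem (fun hm : (s₁, s₂) ∈ E₁ ×ˢ E₂ => hs hm) _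
      simp [hKv, hK1v, hz]
  have e1 : ∀ r₁ s₂, K1 r₁ s₂ = K2 r₁ s₂ + ∫ r₂ in Ioi s₂, K22 r₁ r₂ s₂ ∂μ₂ := by
    intro r₁ s₂
    by_cases hs : r₁ ∈ E₁ ∧ s₂ ∈ E₂
    · have hint : ∫ r₂ in Ioi s₂, K22 r₁ r₂ s₂ ∂μ₂
          = ∫ r₂ in Ioi s₂, h₂ (sigma S₁ r₁) r₂ r₁ s₂ ∂μ₂ := by
        refine integral_congr_ae ?_
        filter_upwards [ae_restrict_of_ae ae₂] with r hr
        exact indicator_of_mem (show (r₁, r, s₂) ∈ E₁ ×ˢ E₂ ×ˢ E₂ from ⟨hs.1, hr, hs.2⟩) _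
      rw [hint]
      have hK1v : K1 r₁ s₂ = h (sigma S₁ r₁) t₂ r₁ s₂ :=
        indicator_of_mem (show (r₁, s₂) ∈ E₁ ×ˢ E₂ from hs) _
      have hK2v : K2 r₁ s₂ = h (sigma S₁ r₁) (sigma S₂ s₂) r₁ s₂ :=
        indicator_of_mem (show (r₁, s₂) ∈ E₁ ×ˢ E₂ from hs) _
      have hm := (σ₁ r₁ hs.1).1
      rw [hK1v, hK2v]
      refine hS₂.eq_add_integral_Ioi (F := fun t => h (sigma S₁ r₁) t r₁ s₂)
        (f := fun r => h₂ (sigma S₁ r₁) r r₁ s₂) (fun r hr => ?_)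
        (fun r hr => hk.deriv₂ _ hm r hr r₁ hs.1.1 s₂ hs.2.1) hs.2.1 ht₂ hs.2.2
      exact hk.cont₂.comp_continuousWithinAt (a := fun _ => sigma S₁ r₁) (b := id)
        (c := fun _ => r₁) (d := fun _ => s₂) hr continuousWithinAt_const continuousWithinAt_id
        continuousWithinAt_const continuousWithinAt_const (fun _ _ => hm) (fun _ hy => hy)
        (fun _ _ => hs.1.1) (fun _ _ => hs.2.1)
    · have hz : ∀ r₂, K22 r₁ r₂ s₂ = 0 := fun r₂ =>
        indicator_of_notMem (fun hm => hs ⟨hm.1, hm.2.2⟩) _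
      have hK1v : K1 r₁ s₂ = 0 :=
        indicator_of_notMem (fun hm : (r₁, s₂) ∈ E₁ ×ˢ E₂ => hs hm) _
      have hK2v : K2 r₁ s₂ = 0 :=
        indicator_of_notMem (fun hm : (r₁, s₂) ∈ E₁ ×ˢ E₂ => hs hm) _
      simp [hK1v, hK2v, hz]
  have e11 : ∀ r₁ s₁ s₂, K11 r₁ s₁ s₂ = K3 r₁ s₁ s₂ + ∫ r₂ in Ioi s₂, K12 r₁ r₂ s₁ s₂ ∂μ₂ := by
    intro r₁ s₁ s₂
    by_cases hs : r₁ ∈ E₁ ∧ s₁ ∈ E₁ ∧ s₂ ∈ E₂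
    · have hint : ∫ r₂ in Ioi s₂, K12 r₁ r₂ s₁ s₂ ∂μ₂
          = ∫ r₂ in Ioi s₂, h₁₂ r₁ r₂ s₁ s₂ ∂μ₂ := by
        refine integral_congr_ae ?_
        filter_upwards [ae_restrict_of_ae ae₂] with r hr
        exact indicator_of_mem
          (show (r₁, r, s₁, s₂) ∈ E₁ ×ˢ E₂ ×ˢ E₁ ×ˢ E₂ from ⟨hs.1, hr, hs.2⟩) _
      rw [hint]
      have hK11v : K11 r₁ s₁ s₂ = h₁ r₁ t₂ s₁ s₂ :=
        indicator_of_mem (show (r₁, s₁, s₂) ∈ E₁ ×ˢ E₁ ×ˢ E₂ from hs) _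
      have hK3v : K3 r₁ s₁ s₂ = h₁ r₁ (sigma S₂ s₂) s₁ s₂ :=
        indicator_of_mem (show (r₁, s₁, s₂) ∈ E₁ ×ˢ E₁ ×ˢ E₂ from hs) _
      have hm := (k₁ r₁ hs.1).1
      rw [hK11v, hK3v]
      refine hS₂.eq_add_integral_Ioi (F := fun t => h₁ r₁ t s₁ s₂)
        (f := fun r => h₁₂ r₁ r s₁ s₂) (fun r hr => ?_)
        (fun r hr => hk.deriv₁₂ r₁ hm r hr s₁ hs.2.1.1 s₂ hs.2.2.1) hs.2.2.1 ht₂ hs.2.2.2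
      exact hk.cont₁₂.comp_continuousWithinAt (a := fun _ => r₁) (b := id)
        (c := fun _ => s₁) (d := fun _ => s₂) hr continuousWithinAt_const continuousWithinAt_id
        continuousWithinAt_const continuousWithinAt_const (fun _ _ => hm) (fun _ hy => hy)
        (fun _ _ => hs.2.1.1) (fun _ _ => hs.2.2.1)
    · have hz : ∀ r₂, K12 r₁ r₂ s₁ s₂ = 0 := fun r₂ =>
        indicator_of_notMem (fun hm => hs ⟨hm.1, hm.2.2⟩) _
      have hK11v : K11 r₁ s₁ s₂ = 0 :=
        indicator_of_notMem (fun hm : (r₁, s₁, s₂) ∈ E₁ ×ˢ E₁ ×ˢ E₂ => hs hm) _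
      have hK3v : K3 r₁ s₁ s₂ = 0 :=
        indicator_of_notMem (fun hm : (r₁, s₁, s₂) ∈ E₁ ×ˢ E₁ ×ˢ E₂ => hs hm) _
      simp [hK11v, hK3v, hz]
  have key := integral_integral_eq_of_expansions μ₁ μ₂ hK1 hK2 hK11 hK22 hK3 hK12 e e1 e11
  have hL : ∫ s₁, ∫ s₂, h t₁ t₂ s₁ s₂ ∂μ₂ ∂μ₁ = ∫ s₁, ∫ s₂, K s₁ s₂ ∂μ₂ ∂μ₁ := by
    refine integral_congr_ae ?_
    filter_upwards [ae₁] with s₁ hs₁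
    refine integral_congr_ae ?_
    filter_upwards [ae₂] with s₂ hs₂
    have hKv : K s₁ s₂ = h t₁ t₂ s₁ s₂ :=
      indicator_of_mem (show (s₁, s₂) ∈ E₁ ×ˢ E₂ from ⟨hs₁, hs₂⟩) _
    exact hKv.symm
  rw [hL, key]
  refine integral_congr_ae ?_
  filter_upwards [ae₁] with r₁ hr₁
  refine integral_congr_ae ?_
  filter_upwards [ae₂] with r₂ hr₂
  have hlt₁ : r₁ ≤ t₁ := le_of_lt hr₁.2
  have hlt₂ : r₂ ≤ t₂ := le_of_lt hr₂.2
  have f₁ : ∀ s ∈ S₁, s < r₁ → s ∈ E₁ := fun s hs hsr => ⟨hs, hsr.trans_le hlt₁⟩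
  have f₂ : ∀ s ∈ S₂, s < r₂ → s ∈ E₂ := fun s hs hsr => ⟨hs, hsr.trans_le hlt₂⟩
  rw [kernelCoeff]
  congr 1
  · congr 1
    · congr 1
      · exact indicator_of_mem (show (r₁, r₂) ∈ E₁ ×ˢ E₂ from ⟨hr₁, hr₂⟩) _
      · exact setIntegral_restrict_Iio_congr hS₂ hlt₂ fun s hs hsr =>
          indicator_of_mem (show (r₁, r₂, s) ∈ E₁ ×ˢ E₂ ×ˢ E₂ from ⟨hr₁, hr₂, f₂ s hs hsr⟩) _
    · exact setIntegral_restrict_Iio_congr hS₁ hlt₁ fun s hs hsr =>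
        indicator_of_mem (show (r₁, s, r₂) ∈ E₁ ×ˢ E₁ ×ˢ E₂ from ⟨hr₁, f₁ s hs hsr, hr₂⟩) _
  · exact setIntegral_restrict_Iio_congr hS₁ hlt₁ fun s hs hsr =>
      setIntegral_restrict_Iio_congr hS₂ hlt₂ fun s' hs' hsr' =>
        indicator_of_mem (show (r₁, r₂, s, s') ∈ E₁ ×ˢ E₂ ×ˢ E₁ ×ˢ E₂ from
          ⟨hr₁, hr₂, f₁ s hs hsr, f₂ s' hs' hsr'⟩) _

end IsKernel

/-! ### Weighted kernels -/

lemma HasDeltaDerivAt.mul_const {S : Set ℝ} {f : ℝ → ℝ} {d t : ℝ} (hf : HasDeltaDerivAt S f d t)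
    (v : ℝ) : HasDeltaDerivAt S (fun s => f s * v) (d * v) t := by
  intro ε hε
  obtain ⟨δ, hδ, h⟩ := hf (ε / (|v| + 1)) (by positivity)
  refine ⟨δ, hδ, fun s hs hst => ?_⟩
  have h1 := h s hs hst
  calc _ = |f (sigma S t) - f s - d * (sigma S t - s)| * |v| := by
        rw [← abs_mul]
        ring_nf
    _ ≤ ε / (|v| + 1) * |sigma S t - s| * (|v| + 1) := by gcongr; linarith
    _ = ε * |sigma S t - s| := by field_simp

/-- The kernel `k(t₁, t₂, s₁, s₂) v(s₁, s₂)`. -/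
def weighted (k : ℝ → ℝ → ℝ → ℝ → ℝ) (v : ℝ → ℝ → ℝ) : ℝ → ℝ → ℝ → ℝ → ℝ :=
  fun t₁ t₂ s₁ s₂ => k t₁ t₂ s₁ s₂ * v s₁ s₂

/-- The coefficient function of `k` with weight `v`, in terms of the delta measures. -/
noncomputable def weightedCoeff (S₁ S₂ : Set ℝ) (k : ℝ → ℝ → ℝ → ℝ → ℝ) (v : ℝ → ℝ → ℝ) :
    ℝ → ℝ → ℝ :=
  kernelCoeff S₁ S₂ (weighted k v) (weighted (partial₁ S₁ k) v) (weighted (partial₂ S₂ k) v)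
    (weighted (partial₁₂ S₁ S₂ k) v)

section Weighted

variable {S₁ S₂ : Set ℝ} {k : ℝ → ℝ → ℝ → ℝ → ℝ} {u p q v : ℝ → ℝ → ℝ}

lemma JointlyContinuousOn.weighted {A B : Set ℝ} (hk : JointlyContinuousOn k A B S₁ S₂)
    (hv : ContinuousOn (fun x : ℝ × ℝ => v x.1 x.2) (S₁ ×ˢ S₂)) :
    JointlyContinuousOn (weighted k v) A B S₁ S₂ :=
  ContinuousOn.mul hk (hv.comp (f := fun x : ℝ × ℝ × ℝ × ℝ => (x.2.2.1, x.2.2.2))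
    (Continuous.continuousOn (by fun_prop)) fun _ hx => hx.2.2)

lemma IsSmoothKernel.isKernel (hk : IsSmoothKernel S₁ S₂ k)
    (hv : ContinuousOn (fun x : ℝ × ℝ => v x.1 x.2) (S₁ ×ˢ S₂)) :
    IsKernel S₁ S₂ (weighted k v) (weighted (partial₁ S₁ k) v) (weighted (partial₂ S₂ k) v)
      (weighted (partial₁₂ S₁ S₂ k) v) where
  cont := hk.cont.weighted hv
  cont₁ := hk.cont₁.weighted hv
  cont₂ := hk.cont₂.weighted hv
  cont₁₂ := hk.cont₁₂.weighted hv
  deriv₁ := fun t₁ h₁ t₂ h₂ s₁ hs₁ s₂ hs₂ =>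
    (hk.diff₁ t₁ h₁ t₂ h₂ s₁ hs₁ s₂ hs₂).hasDeltaDerivAt.mul_const _
  deriv₂ := fun t₁ h₁ t₂ h₂ s₁ hs₁ s₂ hs₂ =>
    (hk.diff₂ t₁ h₁ t₂ h₂ s₁ hs₁ s₂ hs₂).hasDeltaDerivAt.mul_const _
  deriv₁₂ := fun t₁ h₁ t₂ h₂ s₁ hs₁ s₂ hs₂ =>
    (hk.diff₁₂ t₁ h₁ t₂ h₂ s₁ hs₁ s₂ hs₂).hasDeltaDerivAt.mul_const _

lemma isDeltaRegular₂_weightedCoeff (hS₁ : IsHalfScale S₁) (hS₂ : IsHalfScale S₂)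
    (hk : IsSmoothKernel S₁ S₂ k) (hv : ContinuousOn (fun x : ℝ × ℝ => v x.1 x.2) (S₁ ×ˢ S₂)) :
    IsDeltaRegular₂ S₁ S₂ (weightedCoeff S₁ S₂ k v) :=
  (hk.isKernel hv).isDeltaRegular₂_kernelCoeff hS₁ hS₂

/-! ### Conversion of iterated delta integrals -/

lemma deltaIntegral₂_eq (hS₁ : IsHalfScale S₁) (hS₂ : IsHalfScale S₂) {F : ℝ → ℝ → ℝ} {t₁ t₂ : ℝ}
    (h₁ : t₁ ∈ S₁) (h₂ : t₂ ∈ S₂) (hF : ∀ s₁ ∈ kappa S₁, IsDeltaRegular S₂ (F s₁))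
    (hF' : IsDeltaRegular S₁ fun s₁ => ∫ s₂ in Iio t₂, F s₁ s₂ ∂deltaMeasure S₂) :
    deltaIntegral₂ S₁ S₂ F t₁ t₂
      = ∫ s₁ in Iio t₁, ∫ s₂ in Iio t₂, F s₁ s₂ ∂deltaMeasure S₂ ∂deltaMeasure S₁ := by
  have heq : ∀ s₁ ∈ kappa S₁, deltaIntegral S₂ (fun s₂ => F s₁ s₂) 0 t₂
      = ∫ s₂ in Iio t₂, F s₁ s₂ ∂deltaMeasure S₂ := fun s₁ hs₁ =>
    (hF s₁ hs₁).deltaIntegral_eq hS₂ h₂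
  rw [deltaIntegral₂, (hF'.congr heq).deltaIntegral_eq hS₁ h₁]
  exact integral_Iio_congr hS₁ fun s hs hst => heq s (mem_kappa_of_lt hs h₁ hst)

lemma IsDeltaRegular₂.deltaIntegral₂_eq (hS₁ : IsHalfScale S₁) (hS₂ : IsHalfScale S₂)
    {F : ℝ → ℝ → ℝ} (hF : IsDeltaRegular₂ S₁ S₂ F) {t₁ t₂ : ℝ} (h₁ : t₁ ∈ S₁) (h₂ : t₂ ∈ S₂) :
    deltaIntegral₂ S₁ S₂ F t₁ t₂
      = ∫ s₁ in Iio t₁, ∫ s₂ in Iio t₂, F s₁ s₂ ∂deltaMeasure S₂ ∂deltaMeasure S₁ :=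
  TimeScale.deltaIntegral₂_eq hS₁ hS₂ h₁ h₂ (fun _ hs => hF.isDeltaRegular_right hs)
    (hF.isDeltaRegular_integral hS₂ h₂)

namespace JointlyContinuousOn

variable {A B : Set ℝ} {h : ℝ → ℝ → ℝ → ℝ → ℝ}

lemma isDeltaRegular_third (hh : JointlyContinuousOn h A B S₁ S₂) (hS₁ : IsHalfScale S₁)
    {a b s₂ : ℝ} (ha : a ∈ A) (hb : b ∈ B) (hs₂ : s₂ ∈ S₂) :
    IsDeltaRegular S₁ (fun s₁ => h a b s₁ s₂) :=
  isDeltaRegular_of_continuousOn hS₁ (hh.continuousOn_third ha hb hs₂)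

lemma isDeltaRegular_fourth (hh : JointlyContinuousOn h A B S₁ S₂) (hS₂ : IsHalfScale S₂)
    {a b s₁ : ℝ} (ha : a ∈ A) (hb : b ∈ B) (hs₁ : s₁ ∈ S₁) :
    IsDeltaRegular S₂ (fun s₂ => h a b s₁ s₂) :=
  isDeltaRegular_of_continuousOn hS₂ (hh.continuousOn_fourth ha hb hs₁)

lemma isDeltaRegular_integral (hh : JointlyContinuousOn h A B S₁ S₂) (hS₁ : IsHalfScale S₁)
    (hS₂ : IsHalfScale S₂) {a b t₂ : ℝ} (ha : a ∈ A) (hb : b ∈ B) (h₂ : t₂ ∈ S₂) :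
    IsDeltaRegular S₁ (fun s₁ => ∫ s₂ in Iio t₂, h a b s₁ s₂ ∂deltaMeasure S₂) :=
  isDeltaRegular_of_continuousOn hS₁ (hh.continuousOn_integral hS₁ hS₂ ha hb h₂)

lemma deltaIntegral₂_eq (hh : JointlyContinuousOn h A B S₁ S₂) (hS₁ : IsHalfScale S₁)
    (hS₂ : IsHalfScale S₂) {a b t₁ t₂ : ℝ} (ha : a ∈ A) (hb : b ∈ B) (h₁ : t₁ ∈ S₁)
    (h₂ : t₂ ∈ S₂) :
    deltaIntegral₂ S₁ S₂ (fun s₁ s₂ => h a b s₁ s₂) t₁ t₂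
      = ∫ s₁ in Iio t₁, ∫ s₂ in Iio t₂, h a b s₁ s₂ ∂deltaMeasure S₂ ∂deltaMeasure S₁ :=
  TimeScale.deltaIntegral₂_eq hS₁ hS₂ h₁ h₂
    (fun _ hs => hh.isDeltaRegular_fourth hS₂ ha hb (kappa_subset _ hs))
    (hh.isDeltaRegular_integral hS₁ hS₂ ha hb h₂)

end JointlyContinuousOn

lemma coeff_eq_weightedCoeff (hS₁ : IsHalfScale S₁) (hS₂ : IsHalfScale S₂)
    (hk : IsSmoothKernel S₁ S₂ k) (hv : ContinuousOn (fun x : ℝ × ℝ => v x.1 x.2) (S₁ ×ˢ S₂))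
    {t₁ t₂ : ℝ} (h₁ : t₁ ∈ kappa S₁) (h₂ : t₂ ∈ kappa S₂) :
    coeff S₁ S₂ k v t₁ t₂ = weightedCoeff S₁ S₂ k v t₁ t₂ := by
  have hK := hk.isKernel hv
  have k₁ := kappa_subset _ h₁
  have k₂ := kappa_subset _ h₂
  have e2 := (hK.cont₂.isDeltaRegular_fourth hS₂ (sigma_mem hS₁.closed k₁) h₂
    k₁).deltaIntegral_eq hS₂ k₂
  have e1 := (hK.cont₁.isDeltaRegular_third hS₁ h₁ (sigma_mem hS₂.closed k₂)
    k₂).deltaIntegral_eq hS₁ k₁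
  have e12 := hK.cont₁₂.deltaIntegral₂_eq hS₁ hS₂ h₁ h₂ k₁ k₂
  rw [weightedCoeff, kernelCoeff, ← e2, ← e1, ← e12]
  rfl

/-! ### Monotonicity -/

lemma integral_Iio_nonneg {S : Set ℝ} (hS : IsHalfScale S) {f : ℝ → ℝ} {t : ℝ}
    (h : ∀ s ∈ S, s < t → 0 ≤ f s) : 0 ≤ ∫ s in Iio t, f s ∂deltaMeasure S := by
  refine integral_nonneg_of_ae ?_
  filter_upwards [ae_restrict_of_ae hS.ae_mem, ae_restrict_mem measurableSet_Iio] with s hs hst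
  exact h s hs hst

lemma integral_Iio_mono {S : Set ℝ} (hS : IsHalfScale S) {f g : ℝ → ℝ} {s t : ℝ} (ht : t ∈ S)
    (hst : s ≤ t) (hf : IsDeltaRegular S f) (hg : IsDeltaRegular S g)
    (h0 : ∀ r ∈ S, 0 ≤ g r) (h : ∀ r ∈ S, f r ≤ g r) :
    ∫ r in Iio s, f r ∂deltaMeasure S ≤ ∫ r in Iio t, g r ∂deltaMeasure S := by
  have hsub : Iio s ⊆ Iio t := Iio_subset_Iio hst
  have hgi := hg.integrableOn hS ht
  calc ∫ r in Iio s, f r ∂deltaMeasure S ≤ ∫ r in Iio s, g r ∂deltaMeasure S :=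
        integral_mono_ae ((hf.integrableOn hS ht).mono_set hsub) (hgi.mono_set hsub)
          (ae_restrict_of_ae (hS.ae_mem.mono h))
    _ ≤ ∫ r in Iio t, g r ∂deltaMeasure S :=
        setIntegral_mono_set hgi (ae_restrict_of_ae (hS.ae_mem.mono h0)) hsub.eventuallyLE

lemma integral_le_add_mul {S : Set ℝ} (hS : IsHalfScale S) {f g g' : ℝ → ℝ} {t Z : ℝ}
    (ht : t ∈ S) (hf : IsDeltaRegular S f) (hg : IsDeltaRegular S g) (hg' : IsDeltaRegular S g')
    (h : ∀ s ∈ S, s < t → f s ≤ g s + Z * g' s) :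
    ∫ s in Iio t, f s ∂deltaMeasure S
      ≤ (∫ s in Iio t, g s ∂deltaMeasure S) + Z * ∫ s in Iio t, g' s ∂deltaMeasure S := by
  have hi := hg.integrableOn hS ht
  have hi' := (hg'.integrableOn hS ht).const_mul Z
  rw [← integral_const_mul, ← integral_add hi hi']
  refine integral_mono_ae (hf.integrableOn hS ht) (hi.add hi') ?_
  filter_upwards [ae_restrict_of_ae hS.ae_mem, ae_restrict_mem measurableSet_Iio] with s hs hst
  exact h s hs hst

lemma le_of_hasDeltaDerivAt_nonneg {S : Set ℝ} (hS : IsHalfScale S) {f F : ℝ → ℝ}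
    (hf : ContinuousOn f (kappa S)) (hd : ∀ r ∈ kappa S, HasDeltaDerivAt S F (f r) r)
    (h0 : ∀ r ∈ kappa S, 0 ≤ f r) {s t : ℝ} (hs : s ∈ S) (ht : t ∈ S) (hst : s ≤ t) :
    F s ≤ F t := by
  have h := (IsDeltaRegular.of_continuousOn hS hf).integral_eq_sub hS hd hs ht hst
  have h' : 0 ≤ ∫ r in Ico s t, f r ∂deltaMeasure S := by
    refine integral_nonneg_of_ae ?_
    filter_upwards [ae_restrict_of_ae hS.ae_mem, ae_restrict_mem measurableSet_Ico] with r hr hrt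
    exact h0 r (mem_kappa_of_lt hr ht hrt.2)
  linarith

/-- Nonnegativity of a kernel and of its delta derivatives. -/
structure IsNonnegKernel (S₁ S₂ : Set ℝ) (k : ℝ → ℝ → ℝ → ℝ → ℝ) : Prop where
  nonneg : ∀ t₁ ∈ S₁, ∀ t₂ ∈ S₂, ∀ s₁ ∈ S₁, ∀ s₂ ∈ S₂, 0 ≤ k t₁ t₂ s₁ s₂
  nonneg₁ : ∀ t₁ ∈ kappa S₁, ∀ t₂ ∈ S₂, ∀ s₁ ∈ S₁, ∀ s₂ ∈ S₂, 0 ≤ partial₁ S₁ k t₁ t₂ s₁ s₂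
  nonneg₂ : ∀ t₁ ∈ S₁, ∀ t₂ ∈ kappa S₂, ∀ s₁ ∈ S₁, ∀ s₂ ∈ S₂, 0 ≤ partial₂ S₂ k t₁ t₂ s₁ s₂
  nonneg₁₂ : ∀ t₁ ∈ kappa S₁, ∀ t₂ ∈ kappa S₂, ∀ s₁ ∈ S₁, ∀ s₂ ∈ S₂,
    0 ≤ partial₁₂ S₁ S₂ k t₁ t₂ s₁ s₂

namespace IsNonnegKernel

lemma kernel_mono (hS₁ : IsHalfScale S₁) (hS₂ : IsHalfScale S₂) (hk : IsSmoothKernel S₁ S₂ k)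
    (hk0 : IsNonnegKernel S₁ S₂ k) {r₁ r₂ t₁ t₂ s₁ s₂ : ℝ} (hr₁ : r₁ ∈ S₁) (hr₂ : r₂ ∈ S₂)
    (ht₁ : t₁ ∈ S₁) (ht₂ : t₂ ∈ S₂) (hs₁ : s₁ ∈ S₁) (hs₂ : s₂ ∈ S₂) (h₁ : r₁ ≤ t₁)
    (h₂ : r₂ ≤ t₂) : k r₁ r₂ s₁ s₂ ≤ k t₁ t₂ s₁ s₂ := by
  calc k r₁ r₂ s₁ s₂ ≤ k t₁ r₂ s₁ s₂ := by
        refine le_of_hasDeltaDerivAt_nonneg hS₁ (F := fun t => k t r₂ s₁ s₂)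
          (f := fun t => partial₁ S₁ k t r₂ s₁ s₂) (fun r hr => ?_)
          (fun r hr => (hk.diff₁ r hr r₂ hr₂ s₁ hs₁ s₂ hs₂).hasDeltaDerivAt)
          (fun r hr => hk0.nonneg₁ r hr r₂ hr₂ s₁ hs₁ s₂ hs₂) hr₁ ht₁ h₁
        exact hk.cont₁.comp_continuousWithinAt (a := id) (b := fun _ => r₂) (c := fun _ => s₁)
          (d := fun _ => s₂) hr continuousWithinAt_id continuousWithinAt_const
          continuousWithinAt_const continuousWithinAt_const (fun _ hy => hy) (fun _ _ => hr₂)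
          (fun _ _ => hs₁) (fun _ _ => hs₂)
    _ ≤ k t₁ t₂ s₁ s₂ := by
        refine le_of_hasDeltaDerivAt_nonneg hS₂ (F := fun t => k t₁ t s₁ s₂)
          (f := fun t => partial₂ S₂ k t₁ t s₁ s₂) (fun r hr => ?_)
          (fun r hr => (hk.diff₂ t₁ ht₁ r hr s₁ hs₁ s₂ hs₂).hasDeltaDerivAt)
          (fun r hr => hk0.nonneg₂ t₁ ht₁ r hr s₁ hs₁ s₂ hs₂) hr₂ ht₂ h₂
        exact hk.cont₂.comp_continuousWithinAt (a := fun _ => t₁) (b := id) (c := fun _ => s₁)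
          (d := fun _ => s₂) hr continuousWithinAt_const continuousWithinAt_id
          continuousWithinAt_const continuousWithinAt_const (fun _ _ => ht₁) (fun _ hy => hy)
          (fun _ _ => hs₁) (fun _ _ => hs₂)

/-- The double integral of a kernel is nondecreasing in its upper limits, on which the kernel
depends as well. -/
lemma integral_mono (hS₁ : IsHalfScale S₁) (hS₂ : IsHalfScale S₂) (hk : IsSmoothKernel S₁ S₂ k)
    (hk0 : IsNonnegKernel S₁ S₂ k)
    (hv : ContinuousOn (fun x : ℝ × ℝ => v x.1 x.2) (S₁ ×ˢ S₂))
    (hv0 : ∀ s₁ ∈ S₁, ∀ s₂ ∈ S₂, 0 ≤ v s₁ s₂) {r₁ r₂ t₁ t₂ : ℝ} (hr₁ : r₁ ∈ S₁) (hr₂ : r₂ ∈ S₂)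
    (ht₁ : t₁ ∈ S₁) (ht₂ : t₂ ∈ S₂) (h₁ : r₁ ≤ t₁) (h₂ : r₂ ≤ t₂) :
    ∫ s₁ in Iio r₁, ∫ s₂ in Iio r₂, weighted k v r₁ r₂ s₁ s₂ ∂deltaMeasure S₂ ∂deltaMeasure S₁
      ≤ ∫ s₁ in Iio t₁, ∫ s₂ in Iio t₂, weighted k v t₁ t₂ s₁ s₂
          ∂deltaMeasure S₂ ∂deltaMeasure S₁ := by
  have hK := hk.cont.weighted hv
  have hnn : ∀ s₁ ∈ S₁, ∀ s₂ ∈ S₂, 0 ≤ weighted k v t₁ t₂ s₁ s₂ := fun s₁ hs₁ s₂ hs₂ =>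
    mul_nonneg (hk0.nonneg _ ht₁ _ ht₂ _ hs₁ _ hs₂) (hv0 _ hs₁ _ hs₂)
  refine integral_Iio_mono hS₁ ht₁ h₁ (hK.isDeltaRegular_integral hS₁ hS₂ hr₁ hr₂ hr₂)
    (hK.isDeltaRegular_integral hS₁ hS₂ ht₁ ht₂ ht₂)
    (fun s₁ hs₁ => integral_Iio_nonneg hS₂ fun s₂ hs₂ _ => hnn s₁ hs₁ s₂ hs₂) fun s₁ hs₁ => ?_
  refine integral_Iio_mono hS₂ ht₂ h₂ (hK.isDeltaRegular_fourth hS₂ hr₁ hr₂ hs₁)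
    (hK.isDeltaRegular_fourth hS₂ ht₁ ht₂ hs₁) (hnn s₁ hs₁) fun s₂ hs₂ => ?_
  exact mul_le_mul_of_nonneg_right (hk0.kernel_mono hS₁ hS₂ hk hr₁ hr₂ ht₁ ht₂ hs₁ hs₂ h₁ h₂)
    (hv0 _ hs₁ _ hs₂)

lemma weightedCoeff_nonneg (hS₁ : IsHalfScale S₁) (hS₂ : IsHalfScale S₂)
    (hk0 : IsNonnegKernel S₁ S₂ k) (hv0 : ∀ s₁ ∈ S₁, ∀ s₂ ∈ S₂, 0 ≤ v s₁ s₂) {t₁ t₂ : ℝ}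
    (h₁ : t₁ ∈ kappa S₁) (h₂ : t₂ ∈ kappa S₂) : 0 ≤ weightedCoeff S₁ S₂ k v t₁ t₂ := by
  have k₁ := kappa_subset _ h₁
  have k₂ := kappa_subset _ h₂
  have m₁ := sigma_mem hS₁.closed k₁
  have m₂ := sigma_mem hS₂.closed k₂
  refine add_nonneg (add_nonneg (add_nonneg ?_ ?_) ?_) ?_
  · exact mul_nonneg (hk0.nonneg _ m₁ _ m₂ _ k₁ _ k₂) (hv0 _ k₁ _ k₂)
  · exact integral_Iio_nonneg hS₂ fun s hs _ =>
      mul_nonneg (hk0.nonneg₂ _ m₁ _ h₂ _ k₁ _ hs) (hv0 _ k₁ _ hs)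
  · exact integral_Iio_nonneg hS₁ fun s hs _ =>
      mul_nonneg (hk0.nonneg₁ _ h₁ _ m₂ _ hs _ k₂) (hv0 _ hs _ k₂)
  · exact integral_Iio_nonneg hS₁ fun s hs _ => integral_Iio_nonneg hS₂ fun s' hs' _ =>
      mul_nonneg (hk0.nonneg₁₂ _ h₁ _ h₂ _ hs _ hs') (hv0 _ hs _ hs')

lemma mul_le_add_mul {K a b c Z : ℝ} (hK : 0 ≤ K) (h : a ≤ b + Z * c) :
    K * a ≤ K * b + Z * (K * c) := by
  nlinarith [mul_le_mul_of_nonneg_left h hK]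

/-- The coefficient function at `(t₁, t₂)` depends on the weight only through its values up to
`(t₁, t₂)`, monotonically and linearly. -/
lemma weightedCoeff_le (hS₁ : IsHalfScale S₁) (hS₂ : IsHalfScale S₂)
    (hk : IsSmoothKernel S₁ S₂ k) (hk0 : IsNonnegKernel S₁ S₂ k)
    (hu : ContinuousOn (fun x : ℝ × ℝ => u x.1 x.2) (S₁ ×ˢ S₂))
    (hp : ContinuousOn (fun x : ℝ × ℝ => p x.1 x.2) (S₁ ×ˢ S₂))
    (hq : ContinuousOn (fun x : ℝ × ℝ => q x.1 x.2) (S₁ ×ˢ S₂)) {t₁ t₂ Z : ℝ}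
    (h₁ : t₁ ∈ kappa S₁) (h₂ : t₂ ∈ kappa S₂)
    (h : ∀ s₁ ∈ S₁, ∀ s₂ ∈ S₂, s₁ ≤ t₁ → s₂ ≤ t₂ → u s₁ s₂ ≤ p s₁ s₂ + Z * q s₁ s₂) :
    weightedCoeff S₁ S₂ k u t₁ t₂
      ≤ weightedCoeff S₁ S₂ k p t₁ t₂ + Z * weightedCoeff S₁ S₂ k q t₁ t₂ := by
  have k₁ := kappa_subset _ h₁
  have k₂ := kappa_subset _ h₂
  have m₁ := sigma_mem hS₁.closed k₁
  have m₂ := sigma_mem hS₂.closed k₂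
  have i0 : weighted k u (sigma S₁ t₁) (sigma S₂ t₂) t₁ t₂
      ≤ weighted k p (sigma S₁ t₁) (sigma S₂ t₂) t₁ t₂
        + Z * weighted k q (sigma S₁ t₁) (sigma S₂ t₂) t₁ t₂ :=
    mul_le_add_mul (hk0.nonneg _ m₁ _ m₂ _ k₁ _ k₂) (h _ k₁ _ k₂ le_rfl le_rfl)
  have i2 := integral_le_add_mul hS₂ k₂ (Z := Z)
    ((hk.cont₂.weighted hu).isDeltaRegular_fourth hS₂ m₁ h₂ k₁)
    ((hk.cont₂.weighted hp).isDeltaRegular_fourth hS₂ m₁ h₂ k₁)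
    ((hk.cont₂.weighted hq).isDeltaRegular_fourth hS₂ m₁ h₂ k₁) fun s hs hst =>
      mul_le_add_mul (hk0.nonneg₂ _ m₁ _ h₂ _ k₁ _ hs) (h _ k₁ _ hs le_rfl hst.le)
  have i1 := integral_le_add_mul hS₁ k₁ (Z := Z)
    ((hk.cont₁.weighted hu).isDeltaRegular_third hS₁ h₁ m₂ k₂)
    ((hk.cont₁.weighted hp).isDeltaRegular_third hS₁ h₁ m₂ k₂)
    ((hk.cont₁.weighted hq).isDeltaRegular_third hS₁ h₁ m₂ k₂) fun s hs hst =>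
      mul_le_add_mul (hk0.nonneg₁ _ h₁ _ m₂ _ hs _ k₂) (h _ hs _ k₂ hst.le le_rfl)
  have i12 := integral_le_add_mul hS₁ k₁ (Z := Z)
    ((hk.cont₁₂.weighted hu).isDeltaRegular_integral hS₁ hS₂ h₁ h₂ k₂)
    ((hk.cont₁₂.weighted hp).isDeltaRegular_integral hS₁ hS₂ h₁ h₂ k₂)
    ((hk.cont₁₂.weighted hq).isDeltaRegular_integral hS₁ hS₂ h₁ h₂ k₂) fun s hs hst =>
      integral_le_add_mul hS₂ k₂
        ((hk.cont₁₂.weighted hu).isDeltaRegular_fourth hS₂ h₁ h₂ hs)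
        ((hk.cont₁₂.weighted hp).isDeltaRegular_fourth hS₂ h₁ h₂ hs)
        ((hk.cont₁₂.weighted hq).isDeltaRegular_fourth hS₂ h₁ h₂ hs) fun s' hs' hst' =>
          mul_le_add_mul (hk0.nonneg₁₂ _ h₁ _ h₂ _ hs _ hs') (h _ hs _ hs' hst.le hst'.le)
  rw [weightedCoeff, weightedCoeff, weightedCoeff, kernelCoeff, kernelCoeff, kernelCoeff]
  linarith

end IsNonnegKernel

end Weighted

/-! ### Pachpatte's inequality -/

/-- The Gronwall argument for the double integral `z` of the kernel with weight `u`: if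
`u ≤ p + q z`, then `z ≤ A x`, where `x` is an exponential of `c(·, t₂)`. -/
theorem integral_le_mul_exponential {S₁ S₂ : Set ℝ} {k : ℝ → ℝ → ℝ → ℝ → ℝ} {u p q : ℝ → ℝ → ℝ}
    (hS₁ : IsHalfScale S₁) (hS₂ : IsHalfScale S₂)
    (hk : IsSmoothKernel S₁ S₂ k) (hk0 : IsNonnegKernel S₁ S₂ k)
    (hu : ContinuousOn (fun x : ℝ × ℝ => u x.1 x.2) (S₁ ×ˢ S₂))
    (hp : ContinuousOn (fun x : ℝ × ℝ => p x.1 x.2) (S₁ ×ˢ S₂))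
    (hq : ContinuousOn (fun x : ℝ × ℝ => q x.1 x.2) (S₁ ×ˢ S₂))
    (hu0 : ∀ t₁ ∈ S₁, ∀ t₂ ∈ S₂, 0 ≤ u t₁ t₂) (hp0 : ∀ t₁ ∈ S₁, ∀ t₂ ∈ S₂, 0 ≤ p t₁ t₂)
    (hq0 : ∀ t₁ ∈ S₁, ∀ t₂ ∈ S₂, 0 ≤ q t₁ t₂)
    (hle : ∀ t₁ ∈ S₁, ∀ t₂ ∈ S₂, u t₁ t₂ ≤ p t₁ t₂ + q t₁ t₂ *
      ∫ s₁ in Iio t₁, ∫ s₂ in Iio t₂, weighted k u t₁ t₂ s₁ s₂ ∂deltaMeasure S₂ ∂deltaMeasure S₁)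
    {t₁ t₂ : ℝ} (ht₁ : t₁ ∈ S₁) (ht₂ : t₂ ∈ S₂) {c x : ℝ → ℝ}
    (hc : ∀ s₁ ∈ kappa S₁, c s₁ = ∫ s₂ in Iio t₂, weightedCoeff S₁ S₂ k q s₁ s₂ ∂deltaMeasure S₂)
    (hx : IsExponential S₁ c 0 x) :
    ∫ s₁ in Iio t₁, ∫ s₂ in Iio t₂, weighted k u t₁ t₂ s₁ s₂ ∂deltaMeasure S₂ ∂deltaMeasure S₁
      ≤ (∫ s₁ in Iio t₁, ∫ s₂ in Iio t₂, weightedCoeff S₁ S₂ k p s₁ s₂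
          ∂deltaMeasure S₂ ∂deltaMeasure S₁) * x t₁ := by
  set z : ℝ → ℝ → ℝ := fun t₁ t₂ => ∫ s₁ in Iio t₁, ∫ s₂ in Iio t₂,
    weighted k u t₁ t₂ s₁ s₂ ∂deltaMeasure S₂ ∂deltaMeasure S₁ with hz
  have ru := isDeltaRegular₂_weightedCoeff hS₁ hS₂ hk hu
  have rp := isDeltaRegular₂_weightedCoeff hS₁ hS₂ hk hp
  have rq := isDeltaRegular₂_weightedCoeff hS₁ hS₂ hk hq
  have hcreg : IsDeltaRegular S₁ c := (rq.isDeltaRegular_integral hS₂ ht₂).congr hc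
  have hc0 : ∀ s ∈ kappa S₁, 0 ≤ c s := fun s hs => by
    rw [hc s hs]
    exact integral_Iio_nonneg hS₂ fun s₂ hs₂ h2 =>
      hk0.weightedCoeff_nonneg hS₁ hS₂ hq0 hs (mem_kappa_of_lt hs₂ ht₂ h2)
  have hzeq : ∀ t ∈ S₁, z t t₂ = ∫ s₁ in Iio t, ∫ s₂ in Iio t₂,
      weightedCoeff S₁ S₂ k u s₁ s₂ ∂deltaMeasure S₂ ∂deltaMeasure S₁ := fun t ht =>
    (hk.isKernel hu).integral_eq_integral_kernelCoeff hS₁ hS₂ ht ht₂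
  have hzcont : ContinuousOn (fun t => z t t₂) S₁ :=
    ((ru.isDeltaRegular_integral hS₂ ht₂).continuousOn_integral hS₁).congr hzeq
  have hzreg := isDeltaRegular_of_continuousOn hS₁ hzcont
  -- `z(s₁, s₂)` is replaced by its upper bound `z(s₁, t₂)`, which leaves an inequality in `s₁` only
  have hcoeff : ∀ s₁ ∈ kappa S₁, ∀ s₂ ∈ kappa S₂, s₂ ≤ t₂ → weightedCoeff S₁ S₂ k u s₁ s₂
      ≤ weightedCoeff S₁ S₂ k p s₁ s₂ + z s₁ t₂ * weightedCoeff S₁ S₂ k q s₁ s₂ := by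
    intro s₁ hs₁ s₂ hs₂ hst
    refine hk0.weightedCoeff_le hS₁ hS₂ hk hu hp hq hs₁ hs₂ fun r₁ hr₁ r₂ hr₂ h1 h2 => ?_
    refine (hle r₁ hr₁ r₂ hr₂).trans (add_le_add le_rfl ?_)
    rw [mul_comm]
    exact mul_le_mul_of_nonneg_right (hk0.integral_mono hS₁ hS₂ hk hu hu0 hr₁ hr₂
      (kappa_subset _ hs₁) ht₂ h1 (h2.trans hst)) (hq0 _ hr₁ _ hr₂)
  have hzle : ∀ t ∈ S₁, t ≤ t₁ → z t t₂ ≤ (∫ s₁ in Iio t₁, ∫ s₂ in Iio t₂,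
      weightedCoeff S₁ S₂ k p s₁ s₂ ∂deltaMeasure S₂ ∂deltaMeasure S₁)
        + ∫ r in Iio t, c r * z r t₂ ∂deltaMeasure S₁ := by
    intro t ht htt
    rw [hzeq t ht]
    have h1 := integral_le_add_mul hS₁ (Z := 1) ht (ru.isDeltaRegular_integral hS₂ ht₂)
      (rp.isDeltaRegular_integral hS₂ ht₂) (hcreg.mul hzreg) fun s hs hst => by
        have hsk := mem_kappa_of_lt hs ht hst
        rw [one_mul, hc s hsk, mul_comm]
        exact integral_le_add_mul hS₂ ht₂ (ru.isDeltaRegular_right hsk)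
          (rp.isDeltaRegular_right hsk) (rq.isDeltaRegular_right hsk) fun s₂ hs₂ h2 =>
            hcoeff s hsk s₂ (mem_kappa_of_lt hs₂ ht₂ h2) h2.le
    rw [one_mul] at h1
    refine h1.trans (add_le_add ?_ le_rfl)
    refine setIntegral_mono_set ((rp.isDeltaRegular_integral hS₂ ht₂).integrableOn hS₁ ht₁) ?_
      (Iio_subset_Iio htt).eventuallyLE
    filter_upwards [hS₁.ae_mem_kappa ht₁] with s hs
    exact integral_Iio_nonneg hS₂ fun s₂ hs₂ h2 =>
      hk0.weightedCoeff_nonneg hS₁ hS₂ hp0 hs (mem_kappa_of_lt hs₂ ht₂ h2)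
  have hcomp : IsCompact (S₁ ∩ Icc 0 t₁) := isCompact_Icc.inter_left hS₁.closed
  obtain ⟨M, hM⟩ := hcomp.exists_bound_of_continuousOn (hzcont.mono inter_subset_left)
  exact gronwall hS₁ hcreg hc0 hx (y := fun t => z t t₂) ht₁
    (hzreg.aestronglyMeasurable hS₁ ht₁) (fun t ht htt => hM t ⟨ht, hS₁.nonneg t ht, htt⟩) hzle

/-- Pachpatte's inequality on `S₁ × S₂`. -/
theorem pachpatte {S₁ S₂ : Set ℝ} {k : ℝ → ℝ → ℝ → ℝ → ℝ} {u p q : ℝ → ℝ → ℝ}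
    (hS₁ : IsHalfScale S₁) (hS₂ : IsHalfScale S₂)
    (hk : IsSmoothKernel S₁ S₂ k) (hk0 : IsNonnegKernel S₁ S₂ k)
    (hu : ContinuousOn (fun x : ℝ × ℝ => u x.1 x.2) (S₁ ×ˢ S₂))
    (hp : ContinuousOn (fun x : ℝ × ℝ => p x.1 x.2) (S₁ ×ˢ S₂))
    (hq : ContinuousOn (fun x : ℝ × ℝ => q x.1 x.2) (S₁ ×ˢ S₂))
    (hu0 : ∀ t₁ ∈ S₁, ∀ t₂ ∈ S₂, 0 ≤ u t₁ t₂) (hp0 : ∀ t₁ ∈ S₁, ∀ t₂ ∈ S₂, 0 ≤ p t₁ t₂)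
    (hq0 : ∀ t₁ ∈ S₁, ∀ t₂ ∈ S₂, 0 ≤ q t₁ t₂)
    (hineq : ∀ t₁ ∈ S₁, ∀ t₂ ∈ S₂, u t₁ t₂ ≤ p t₁ t₂ + q t₁ t₂ *
      deltaIntegral₂ S₁ S₂ (fun s₁ s₂ => k t₁ t₂ s₁ s₂ * u s₁ s₂) t₁ t₂)
    {t₁ t₂ : ℝ} (ht₁ : t₁ ∈ S₁) (ht₂ : t₂ ∈ S₂) :
    u t₁ t₂ ≤ p t₁ t₂ + q t₁ t₂ * deltaIntegral₂ S₁ S₂ (coeff S₁ S₂ k p) t₁ t₂ *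
      deltaExp S₁ (fun s₁ => deltaIntegral S₂ (fun s₂ => coeff S₁ S₂ k q s₁ s₂) 0 t₂) t₁ 0 := by
  have reg : ∀ {v : ℝ → ℝ → ℝ}, ContinuousOn (fun x : ℝ × ℝ => v x.1 x.2) (S₁ ×ˢ S₂) →
      IsDeltaRegular₂ S₁ S₂ (coeff S₁ S₂ k v) := fun hv =>
    (isDeltaRegular₂_weightedCoeff hS₁ hS₂ hk hv).congr fun _ h₁ _ h₂ =>
      coeff_eq_weightedCoeff hS₁ hS₂ hk hv h₁ h₂
  have hc : ∀ r ∈ kappa S₁, deltaIntegral S₂ (fun s => coeff S₁ S₂ k q r s) 0 t₂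
      = ∫ s in Iio t₂, weightedCoeff S₁ S₂ k q r s ∂deltaMeasure S₂ := fun r hr => by
    rw [((reg hq).isDeltaRegular_right hr).deltaIntegral_eq hS₂ ht₂]
    exact integral_Iio_congr hS₂ fun s hs hst =>
      coeff_eq_weightedCoeff hS₁ hS₂ hk hq hr (mem_kappa_of_lt hs ht₂ hst)
  have hA : deltaIntegral₂ S₁ S₂ (coeff S₁ S₂ k p) t₁ t₂
      = ∫ r in Iio t₁, ∫ s in Iio t₂, weightedCoeff S₁ S₂ k p r s
          ∂deltaMeasure S₂ ∂deltaMeasure S₁ := by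
    rw [(reg hp).deltaIntegral₂_eq hS₁ hS₂ ht₁ ht₂]
    exact integral_Iio_congr hS₁ fun r hr hrt => integral_Iio_congr hS₂ fun s hs hst =>
      coeff_eq_weightedCoeff hS₁ hS₂ hk hp (mem_kappa_of_lt hr ht₁ hrt)
        (mem_kappa_of_lt hs ht₂ hst)
  have hexp := isExponential_deltaExp hS₁
    (((isDeltaRegular₂_weightedCoeff hS₁ hS₂ hk hq).isDeltaRegular_integral hS₂ ht₂).congr hc)
  have hle := fun r₁ h₁ r₂ h₂ => (hineq r₁ h₁ r₂ h₂).trans_eq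
    (congrArg (fun w => p r₁ r₂ + q r₁ r₂ * w)
      ((hk.cont.weighted hu).deltaIntegral₂_eq hS₁ hS₂ h₁ h₂ h₁ h₂))
  have key := integral_le_mul_exponential hS₁ hS₂ hk hk0 hu hp hq hu0 hp0 hq0 hle ht₁ ht₂ hc hexp
  rw [← hA] at key
  refine (hle t₁ ht₁ t₂ ht₂).trans (add_le_add le_rfl ?_)
  rw [mul_assoc]
  exact mul_le_mul_of_nonneg_left key (hq0 t₁ ht₁ t₂ ht₂)

end TimeScale

theorem theorem6p4 (T₁ T₂ : Set ℝ)
    (hT₁ : TimeScale.IsTimeScale T₁) (hT₂ : TimeScale.IsTimeScale T₂)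
    (h0₁ : (0 : ℝ) ∈ T₁) (h0₂ : (0 : ℝ) ∈ T₂)
    (hpos₁ : ∃ t ∈ T₁, 0 < t) (hpos₂ : ∃ t ∈ T₂, 0 < t)
    (S₁ S₂ : Set ℝ) (hS₁ : S₁ = TimeScale.half T₁) (hS₂ : S₂ = TimeScale.half T₂)
    (u p q : ℝ → ℝ → ℝ) (k : ℝ → ℝ → ℝ → ℝ → ℝ)
    (hu : ContinuousOn (fun x : ℝ × ℝ => u x.1 x.2) (S₁ ×ˢ S₂))
    (hp : ContinuousOn (fun x : ℝ × ℝ => p x.1 x.2) (S₁ ×ˢ S₂))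
    (hq : ContinuousOn (fun x : ℝ × ℝ => q x.1 x.2) (S₁ ×ˢ S₂))
    (hu0 : ∀ t₁ ∈ S₁, ∀ t₂ ∈ S₂, 0 ≤ u t₁ t₂)
    (hp0 : ∀ t₁ ∈ S₁, ∀ t₂ ∈ S₂, 0 ≤ p t₁ t₂)
    (hq0 : ∀ t₁ ∈ S₁, ∀ t₂ ∈ S₂, 0 ≤ q t₁ t₂)
    (hk : TimeScale.IsSmoothKernel S₁ S₂ k)
    (hk0 : ∀ t₁ ∈ S₁, ∀ t₂ ∈ S₂, ∀ s₁ ∈ S₁, ∀ s₂ ∈ S₂, 0 ≤ k t₁ t₂ s₁ s₂)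
    (hk1 : ∀ t₁ ∈ TimeScale.kappa S₁, ∀ t₂ ∈ S₂, ∀ s₁ ∈ S₁, ∀ s₂ ∈ S₂,
      0 ≤ TimeScale.partial₁ S₁ k t₁ t₂ s₁ s₂)
    (hk2 : ∀ t₁ ∈ S₁, ∀ t₂ ∈ TimeScale.kappa S₂, ∀ s₁ ∈ S₁, ∀ s₂ ∈ S₂,
      0 ≤ TimeScale.partial₂ S₂ k t₁ t₂ s₁ s₂)
    (hk12 : ∀ t₁ ∈ TimeScale.kappa S₁, ∀ t₂ ∈ TimeScale.kappa S₂, ∀ s₁ ∈ S₁, ∀ s₂ ∈ S₂,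
      0 ≤ TimeScale.partial₁₂ S₁ S₂ k t₁ t₂ s₁ s₂)
    (hineq : ∀ t₁ ∈ S₁, ∀ t₂ ∈ S₂,
      u t₁ t₂ ≤ p t₁ t₂ + q t₁ t₂ *
        TimeScale.deltaIntegral₂ S₁ S₂ (fun s₁ s₂ => k t₁ t₂ s₁ s₂ * u s₁ s₂) t₁ t₂)
    (a b A c : ℝ → ℝ → ℝ)
    (ha : a = TimeScale.coeff S₁ S₂ k p)
    (hb : b = TimeScale.coeff S₁ S₂ k q)
    (hA : A = fun t₁ t₂ => TimeScale.deltaIntegral₂ S₁ S₂ a t₁ t₂)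
    (hc : c = fun t₁ t₂ => TimeScale.deltaIntegral S₂ (fun s₂ => b t₁ s₂) 0 t₂) :
    ∀ t₁ ∈ S₁, ∀ t₂ ∈ S₂,
      u t₁ t₂ ≤ p t₁ t₂ + q t₁ t₂ * A t₁ t₂ *
        TimeScale.deltaExp S₁ (fun s₁ => c s₁ t₂) t₁ 0 := by
  subst hS₁ hS₂ ha hb hA hc
  intro t₁ ht₁ t₂ ht₂
  exact TimeScale.pachpatte (TimeScale.isHalfScale_half hT₁ h0₁)
    (TimeScale.isHalfScale_half hT₂ h0₂) hk ⟨hk0, hk1, hk2, hk12⟩ hu hp hq hu0 hp0 hq0 hineq ht₁ ht₂
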